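/- **Setting.** Let $q\ge 2$ be an integer and $\gamma>0$. A partition of length $N$ is a sequence $b=(b_1\le\dots\le b_N)$ of non-negative integers; $m(b,k)$ is the number of $j$ with $b_j=k$, and $M(b)!=\prod_k m(b,k)!$. Its root partition is $\lambda_N(b)=(b_1,q+b_2,\dots,q(N-1)+b_N)$. On $\big(\mathbb R+i[0,2\pi/\gamma)\big)^N$ with the measure $\prod_j e^{-x_j^2}dx_jdy_j$ ($z_j=x_j+iy_j$), and with $L^2$-norm $\|\cdot\|$, let $$\Psi_{b,N}(z)=\kappa_{b,N}\,m_b(e^{\gamma z_1},\dots,e^{\gamma z_N})\prod_{j<k}(e^{\gamma z_j}-e^{\gamma z_k})^q ,\qquad m_b(w)=\frac1{M(b)!}\sum_{\sigma\in S_N}\prod_j w_{\sigma(j)}^{b_j},$$ $$\kappa_{b,N}^{-1}=(-1)^{qN(N-1)/2}\sqrt{N!}\,\Big(\tfrac{2\pi^{3/2}}{\gamma}\Big)^{N/2}\exp\Big(\tfrac{\gamma^2}{2}\sum_{j}[q(j-1)+b_j]^2\Big).$$ Let $\varphi_k(z)=\sqrt{\gamma/(2\pi^{3/2})}\,e^{-\gamma^2k^2/2}e^{\gamma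 kz}$ and $\Phi_\lambda=(M(\lambda)!\,N!)^{-1/2}\sum_{\sigma\in S_N}(\operatorname{sgn}\sigma)^q\prod_j\varphi_{\lambda_j}(z_{\sigma(j)})$. For partitions of the same integer and of the same length $N$ write $\mu\preceq\lambda$ if $\sum_{j\ge i}\mu_j\le\sum_{j\ge i}\lambda_j$ for all $i$. A partition $\mu\preceq\lambda_N(b)$ has a renewal point at $s\in[1,N-1]$ if there are partitions $b',b''$ of lengths $s,N-s$ with $b=(b'_1,\dots,b'_s,b'_s+b''_1,\dots,b'_s+b''_{N-s})$ and partitions $\mu'\preceq\lambda_s(b')$, $\mu''\preceq\lambda_{N-s}(b'')$ with $\mu=(\mu'_1,\dots,\mu'_s,qs+b'_s+\mu''_1,\dots,qs+b'_s+\mu''_{N-s})$; it is irreducible if it has no renewal point. Let $\widehat\Psi_{b,N}=\sum_\mu\langle\Phi_\mu,\Psi_{b,N}\rangle\Phi_\mu$, the sum over irreducible $\mu\preceq\lambda_N(b)$. Put $$C_q(\gamma)=\gamma^2-2(4q+1)-\tfrac2q\ln\big(1-e^{-(4q+1)}\big)-\pi\sqrt{2/3}$$ and assume $C_q(\gamma)>0$.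 Let $\alpha_n=\|\widehat\Psi_{0,n}\|^2$ for $n\ge1$. **Claim.** There is a number $r\in(0,1)$, depending only on $q$ and $\gamma$, such that the following holds. The series $\sum_{n\ge1}\alpha_nz^n$ converges for $|z|<e^{C_q(\gamma)q}$, and $\mu:=\sum_{n\ge1}n\alpha_nr^n$ is finite and positive. For every $M\ge0$ and every partition $b^{(2)}$ of length $M$, put $b=(0,\dots,0,b^{(2)})$ of length $N$ and $C_N=\|\Psi_{b,N}\|^2$, for $N\ge\max\{1,M\}$. Then: 1. $\displaystyle \ln r^{-1}=\lim_{N\to\infty}\frac{\ln C_N}{N}=\sup_{N\ge \max\{1,M\}}\frac{\ln C_N}{N}>0$; in particular the growth rate $r^{-1}>1$ does not depend on $b^{(2)}$. 2. For $n\ge\max\{1,M\}$ let $\beta_n=\big\|\sum_\mu\langle\Phi_\mu,\Psi_{b,n}\rangle\Phi_\mu\big\|^2$, the sum over all $\mu\preceq\lambda_n(b)$ without a renewal point in $[1,n-M]$, and let $\beta_n=0$ for other $n$ (for $M\le1$ this is $\beta_n=\|\widehat\Psi_{b,n}\|^2$). Then $C_n=\sum_{1\le j\le n-M,\ j<n}\alpha_jC_{n-j}+\beta_n$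 for all $n\ge\max\{1,M\}$, and the power series with coefficients $\beta_n$ and with coefficients $\|\widehat\Psi_{b,n}\|^2$ ($n\ge\max\{1,M\}$) converge for $|z|<e^{C_q(\gamma)q}$. 3. With $\beta(r)=\sum_n\beta_nr^n$, one has $\big|C_nr^n-\beta(r)/\mu\big|=\mathcal O(R^{-n})$ as $n\to\infty$ for every $$0<R<\frac{e^{C_q(\gamma)q}}{r}\left(1+\frac{e^{-b^{(2)}_M}}{1-e^{-C_q(\gamma)q}}\right)^{-1},$$ where $b^{(2)}_M$ is the last entry of $b^{(2)}$ (and $0$ if $M=0$). -/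

import Mathlib

open MeasureTheory Filter Topology

namespace FQH

noncomputable section

/-! ### Partitions, dominance order, concatenation, renewal points

A partition of length `N` is a monotone map `Fin N → ℕ`; the index `j : Fin N` is zero-based. -/

/-- `M(b)! = ∏ₖ m(b,k)!`, where `m(b,k)` is the number of indices `j` with `b j = k`. -/
def multFactorial {N : ℕ} (b : Fin N → ℕ) : ℕ :=
  ∏ k ∈ Finset.univ.image b, (Finset.univ.filter fun j => b j = k).card.factorial

/-- The root partition `(b₁, q + b₂, …, q (N - 1) + b_N)`. -/
def rootPartition (q : ℕ) {N : ℕ} (b : Fin N → ℕ) : Fin N → ℕ :=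
  fun j => q * (j : ℕ) + b j

/-- `Dominated μ ν`: both are partitions of the same integer and `ν` dominates `μ`. -/
structure Dominated {N : ℕ} (μ ν : Fin N → ℕ) : Prop where
  mono_left : Monotone μ
  mono_right : Monotone ν
  sum_eq : ∑ j, μ j = ∑ j, ν j
  tail_le : ∀ i, ∑ j ∈ Finset.Ici i, μ j ≤ ∑ j ∈ Finset.Ici i, ν j

/-- The last entry of a finite sequence (`0` for the empty sequence). -/
def lastEntry {N : ℕ} (b : Fin N → ℕ) : ℕ :=
  if h : 0 < N then b ⟨N - 1, Nat.sub_lt h Nat.one_pos⟩ else 0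

/-- `(b₁, …, b_{N₁}, b_{N₁} + b'₁, …, b_{N₁} + b'_{N₂})`. -/
def compose {N₁ N₂ : ℕ} (b : Fin N₁ → ℕ) (b' : Fin N₂ → ℕ) : Fin (N₁ + N₂) → ℕ :=
  Fin.append b fun j => lastEntry b + b' j

/-- The concatenation `μ ∪ μ'` of partitions dominated by the root partitions of
`b : Fin N₁ → ℕ` and of a second sequence: the second is shifted by `q N₁ + b_{N₁}`. -/
def concat (q : ℕ) {N₁ N₂ : ℕ} (b μ : Fin N₁ → ℕ) (μ' : Fin N₂ → ℕ) : Fin (N₁ + N₂) → ℕ :=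
  Fin.append μ fun j => q * N₁ + lastEntry b + μ' j

/-- `μ` (dominated by the root partition of `b`) has a renewal point at `N₁ ∈ [1, N - 1]`. -/
def HasRenewalPoint (q : ℕ) {N : ℕ} (b μ : Fin N → ℕ) (N₁ : ℕ) : Prop :=
  1 ≤ N₁ ∧ ∃ (N₂ : ℕ) (h : N = N₁ + N₂), 1 ≤ N₂ ∧
    ∃ (b₁ μ₁ : Fin N₁ → ℕ) (b₂ μ₂ : Fin N₂ → ℕ),
      Monotone b₁ ∧ Monotone b₂ ∧
      Dominated μ₁ (rootPartition q b₁) ∧ Dominated μ₂ (rootPartition q b₂) ∧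
      b = compose b₁ b₂ ∘ Fin.cast h ∧ μ = concat q b₁ μ₁ μ₂ ∘ Fin.cast h

/-- No renewal point at all. -/
def Irred (q : ℕ) {N : ℕ} (b μ : Fin N → ℕ) : Prop :=
  ∀ s, ¬ HasRenewalPoint q b μ s

open Classical in
/-- The finite set of all partitions dominated by the root partition of `b`. -/
def dominatedSet (q : ℕ) {N : ℕ} (b : Fin N → ℕ) : Finset (Fin N → ℕ) :=
  (Fintype.piFinset fun _ => Finset.range (∑ j, rootPartition q b j + 1)).filter
    fun μ => Dominated μ (rootPartition q b)

theorem mem_dominatedSet (q : ℕ) {N : ℕ} (b μ : Fin N → ℕ) :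
    μ ∈ dominatedSet q b ↔ Dominated μ (rootPartition q b) := by
  classical
  unfold dominatedSet
  rw [Finset.mem_filter, Fintype.mem_piFinset]
  refine ⟨fun h => h.2, fun h => ⟨fun j => ?_, h⟩⟩
  rw [Finset.mem_range, ← h.sum_eq]
  exact Nat.lt_succ_of_le (Finset.single_le_sum (fun i _ => Nat.zero_le (μ i)) (Finset.mem_univ j))

/-! ### The cylinder, its orbitals and the many-particle Hilbert space norm -/

/-- The fundamental domain `ℝ + i [0, 2π/γ)` of the cylinder. -/
def strip (γ : ℝ) : Set ℂ := {z | 0 ≤ z.im ∧ z.im < 2 * Real.pi / γ}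

/-- `exp (-x²) dx dy` on the cylinder. -/
def orbitalMeasure (γ : ℝ) : Measure ℂ :=
  (volume.restrict (strip γ)).withDensity fun z => ENNReal.ofReal (Real.exp (-z.re ^ 2))

def manyBodyMeasure (γ : ℝ) (N : ℕ) : Measure (Fin N → ℂ) :=
  Measure.pi fun _ => orbitalMeasure γ

/-- The scalar product of the `N`-particle space, as a subspace of `L²`. -/
def braket (γ : ℝ) {N : ℕ} (f g : (Fin N → ℂ) → ℂ) : ℂ :=
  ∫ z, (starRingEnd ℂ) (f z) * g z ∂manyBodyMeasure γ N

/-- The squared norm of the `N`-particle space. -/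
def normSq (γ : ℝ) {N : ℕ} (f : (Fin N → ℂ) → ℂ) : ℝ :=
  ∫ z, ‖f z‖ ^ 2 ∂manyBodyMeasure γ N

/-- The orbital `φₖ(z) = √(γ / (2 π^{3/2})) exp (-γ² k² / 2) exp (γ z k)`. -/
def orbital (γ : ℝ) (k : ℕ) (z : ℂ) : ℂ :=
  ((Real.sqrt (γ / (2 * Real.pi ^ (3 / 2 : ℝ))) * Real.exp (-(γ ^ 2 * (k : ℝ) ^ 2 / 2)) : ℝ) : ℂ) *
    Complex.exp (γ * z * k)

/-- The normalized Slater determinant (`q` odd) or permanent (`q` even) `Φ_μ`. -/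
def slater (q : ℕ) (γ : ℝ) {N : ℕ} (μ : Fin N → ℕ) (z : Fin N → ℂ) : ℂ :=
  ((1 / Real.sqrt (multFactorial μ * N.factorial) : ℝ) : ℂ) *
    ∑ σ : Equiv.Perm (Fin N), (((Equiv.Perm.sign σ : ℤ) : ℂ)) ^ q *
      ∏ j, orbital γ (μ j) (z (σ j))

/-! ### The wavefunctions -/

/-- The monomial symmetric polynomial `m_b`. -/
def monomialSymm {N : ℕ} (b : Fin N → ℕ) (w : Fin N → ℂ) : ℂ :=
  (1 / (multFactorial b : ℂ)) * ∑ σ : Equiv.Perm (Fin N), ∏ j, w (σ j) ^ b j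

/-- The normalization constant `κ_{b,N}`. -/
def kappa (q : ℕ) (γ : ℝ) {N : ℕ} (b : Fin N → ℕ) : ℝ :=
  1 / ((-1) ^ (q * (N * (N - 1) / 2)) * Real.sqrt N.factorial *
    Real.sqrt (2 * Real.pi ^ (3 / 2 : ℝ) / γ) ^ N *
    Real.exp (γ ^ 2 / 2 * ∑ j, ((rootPartition q b j : ℕ) : ℝ) ^ 2))

/-- The fractional quantum Hall wavefunction `Ψ_{b,N}` on the cylinder. -/
def psi (q : ℕ) (γ : ℝ) {N : ℕ} (b : Fin N → ℕ) (z : Fin N → ℂ) : ℂ :=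
  (kappa q γ b : ℂ) * monomialSymm b (fun j => Complex.exp (γ * z j)) *
    ∏ j, ∏ k ∈ Finset.Ioi j, (Complex.exp (γ * z j) - Complex.exp (γ * z k)) ^ q

/-- The expansion coefficient `h_b(μ) = ⟨Φ_μ, Ψ_{b,N}⟩` in the occupation basis. -/
def coeff (q : ℕ) (γ : ℝ) {N : ℕ} (b μ : Fin N → ℕ) : ℂ :=
  braket γ (slater q γ μ) (psi q γ b)

open Classical in
/-- The part of the expansion of `Ψ_{b,N}` in the occupation basis that is carried by the
partitions, dominated by the root partition of `b`, which satisfy `P`. -/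
def psiPart (q : ℕ) (γ : ℝ) {N : ℕ} (b : Fin N → ℕ) (P : (Fin N → ℕ) → Prop)
    (z : Fin N → ℂ) : ℂ :=
  ∑ μ ∈ (dominatedSet q b).filter P, coeff q γ b μ * slater q γ μ z

/-- The irreducible contribution `Ψ̂_{b,N}`. -/
def psiHat (q : ℕ) (γ : ℝ) {N : ℕ} (b : Fin N → ℕ) : (Fin N → ℂ) → ℂ :=
  psiPart q γ b (Irred q b)

/-! ### Laughlin state in the bulk, fixed boundary block `b₂` on the right -/

/-- `(0, …, 0, b₂)` of length `N`; it is used for `M ≤ N` only. -/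
def padded {M : ℕ} (b₂ : Fin M → ℕ) (N : ℕ) : Fin N → ℕ :=
  fun j => if h : N - M ≤ (j : ℕ) then b₂ ⟨j - (N - M), by have := j.2; omega⟩ else 0

/-- `C_N = ‖Ψ_{b,N}‖²` for `b = (0, …, 0, b₂)`. -/
def normC (q : ℕ) (γ : ℝ) {M : ℕ} (b₂ : Fin M → ℕ) (N : ℕ) : ℝ :=
  normSq γ (psi q γ (padded b₂ N))

/-- `αₙ = ‖Ψ̂_{0,n}‖²` for `n ≥ 1` (and `0` for `n = 0`). -/
def alpha (q : ℕ) (γ : ℝ) (n : ℕ) : ℝ :=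
  if 1 ≤ n then normSq γ (psiHat q γ (0 : Fin n → ℕ)) else 0

/-- `‖Ψ̂_{b,n}‖²` for `b = (0, …, 0, b₂)`, `n ≥ 1`, `n ≥ M` (and `0` for other `n`). -/
def betaHat (q : ℕ) (γ : ℝ) {M : ℕ} (b₂ : Fin M → ℕ) (n : ℕ) : ℝ :=
  if 1 ≤ n ∧ M ≤ n then normSq γ (psiHat q γ (padded b₂ n)) else 0

/-- The squared norm of the part of `Ψ_{b,n}`, `b = (0, …, 0, b₂)`, that has no renewal point
in `[1, n - M]`, for `n ≥ 1`, `n ≥ M` (and `0` for other `n`).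
For `M ≤ 1` this is `betaHat`. -/
def beta (q : ℕ) (γ : ℝ) {M : ℕ} (b₂ : Fin M → ℕ) (n : ℕ) : ℝ :=
  if 1 ≤ n ∧ M ≤ n then
    normSq γ (psiPart q γ (padded b₂ n) fun μ =>
      ∀ s, s ≤ n - M → ¬ HasRenewalPoint q (padded b₂ n) μ s)
  else 0

theorem beta_eq_betaHat (q : ℕ) (γ : ℝ) {M : ℕ} (hM : M ≤ 1) (b₂ : Fin M → ℕ) (n : ℕ) :
    beta q γ b₂ n = betaHat q γ b₂ n := by
  have key : (fun μ => ∀ s, s ≤ n - M → ¬ HasRenewalPoint q (padded b₂ n) μ s) =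
      Irred q (padded b₂ n) := by
    funext μ
    refine propext ⟨fun h s hs => ?_, fun h s _ => h s⟩
    obtain ⟨-, N₂, hN, h2, -⟩ := id hs
    exact h s (by omega) hs
  unfold beta betaHat psiHat
  rw [key]

/-- The constant `C_q(γ)`. -/
def decayConst (q : ℕ) (γ : ℝ) : ℝ :=
  (γ ^ 2 - 2 * (4 * q + 1)) - 2 * (q : ℝ)⁻¹ * Real.log (1 - Real.exp (-(4 * q + 1)))
    - Real.pi * Real.sqrt (2 / 3)

/-- `exp (C_q(γ) q) / r * (1 / (1 + exp (-l) / (1 - exp (-C_q(γ) q))))`. -/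
def rateBound (q : ℕ) (γ r : ℝ) (l : ℕ) : ℝ :=
  Real.exp (decayConst q γ * q) / r *
    (1 / (1 + Real.exp (-(l : ℝ)) / (1 - Real.exp (-(decayConst q γ * q)))))

end

end FQH

/-!
Expanding `m_b(w) ∏_{j<k} (wₖ - wⱼ)^q` in monomials and normalizing each `∏ⱼ exp (γ zⱼ νⱼ)` to a
product of orbitals turns squared norms into combinatorial sums: the orbitals are orthonormal, so
the squared norm of the part of `Ψ_b` carried by a set of partitions is the sum of the weights
`[w^μ]² / M(μ)! · exp (-γ² (∑ λⱼ² - ∑ μⱼ²))`, where `λ` is the root partition (`normSq_psiPart`).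

*Renewal structure.* A partition `μ` has a renewal point at `s` exactly where its tail sum
reaches that of the root partition (`hasRenewalPoint_iff`). Only the factor of top degree in the
last variables contributes there, so weights are multiplicative under concatenation
(`weight_concat`). Splitting at the first renewal point gives the recursion
`C_n = ∑ αⱼ C_{n-j} + βₙ` (`blockWeight_eq`, `normC_recursion`).

*Decay of the irreducible weights.* Without renewal points in `[1, L]` the tail sums of `μ` lose
at least `L` units in total, which costs at least `q L` in `∑ λⱼ² - ∑ μⱼ²`
(`mul_displacement_le_energyGap`). The number of terms is controlled by evaluating
`m_b ∏ (wₖ + wⱼ)^q` at `wⱼ = 2^j`, where it exceeds its leading term by a factor of at most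
`(2 e^q)^N` (`eval_majorantPoly_le`). Together this bounds the weight by
`(2 e^q)^{2N} (4 e^{-γ² q})^L` (`partWeight_no_renewal_le`). Since
`C_q(γ) ≤ γ² - 8q - 2` (`decayConst_le`), the resulting power series converge at
`exp (C_q(γ) q)`, and the ratio of the geometric bound is still tiny there (`ratio_small`).

*The number `r`.* As `α₁ = 1` and `α₂ > 0`, the sum of the `αₙ` exceeds one, so `∑ αₙ rⁿ = 1`
for some `r ∈ (0, 1)` (`exists_hasSum_alpha_mul_pow`).

*The limit.* With `fₙ = αₙ rⁿ`, `T` the tails of `f`, and `v` the increments of `uₙ = C_n rⁿ`, the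
renewal equation becomes `T * v = (βₙ rⁿ)` (`sum_distTail_mul_increment`). The tails weighted with
`wᵏ`, `w = exp (C_q(γ) q) / r`, add up to `T₀ = 1` plus less than one. Hence `T` can be inverted by
a contraction, and `v` is summable with the weights `wⁿ` (`summable_increment`). So `uₙ` converges
to `∑ βₙ rⁿ / ∑ Tₖ = β(r) / μ` at the rate `w⁻ⁿ` (`abs_sub_renewal_limit_le`), which is stronger than
the rate claimed, as the additional factor in the bound on `R` is less than one.

*The supremum.* That `C_N ≤ r⁻ᴺ` holds without a constant follows from comparing `b` with the
zero sequence, for which it is immediate from the recursion. Closing the first jump of `b` costs at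
most the irreducible weights of the blocks that straddle it, which are small because a jump costs
energy (`irredWeight_jump_le`). It gains the irreducible weight of a block of two particles without
a jump, which is at least that of the partition `(1, q - 1)` (`exp_le_irredWeight_two`). The gain
beats the loss (`renewal_compare`), so the total weight does not decrease until `b` is constant
(`blockWeight_le_zero`).
-/

namespace FQH

open Finset

/-! ### Rearrangements of finite sequences -/

/-- The finite set of all distinct rearrangements of a finite sequence. -/
def rearr {N : ℕ} (b : Fin N → ℕ) : Finset (Fin N → ℕ) :=
  univ.image fun σ : Equiv.Perm (Fin N) => b ∘ σ

theorem mem_rearr {N : ℕ} {b β : Fin N → ℕ} :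
    β ∈ rearr b ↔ ∃ σ : Equiv.Perm (Fin N), b ∘ σ = β := by
  simp [rearr]

theorem self_mem_rearr {N : ℕ} (b : Fin N → ℕ) : b ∈ rearr b :=
  mem_rearr.2 ⟨1, rfl⟩

theorem multFactorial_pos {N : ℕ} (b : Fin N → ℕ) : 0 < multFactorial b :=
  Finset.prod_pos fun _ _ => Nat.factorial_pos _

theorem card_stabilizer {N : ℕ} (b : Fin N → ℕ) :
    #{σ : Equiv.Perm (Fin N) | b ∘ σ = b} = multFactorial b := by
  classical
  have h := DomMulAct.stabilizer_card' b
  rw [Fintype.card_subtype] at h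
  rw [h, multFactorial]
  refine Finset.prod_congr rfl fun k _ => ?_
  rw [Fintype.card_subtype]

theorem card_rearr_fiber {N : ℕ} {b β : Fin N → ℕ} (hβ : β ∈ rearr b) :
    #{σ : Equiv.Perm (Fin N) | b ∘ σ = β} = multFactorial b := by
  obtain ⟨τ, rfl⟩ := mem_rearr.1 hβ
  rw [← card_stabilizer b]
  refine Finset.card_bij' (fun σ _ => σ * τ⁻¹) (fun σ _ => σ * τ) ?_ ?_ ?_ ?_
  · intro σ hσ
    simp only [mem_filter, mem_univ, true_and] at hσ ⊢
    funext j
    have := congrFun hσ (τ⁻¹ j)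
    simpa using this
  · intro σ hσ
    simp only [mem_filter, mem_univ, true_and] at hσ ⊢
    funext j
    have := congrFun hσ (τ j)
    simpa using this
  · intro σ _; simp
  · intro σ _; simp

/-- A sum over all permutations counts every distinct rearrangement `M(b)!` times. -/
theorem sum_perm_eq {N : ℕ} {E : Type*} [AddCommMonoid E] (b : Fin N → ℕ)
    (f : (Fin N → ℕ) → E) :
    ∑ σ : Equiv.Perm (Fin N), f (b ∘ σ) = multFactorial b • ∑ β ∈ rearr b, f β := by
  rw [Finset.sum_comp f (fun σ : Equiv.Perm (Fin N) => b ∘ σ), Finset.smul_sum]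
  refine Finset.sum_congr rfl fun β hβ => ?_
  rw [card_rearr_fiber hβ]

theorem sum_perm_inv_eq {N : ℕ} {E : Type*} [AddCommMonoid E] (b : Fin N → ℕ)
    (f : (Fin N → ℕ) → E) :
    ∑ σ : Equiv.Perm (Fin N), f (b ∘ ⇑σ⁻¹) = multFactorial b • ∑ β ∈ rearr b, f β := by
  rw [← sum_perm_eq]
  exact Fintype.sum_equiv (Equiv.inv _) _ _ fun σ => rfl

theorem card_rearr_mul {N : ℕ} (b : Fin N → ℕ) :
    multFactorial b * #(rearr b) = N.factorial := by
  have h := sum_perm_eq b (fun _ => (1 : ℕ))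
  simp only [sum_const, smul_eq_mul, mul_one, card_univ, Fintype.card_perm, Fintype.card_fin] at h
  exact h.symm

theorem sum_comp_rearr {N : ℕ} {E : Type*} [AddCommMonoid E] {b β : Fin N → ℕ} (hβ : β ∈ rearr b)
    (g : ℕ → E) : ∑ j, g (β j) = ∑ j, g (b j) := by
  obtain ⟨σ, rfl⟩ := mem_rearr.1 hβ
  exact Equiv.sum_comp σ fun j => g (b j)

theorem rearr_eq_of_mem {N : ℕ} {b β : Fin N → ℕ} (hβ : β ∈ rearr b) : rearr β = rearr b := by
  obtain ⟨τ, rfl⟩ := mem_rearr.1 hβ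
  ext γ
  simp only [mem_rearr]
  constructor
  · rintro ⟨σ, rfl⟩
    exact ⟨τ * σ, rfl⟩
  · rintro ⟨σ, rfl⟩
    exact ⟨τ⁻¹ * σ, by funext j; simp⟩

theorem eq_of_mem_rearr_of_monotone {N : ℕ} {b β : Fin N → ℕ} (hβ : β ∈ rearr b)
    (hb : Monotone b) (hm : Monotone β) : β = b := by
  obtain ⟨σ, rfl⟩ := mem_rearr.1 hβ
  have := Tuple.unique_monotone (f := b) (σ := σ) (τ := 1) hm (by simpa using hb)
  simpa using this

theorem mem_rearr_sort {N : ℕ} (ν : Fin N → ℕ) : ν ∈ rearr (ν ∘ Tuple.sort ν) :=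
  mem_rearr.2 ⟨(Tuple.sort ν)⁻¹, by funext j; simp⟩

/-- Two sequences of the same length are rearrangements of each other as soon as they take
every value equally often. -/
theorem mem_rearr_of_count {N : ℕ} {b β : Fin N → ℕ}
    (h : ∀ k, #{j | β j = k} = #{j | b j = k}) : β ∈ rearr b := by
  have e : ∀ k, Nonempty ({j // β j = k} ≃ {j // b j = k}) := fun k =>
    Fintype.card_eq.1 (by rw [Fintype.card_subtype, Fintype.card_subtype, h k])
  refine mem_rearr.2 ⟨Equiv.ofFiberEquiv fun k => (e k).some, ?_⟩
  funext j
  exact Equiv.ofFiberEquiv_map _ j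

theorem card_eq_of_mem_rearr {N : ℕ} {b β : Fin N → ℕ} (h : β ∈ rearr b) (k : ℕ) :
    #{j | β j = k} = #{j | b j = k} := by
  have := sum_comp_rearr h (fun x => if x = k then 1 else 0)
  simpa only [card_filter] using this

/-! ### Tail sums -/

/-- The sum of the entries with (zero-based) index at least `i`. -/
def tail {N : ℕ} (μ : Fin N → ℕ) (i : ℕ) : ℕ := ∑ j : Fin N, if i ≤ (j : ℕ) then μ j else 0

theorem tail_zero {N : ℕ} (μ : Fin N → ℕ) : tail μ 0 = ∑ j, μ j := by simp [tail]

theorem tail_eq_zero {N : ℕ} (μ : Fin N → ℕ) {i : ℕ} (hi : N ≤ i) : tail μ i = 0 := by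
  refine Finset.sum_eq_zero fun j _ => if_neg ?_
  have := j.2
  omega

theorem tail_fin {N : ℕ} (μ : Fin N → ℕ) (i : Fin N) : ∑ j ∈ Ici i, μ j = tail μ i := by
  have h : Ici i = ({j : Fin N | (i : ℕ) ≤ j} : Finset (Fin N)) :=
    Finset.ext fun j => by
      rw [Finset.mem_Ici, Finset.mem_filter, Fin.le_def, and_iff_right (Finset.mem_univ j)]
  rw [h, Finset.sum_filter, tail]

theorem tail_eq_add_tail_succ {N : ℕ} (μ : Fin N → ℕ) (i : Fin N) :
    tail μ i = μ i + tail μ (i + 1) := by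
  have : μ i = ∑ j : Fin N, if j = i then μ j else 0 := by simp
  rw [this, tail, tail, ← Finset.sum_add_distrib]
  refine Finset.sum_congr rfl fun j _ => ?_
  rcases lt_trichotomy j i with h | h | h
  · have h1 : ¬ (i : ℕ) ≤ j := by omega
    have h2 : ¬ (i : ℕ) + 1 ≤ j := by omega
    simp [h1, h2, h.ne]
  · subst h; simp
  · have h1 : (i : ℕ) ≤ j := by omega
    have h2 : (i : ℕ) + 1 ≤ j := by omega
    simp [h1, h2, h.ne']

theorem tail_append {s t : ℕ} (f : Fin s → ℕ) (g : Fin t → ℕ) (i : ℕ) :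
    tail (Fin.append f g) i = tail f i + tail g (i - s) := by
  simp only [tail, Fin.sum_univ_add, Fin.append_left, Fin.append_right, Fin.val_castAdd,
    Fin.val_natAdd]
  congr 1
  refine Finset.sum_congr rfl fun j _ => ?_
  congr 1
  exact propext (by omega)

theorem tail_add {N : ℕ} (f g : Fin N → ℕ) (i : ℕ) :
    tail (fun j => f j + g j) i = tail f i + tail g i := by
  simp only [tail, ← Finset.sum_add_distrib]
  refine Finset.sum_congr rfl fun j _ => ?_
  split_ifs <;> simp

theorem dominated_iff {N : ℕ} (μ ν : Fin N → ℕ) :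
    Dominated μ ν ↔ Monotone μ ∧ Monotone ν ∧ tail μ 0 = tail ν 0 ∧
      ∀ i, tail μ i ≤ tail ν i := by
  constructor
  · rintro ⟨h1, h2, h3, h4⟩
    refine ⟨h1, h2, by simpa [tail_zero] using h3, fun i => ?_⟩
    by_cases hi : i < N
    · simpa [tail_fin] using h4 ⟨i, hi⟩
    · rw [tail_eq_zero μ (by omega)]; exact Nat.zero_le _
  · rintro ⟨h1, h2, h3, h4⟩
    exact ⟨h1, h2, by simpa [tail_zero] using h3, fun i => by simpa [tail_fin] using h4 i⟩

/-- The nondecreasing rearrangement has the largest tail sums. Up to a constant, the tail sum is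
bounded by the sum of the excesses over the threshold `b i`, which does not depend on the order. -/
theorem tail_le_of_mem_rearr {N : ℕ} {b β : Fin N → ℕ} (hb : Monotone b) (hβ : β ∈ rearr b)
    (i : ℕ) : tail β i ≤ tail b i := by
  by_cases hi : i < N
  swap
  · rw [tail_eq_zero β (by omega)]; exact Nat.zero_le _
  set v := b ⟨i, hi⟩
  have e := sum_comp_rearr hβ (fun x => x - v)
  have h1 : tail β i ≤ ∑ j, (β j - v) + ∑ j : Fin N, (if i ≤ (j : ℕ) then v else 0) := by
    rw [tail, ← Finset.sum_add_distrib]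
    refine Finset.sum_le_sum fun j _ => ?_
    split_ifs <;> omega
  have h2 : tail b i = ∑ j, (b j - v) + ∑ j : Fin N, (if i ≤ (j : ℕ) then v else 0) := by
    rw [tail, ← Finset.sum_add_distrib]
    refine Finset.sum_congr rfl fun j _ => ?_
    split_ifs with h
    · have : v ≤ b j := hb (Fin.le_def.2 h)
      omega
    · have : b j ≤ v := hb (Fin.le_def.2 (by simp only; omega))
      omega
  omega

/-- If a rearrangement of `append f g`, all entries of `f` being below those of `g`, has the
largest possible tail sum then it rearranges `f` and `g` separately. -/
theorem append_mem_rearr_iff {s t : ℕ} {f β₁ : Fin s → ℕ} {g β₂ : Fin t → ℕ} {v : ℕ}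
    (hf : ∀ j, f j ≤ v) (hg : ∀ j, v ≤ g j) :
    (Fin.append β₁ β₂ ∈ rearr (Fin.append f g) ∧ ∑ j, β₂ j = ∑ j, g j) ↔
      β₁ ∈ rearr f ∧ β₂ ∈ rearr g := by
  have split : ∀ (k : ℕ) (p : Fin s → ℕ) (q : Fin t → ℕ),
      #{j | Fin.append p q j = k} = #{j | p j = k} + #{j | q j = k} := by
    intro k p q
    simp only [card_filter, Fin.sum_univ_add, Fin.append_left, Fin.append_right]
  constructor
  · rintro ⟨h, hsum⟩
    have key : ∀ w : ℕ → ℕ,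
        ∑ j, w (β₁ j) + ∑ j, w (β₂ j) = ∑ j, w (f j) + ∑ j, w (g j) := by
      intro w
      simpa only [Fin.sum_univ_add, Fin.append_left, Fin.append_right] using sum_comp_rearr h w
    -- all entries of `β₁` are at most `v` and all those of `β₂` at least `v`: compare the sums of
    -- the excesses over `v`
    have h0 : ∑ j, (f j - v) = 0 := Finset.sum_eq_zero fun j _ => Nat.sub_eq_zero_of_le (hf j)
    have h1 : ∑ j, g j = ∑ j, (g j - v) + ∑ _j : Fin t, v := by
      rw [← Finset.sum_add_distrib]
      exact Finset.sum_congr rfl fun j _ => (Nat.sub_add_cancel (hg j)).symm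
    have h2 : ∑ j, β₂ j + ∑ j, (v - β₂ j) = ∑ j, (β₂ j - v) + ∑ _j : Fin t, v := by
      rw [← Finset.sum_add_distrib, ← Finset.sum_add_distrib]
      exact Finset.sum_congr rfl fun j _ => by omega
    have h3 := key fun x => x - v
    have h4 : ∑ j, (β₁ j - v) = 0 := by omega
    have h5 : ∑ j, (v - β₂ j) = 0 := by omega
    have l1 : ∀ j, β₁ j ≤ v := fun j => by
      have := Finset.sum_eq_zero_iff.1 h4 j (mem_univ j)
      omega
    have l2 : ∀ j, v ≤ β₂ j := fun j => by
      have := Finset.sum_eq_zero_iff.1 h5 j (mem_univ j)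
      omega
    have c2 : ∀ k, #{j | β₂ j = k} = #{j | g j = k} := by
      intro k
      rcases lt_trichotomy k v with hk | hk | hk
      · rw [card_eq_zero.2, card_eq_zero.2]
        · exact filter_eq_empty_iff.2 fun j _ => by have := hg j; omega
        · exact filter_eq_empty_iff.2 fun j _ => by have := l2 j; omega
      · -- the entries of `β₂` and `g` equal to `v` are those that do not exceed it
        subst hk
        have e := key fun x => if x ≤ k then 0 else 1
        rw [Finset.sum_eq_zero fun j _ => if_pos (l1 j),
          Finset.sum_eq_zero fun j _ => if_pos (hf j)] at e
        have e1 : ∀ p : Fin t → ℕ, (∀ j, k ≤ p j) →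
            #{j | p j = k} + ∑ j, (if p j ≤ k then 0 else 1) = t := by
          intro p hp
          rw [card_filter, ← Finset.sum_add_distrib,
            Finset.sum_congr rfl (g := fun _ => 1)]
          · simp
          · intro j _
            have := hp j
            split_ifs <;> omega
        have := e1 _ l2
        have := e1 _ hg
        omega
      · have e := key fun x => if x = k then 1 else 0
        simp only [← card_filter] at e
        have e1 : #{j | β₁ j = k} = 0 :=
          card_eq_zero.2 (filter_eq_empty_iff.2 fun j _ => by have := l1 j; omega)
        have e2 : #{j | f j = k} = 0 :=
          card_eq_zero.2 (filter_eq_empty_iff.2 fun j _ => by have := hf j; omega)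
        omega
    refine ⟨mem_rearr_of_count fun k => ?_, mem_rearr_of_count c2⟩
    have := card_eq_of_mem_rearr h k
    rw [split, split, c2] at this
    omega
  · rintro ⟨h1, h2⟩
    refine ⟨mem_rearr_of_count fun k => ?_, by simpa using sum_comp_rearr h2 id⟩
    rw [split, split, card_eq_of_mem_rearr h1, card_eq_of_mem_rearr h2]

/-! ### The polynomial part of the wavefunctions and its coefficients -/

/-- A sequence of exponents as a finitely supported function. -/
noncomputable def expo {N : ℕ} (μ : Fin N → ℕ) : Fin N →₀ ℕ := Finsupp.equivFunOnFinite.symm μ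

@[simp] theorem expo_apply {N : ℕ} (μ : Fin N → ℕ) (j : Fin N) : expo μ j = μ j := rfl

@[simp] theorem expo_coe {N : ℕ} (m : Fin N →₀ ℕ) : expo (m : Fin N → ℕ) = m := by
  ext j; rfl

theorem expo_injective {N : ℕ} : Function.Injective (expo (N := N)) :=
  Finsupp.equivFunOnFinite.symm.injective

/-- The monomial symmetric polynomial of `b`. -/
noncomputable def monomialPoly {N : ℕ} (b : Fin N → ℕ) : MvPolynomial (Fin N) ℝ :=
  ∑ β ∈ rearr b, MvPolynomial.monomial (expo β) 1

/-- The `q`-th power of the Vandermonde product. -/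
noncomputable def vandPoly (q N : ℕ) : MvPolynomial (Fin N) ℝ :=
  ∏ j, ∏ k ∈ Ioi j, (MvPolynomial.X k - MvPolynomial.X j) ^ q

/-- The coefficient of `∏ⱼ wⱼ ^ μⱼ` in `m_b(w) ∏_{j<k} (wₖ - wⱼ)^q`. -/
noncomputable def monCoeff (q : ℕ) {N : ℕ} (b μ : Fin N → ℕ) : ℝ :=
  MvPolynomial.coeff (expo μ) (monomialPoly b * vandPoly q N)

/-! ### Extracting the part of a given degree in the last variables -/

/-- The substitution which multiplies every variable of index at least `i` by a new variable `T`. -/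
noncomputable def tailHom (N i : ℕ) :
    MvPolynomial (Fin N) ℝ →ₐ[ℝ] Polynomial (MvPolynomial (Fin N) ℝ) :=
  MvPolynomial.aeval fun j =>
    Polynomial.C (MvPolynomial.X j) * Polynomial.X ^ (if i ≤ (j : ℕ) then 1 else 0)

theorem tailHom_X {N i : ℕ} (j : Fin N) : tailHom N i (MvPolynomial.X j) =
    Polynomial.C (MvPolynomial.X j) * Polynomial.X ^ (if i ≤ (j : ℕ) then 1 else 0) := by
  simp [tailHom]

theorem tailHom_monomial {N i : ℕ} (m : Fin N →₀ ℕ) (c : ℝ) :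
    tailHom N i (MvPolynomial.monomial m c) =
      Polynomial.monomial (tail m i) (MvPolynomial.monomial m c) := by
  rw [tailHom, MvPolynomial.aeval_monomial, Finsupp.prod_fintype _ _ (fun _ => pow_zero _)]
  simp only [mul_pow, Finset.prod_mul_distrib, ← pow_mul, Finset.prod_pow_eq_pow_sum,
    ← Polynomial.C_pow, ← map_prod]
  have h1 : ∑ j : Fin N, (if i ≤ (j : ℕ) then 1 else 0) * m j = tail m i := by
    simp [tail, ite_mul]
  rw [h1, ← mul_assoc, ← Polynomial.C_mul_X_pow_eq_monomial]
  congr 1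
  rw [MvPolynomial.monomial_eq (s := m), Finsupp.prod_fintype _ _ (fun _ => pow_zero _),
    Polynomial.C_mul]
  rfl

/-- The coefficient of `T^d` under `tailHom` is the part of degree `d` in the variables of index at
least `i`. -/
theorem coeff_coeff_tailHom {N i : ℕ} (p : MvPolynomial (Fin N) ℝ) (d : ℕ) (m : Fin N →₀ ℕ) :
    MvPolynomial.coeff m ((tailHom N i p).coeff d) =
      if tail m i = d then MvPolynomial.coeff m p else 0 := by
  classical
  induction p using MvPolynomial.induction_on' with
  | monomial u a =>
    rw [tailHom_monomial, Polynomial.coeff_monomial]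
    split_ifs with h1 h2 h2
    · rfl
    · rw [MvPolynomial.coeff_monomial, if_neg]
      rintro rfl
      exact h2 h1
    · rw [MvPolynomial.coeff_monomial, if_neg, MvPolynomial.coeff_zero]
      rintro rfl
      exact h1 h2
    · simp
  | add p q hp hq =>
    rw [map_add, Polynomial.coeff_add, MvPolynomial.coeff_add, hp, hq]
    split_ifs <;> simp

theorem tail_le_of_natDegree_le {N i d : ℕ} {p : MvPolynomial (Fin N) ℝ}
    (h : (tailHom N i p).natDegree ≤ d) {μ : Fin N → ℕ}
    (hμ : MvPolynomial.coeff (expo μ) p ≠ 0) : tail μ i ≤ d := by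
  by_contra hc
  have h1 := coeff_coeff_tailHom (i := i) p (tail μ i) (expo μ)
  rw [Polynomial.coeff_eq_zero_of_natDegree_lt (by omega)] at h1
  have h2 : tail (expo μ) i = tail μ i := rfl
  rw [h2, if_pos rfl] at h1
  exact hμ h1.symm

theorem natDegree_tailHom_monomialPoly {N : ℕ} {b : Fin N → ℕ} (hb : Monotone b) (i : ℕ) :
    (tailHom N i (monomialPoly b)).natDegree ≤ tail b i := by
  rw [monomialPoly, map_sum]
  refine Polynomial.natDegree_sum_le_of_forall_le _ _ fun β hβ => ?_
  rw [tailHom_monomial]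
  exact (Polynomial.natDegree_monomial_le _).trans (tail_le_of_mem_rearr hb hβ i)

theorem natDegree_tailHom_sub {N : ℕ} (i : ℕ) {j k : Fin N} (h : j < k) :
    (tailHom N i (MvPolynomial.X k - MvPolynomial.X j)).natDegree ≤
      if i ≤ (k : ℕ) then 1 else 0 := by
  rw [map_sub, tailHom_X, tailHom_X]
  refine (Polynomial.natDegree_sub_le_of_le (Polynomial.natDegree_C_mul_X_pow_le _ _)
    (Polynomial.natDegree_C_mul_X_pow_le _ _)).trans ?_
  have := Fin.lt_def.1 h
  split_ifs <;> (simp; try omega)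

theorem sum_sum_Ioi {N : ℕ} (f : Fin N → ℕ) :
    ∑ j, ∑ k ∈ Ioi j, f k = ∑ k : Fin N, (k : ℕ) * f k := by
  rw [Finset.sum_comm' (t' := univ) (s' := fun k => Iio k) (by simp)]
  simp

theorem natDegree_tailHom_vandPoly (q N i : ℕ) :
    (tailHom N i (vandPoly q N)).natDegree ≤ tail (fun j : Fin N => q * (j : ℕ)) i := by
  have h1 : tail (fun j : Fin N => q * (j : ℕ)) i =
      ∑ j : Fin N, ∑ k ∈ Ioi j, q * (if i ≤ (k : ℕ) then 1 else 0) := by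
    rw [sum_sum_Ioi, tail]
    refine Finset.sum_congr rfl fun j _ => ?_
    split_ifs <;> simp [mul_comm]
  rw [h1, vandPoly, map_prod]
  refine (Polynomial.natDegree_prod_le _ _).trans (Finset.sum_le_sum fun j _ => ?_)
  rw [map_prod]
  refine (Polynomial.natDegree_prod_le _ _).trans (Finset.sum_le_sum fun k hk => ?_)
  rw [map_pow]
  exact Polynomial.natDegree_pow_le_of_le q (natDegree_tailHom_sub i (mem_Ioi.1 hk))

theorem tail_rootPartition (q : ℕ) {N : ℕ} (b : Fin N → ℕ) (i : ℕ) :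
    tail (rootPartition q b) i = tail (fun j : Fin N => q * (j : ℕ)) i + tail b i :=
  tail_add _ _ _

theorem monotone_rootPartition (q : ℕ) {N : ℕ} {b : Fin N → ℕ} (hb : Monotone b) :
    Monotone (rootPartition q b) := fun _ _ h =>
  Nat.add_le_add (Nat.mul_le_mul_left _ h) (hb h)

theorem isHomogeneous_monomialPoly {N : ℕ} (b : Fin N → ℕ) :
    (monomialPoly b).IsHomogeneous (tail b 0) := by
  refine MvPolynomial.IsHomogeneous.sum _ _ _ fun β hβ => ?_
  refine MvPolynomial.isHomogeneous_monomial _ ?_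
  rw [Finsupp.degree_eq_sum, tail_zero]
  exact sum_comp_rearr hβ id

theorem isHomogeneous_vandPoly (q N : ℕ) :
    (vandPoly q N).IsHomogeneous (tail (fun j : Fin N => q * (j : ℕ)) 0) := by
  have h1 : tail (fun j : Fin N => q * (j : ℕ)) 0 = ∑ j : Fin N, ∑ k ∈ Ioi j, 1 * q := by
    rw [sum_sum_Ioi, tail_zero]
    exact Finset.sum_congr rfl fun j _ => by ring
  rw [h1]
  refine MvPolynomial.IsHomogeneous.prod _ _ _ fun j _ =>
    MvPolynomial.IsHomogeneous.prod _ _ _ fun k _ => ?_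
  exact ((MvPolynomial.isHomogeneous_X _ _).sub (MvPolynomial.isHomogeneous_X _ _)).pow q

/-- The partitions in the expansion of the wavefunction are dominated by the root partition. -/
theorem dominated_of_monCoeff_ne_zero {q N : ℕ} {b μ : Fin N → ℕ} (hb : Monotone b)
    (hμ : Monotone μ) (h : monCoeff q b μ ≠ 0) : Dominated μ (rootPartition q b) := by
  refine (dominated_iff _ _).2 ⟨hμ, monotone_rootPartition q hb, ?_, fun i => ?_⟩
  · have := ((isHomogeneous_monomialPoly b).mul (isHomogeneous_vandPoly q N)) h
    rw [tail_rootPartition, tail_zero μ, add_comm, ← this]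
    simp [Finsupp.weight_apply, Finsupp.sum_fintype]
  · refine tail_le_of_natDegree_le ?_ h
    rw [map_mul, tail_rootPartition, add_comm]
    exact Polynomial.natDegree_mul_le_of_le (natDegree_tailHom_monomialPoly hb i)
      (natDegree_tailHom_vandPoly q N i)

/-! ### The product rule -/

theorem mapDomain_add_mapDomain {s t : ℕ} (a : Fin s →₀ ℕ) (c : Fin t →₀ ℕ) :
    Finsupp.mapDomain (Fin.castAdd t) a + Finsupp.mapDomain (Fin.natAdd s) c =
      expo (Fin.append a c) := by
  ext j
  have h1 : ∀ (i : Fin s) (k : Fin t), Fin.castAdd t i ≠ Fin.natAdd s k := fun i k h => by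
    have := congrArg Fin.val h
    simp at this
    omega
  refine Fin.addCases (fun i => ?_) (fun k => ?_) j
  · rw [Finsupp.add_apply, Finsupp.mapDomain_apply (Fin.castAdd_injective s t),
      Finsupp.mapDomain_of_notMem_range]
    · simp
    · rintro ⟨k, hk⟩
      exact h1 i k hk.symm
  · rw [Finsupp.add_apply, Finsupp.mapDomain_apply (Fin.natAdd_injective t s),
      Finsupp.mapDomain_of_notMem_range]
    · simp
    · rintro ⟨i, hi⟩
      exact h1 i k hi

theorem append_eq_append_iff {s t : ℕ} {a a' : Fin s → ℕ} {c c' : Fin t → ℕ} :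
    Fin.append a c = Fin.append a' c' ↔ a = a' ∧ c = c' := by
  constructor
  · intro h
    refine ⟨funext fun i => ?_, funext fun k => ?_⟩
    · simpa using congrFun h (Fin.castAdd t i)
    · simpa using congrFun h (Fin.natAdd s k)
  · rintro ⟨rfl, rfl⟩; rfl

theorem coeff_rename_mul_rename {s t : ℕ} (p : MvPolynomial (Fin s) ℝ)
    (p' : MvPolynomial (Fin t) ℝ) (a : Fin s → ℕ) (c : Fin t → ℕ) :
    MvPolynomial.coeff (expo (Fin.append a c))
      (MvPolynomial.rename (Fin.castAdd t) p * MvPolynomial.rename (Fin.natAdd s) p') =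
      MvPolynomial.coeff (expo a) p * MvPolynomial.coeff (expo c) p' := by
  classical
  induction p using MvPolynomial.induction_on' with
  | monomial u x =>
    induction p' using MvPolynomial.induction_on' with
    | monomial v y =>
      rw [MvPolynomial.rename_monomial, MvPolynomial.rename_monomial, MvPolynomial.monomial_mul,
        mapDomain_add_mapDomain, MvPolynomial.coeff_monomial, MvPolynomial.coeff_monomial,
        MvPolynomial.coeff_monomial]
      have h1 : expo (Fin.append u v) = expo (Fin.append a c) ↔ u = expo a ∧ v = expo c := by
        rw [expo_injective.eq_iff, append_eq_append_iff]
        constructor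
        · rintro ⟨h, h'⟩
          exact ⟨DFunLike.coe_injective h, DFunLike.coe_injective h'⟩
        · rintro ⟨rfl, rfl⟩
          exact ⟨rfl, rfl⟩
      rw [if_congr h1 rfl rfl]
      by_cases hu : u = expo a <;> by_cases hv : v = expo c <;> simp [hu, hv]
    | add p q hp hq => simp only [map_add, mul_add, MvPolynomial.coeff_add, hp, hq]
  | add p q hp hq => simp only [map_add, add_mul, MvPolynomial.coeff_add, hp, hq]

/-- The part of `m_{append f g}` of top degree in the last `t` variables is `m_f m_g`. -/
theorem coeff_tailHom_monomialPoly {s t : ℕ} {f : Fin s → ℕ} {g : Fin t → ℕ} {v : ℕ}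
    (hf : ∀ j, f j ≤ v) (hg : ∀ j, v ≤ g j) :
    (tailHom (s + t) s (monomialPoly (Fin.append f g))).coeff (∑ j, g j) =
      MvPolynomial.rename (Fin.castAdd t) (monomialPoly f) *
        MvPolynomial.rename (Fin.natAdd s) (monomialPoly g) := by
  have ht : ∀ β : Fin (s + t) → ℕ, tail β s = ∑ j : Fin t, β (Fin.natAdd s j) := fun β => by
    rw [tail, Fin.sum_univ_add, Finset.sum_eq_zero, zero_add]
    · simp
    · intro j _
      simp
  simp only [monomialPoly, map_sum, tailHom_monomial, Polynomial.finsetSum_coeff,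
    Polynomial.coeff_monomial, MvPolynomial.rename_monomial, Finset.sum_mul_sum,
    MvPolynomial.monomial_mul, mapDomain_add_mapDomain, mul_one]
  rw [← Finset.sum_filter, ← Finset.sum_product']
  refine Finset.sum_bij' (fun β _ => (β ∘ Fin.castAdd t, β ∘ Fin.natAdd s))
    (fun p _ => Fin.append p.1 p.2) ?_ ?_ ?_ ?_ ?_
  · intro β hβ
    rw [mem_filter] at hβ
    rw [mem_product]
    refine (append_mem_rearr_iff hf hg).1 ⟨?_, ?_⟩
    · have : Fin.append (β ∘ Fin.castAdd t) (β ∘ Fin.natAdd s) = β := Fin.append_castAdd_natAdd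
      rw [this]
      exact hβ.1
    · rw [← hβ.2]
      exact (ht β).symm
  · intro p hp
    rw [mem_product] at hp
    have := (append_mem_rearr_iff hf hg).2 hp
    rw [mem_filter]
    refine ⟨this.1, ?_⟩
    rw [← this.2]
    refine (ht (Fin.append p.1 p.2)).trans ?_
    simp
  · intro β _
    exact Fin.append_castAdd_natAdd
  · intro p _
    ext j <;> simp
  · intro β _
    have : Fin.append (β ∘ Fin.castAdd t) (β ∘ Fin.natAdd s) = β := Fin.append_castAdd_natAdd
    conv_lhs => rw [← this]
    rfl

theorem prod_Ioi_eq {N : ℕ} {R : Type*} [CommMonoid R] (F : Fin N → Fin N → R) :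
    ∏ j, ∏ k ∈ Ioi j, F j k = ∏ j, ∏ k, if j < k then F j k else 1 := by
  refine Finset.prod_congr rfl fun j _ => ?_
  rw [← Finset.prod_filter]
  refine Finset.prod_congr ?_ fun _ _ => rfl
  ext k
  simp

theorem prod_Ioi_append {s t : ℕ} {R : Type*} [CommMonoid R]
    (F : Fin (s + t) → Fin (s + t) → R) :
    ∏ j, ∏ k ∈ Ioi j, F j k =
      (∏ j, ∏ k ∈ Ioi j, F (Fin.castAdd t j) (Fin.castAdd t k)) *
      (∏ j, ∏ k ∈ Ioi j, F (Fin.natAdd s j) (Fin.natAdd s k)) *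
      ∏ j, ∏ k, F (Fin.castAdd t j) (Fin.natAdd s k) := by
  simp only [prod_Ioi_eq]
  rw [Fin.prod_univ_add]
  have h1 : ∀ (i : Fin s) (k : Fin t), Fin.castAdd t i < Fin.natAdd s k := fun i k => by
    rw [Fin.lt_def]; simp; omega
  have h2 : ∀ (i : Fin s) (k : Fin t), ¬ Fin.natAdd s k < Fin.castAdd t i := fun i k =>
    (h1 i k).le.not_gt
  have h3 : ∀ (i k : Fin s), Fin.castAdd t i < Fin.castAdd t k ↔ i < k := fun i k => Iff.rfl
  have h4 : ∀ (i k : Fin t), Fin.natAdd s i < Fin.natAdd s k ↔ i < k := fun i k => by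
    rw [Fin.lt_def, Fin.lt_def]; simp
  simp only [Fin.prod_univ_add, h1, h2, h3, h4, if_true, if_false, Finset.prod_const_one, one_mul,
    Finset.prod_mul_distrib]
  rw [mul_right_comm]

/-- The part of the Vandermonde power of top degree in the last `t` variables: every factor that
mixes the two groups of variables is replaced by the `q`-th power of its larger variable. -/
theorem coeff_tailHom_vandPoly (q s t : ℕ) :
    (tailHom (s + t) s (vandPoly q (s + t))).coeff
        (tail (fun j : Fin t => q * (j : ℕ)) 0 + t * (q * s)) =
      MvPolynomial.rename (Fin.castAdd t) (vandPoly q s) *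
        MvPolynomial.rename (Fin.natAdd s) (vandPoly q t) *
          MvPolynomial.monomial (expo (Fin.append 0 fun _ => q * s)) 1 := by
  have e1 : ∀ j : Fin s, tailHom (s + t) s (MvPolynomial.X (Fin.castAdd t j)) =
      Polynomial.C (MvPolynomial.X (Fin.castAdd t j)) := fun j => by
    rw [tailHom_X]; simp
  have e2 : ∀ j : Fin t, tailHom (s + t) s (MvPolynomial.X (Fin.natAdd s j)) =
      Polynomial.C (MvPolynomial.X (Fin.natAdd s j)) * Polynomial.X := fun j => by
    rw [tailHom_X]; simp
  have h0 : tail (fun j : Fin t => q * (j : ℕ)) 0 = ∑ j : Fin t, ∑ k ∈ Ioi j, q := by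
    rw [sum_sum_Ioi, tail_zero]
    exact Finset.sum_congr rfl fun j _ => by ring
  have h2 : (∏ j : Fin t, ∏ k ∈ Ioi j, tailHom (s + t) s
      ((MvPolynomial.X (Fin.natAdd s k) - MvPolynomial.X (Fin.natAdd s j)) ^ q)) =
      Polynomial.C (MvPolynomial.rename (Fin.natAdd s) (vandPoly q t)) *
        Polynomial.X ^ tail (fun j : Fin t => q * (j : ℕ)) 0 := by
    simp only [map_pow, map_sub, e2, ← sub_mul, mul_pow, Finset.prod_mul_distrib,
      Finset.prod_pow_eq_pow_sum, h0, vandPoly, map_prod, MvPolynomial.rename_X]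
  have h1 : (∏ j : Fin s, ∏ k ∈ Ioi j, tailHom (s + t) s
      ((MvPolynomial.X (Fin.castAdd t k) - MvPolynomial.X (Fin.castAdd t j)) ^ q)) =
      Polynomial.C (MvPolynomial.rename (Fin.castAdd t) (vandPoly q s)) := by
    simp only [map_pow, map_sub, e1, vandPoly, map_prod, MvPolynomial.rename_X]
  have d0 : ∀ (j : Fin s) (k : Fin t), (Polynomial.C (MvPolynomial.X (Fin.natAdd s k)) *
      Polynomial.X - Polynomial.C (MvPolynomial.X (Fin.castAdd t j)) :
        Polynomial (MvPolynomial (Fin (s + t)) ℝ)).natDegree ≤ 1 := fun j k => by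
    compute_degree
  have d1 : ∀ (j : Fin s) (k : Fin t), ((Polynomial.C (MvPolynomial.X (Fin.natAdd s k)) *
      Polynomial.X - Polynomial.C (MvPolynomial.X (Fin.castAdd t j)) :
        Polynomial (MvPolynomial (Fin (s + t)) ℝ)) ^ q).natDegree ≤ q := fun j k => by
    have := Polynomial.natDegree_pow_le_of_le q (d0 j k)
    rwa [mul_one] at this
  have d2 : ∀ (k : Fin t), (∏ j : Fin s, (Polynomial.C (MvPolynomial.X (Fin.natAdd s k)) *
      Polynomial.X - Polynomial.C (MvPolynomial.X (Fin.castAdd t j)) :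
        Polynomial (MvPolynomial (Fin (s + t)) ℝ)) ^ q).natDegree ≤ q * s := fun k => by
    refine (Polynomial.natDegree_prod_le _ _).trans ((Finset.sum_le_sum fun j _ => d1 j k).trans ?_)
    simp [mul_comm]
  have h3 : (∏ j : Fin s, ∏ k : Fin t, tailHom (s + t) s
      ((MvPolynomial.X (Fin.natAdd s k) - MvPolynomial.X (Fin.castAdd t j)) ^ q)).coeff
        (t * (q * s)) =
      MvPolynomial.monomial (expo (Fin.append 0 fun _ => q * s)) 1 := by
    rw [Finset.prod_comm]
    simp only [map_pow, map_sub, e1, e2]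
    have c1 := Polynomial.coeff_prod_of_natDegree_le (s := (univ : Finset (Fin t))) _ (q * s)
      fun k _ => d2 k
    rw [card_univ, Fintype.card_fin] at c1
    rw [c1]
    have c2 : ∀ k : Fin t, (∏ j : Fin s, (Polynomial.C (MvPolynomial.X (Fin.natAdd s k)) *
      Polynomial.X - Polynomial.C (MvPolynomial.X (Fin.castAdd t j)) :
        Polynomial (MvPolynomial (Fin (s + t)) ℝ)) ^ q).coeff (q * s) =
        MvPolynomial.X (Fin.natAdd s k) ^ (q * s) := fun k => by
      have c3 := Polynomial.coeff_prod_of_natDegree_le (s := (univ : Finset (Fin s))) _ q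
        fun j _ => d1 j k
      rw [card_univ, Fintype.card_fin] at c3
      rw [mul_comm q s, c3]
      have c4 : ∀ j : Fin s, ((Polynomial.C (MvPolynomial.X (Fin.natAdd s k)) *
        Polynomial.X - Polynomial.C (MvPolynomial.X (Fin.castAdd t j)) :
        Polynomial (MvPolynomial (Fin (s + t)) ℝ)) ^ q).coeff q =
          MvPolynomial.X (Fin.natAdd s k) ^ q := fun j => by
        have := Polynomial.coeff_pow_of_natDegree_le (m := q) (d0 j k)
        rw [mul_one] at this
        rw [this]
        simp
      simp only [c4, Finset.prod_const, card_univ, Fintype.card_fin]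
      rw [mul_comm s q, pow_mul]
    simp only [c2]
    rw [MvPolynomial.monomial_eq, Finsupp.prod_fintype _ _ (fun _ => pow_zero _),
      Fin.prod_univ_add]
    simp
  rw [vandPoly, prod_Ioi_append]
  simp only [map_mul, map_prod] at h1 h2 h3 ⊢
  rw [h1, h2, mul_assoc, mul_assoc, Polynomial.coeff_C_mul, Polynomial.coeff_C_mul,
    add_comm _ (t * (q * s)), Polynomial.coeff_X_pow_mul, h3, mul_assoc]

/-- The product rule for coefficients. The monomial on the left has the largest possible degree in
the last `t` variables, so it occurs only in the product of the two parts of top degree. -/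
theorem monCoeff_append {q s t : ℕ} {f μ₁ : Fin s → ℕ} {g μ₂ : Fin t → ℕ} {v : ℕ}
    (hfm : Monotone f) (hgm : Monotone g) (hf : ∀ j, f j ≤ v) (hg : ∀ j, v ≤ g j)
    (hμ : ∑ j, μ₂ j = ∑ j, rootPartition q g j) :
    monCoeff q (Fin.append f g) (Fin.append μ₁ fun j => q * s + μ₂ j) =
      monCoeff q f μ₁ * monCoeff q g μ₂ := by
  have hb : Monotone (Fin.append f g) := by
    intro i j
    refine Fin.addCases (fun i => ?_) (fun i => ?_) i <;>
      refine Fin.addCases (fun j => ?_) (fun j => ?_) j <;> intro h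
    · simpa using hfm h
    · simpa using (hf i).trans (hg j)
    · have := Fin.le_def.1 h
      simp at this
      omega
    · have := Fin.le_def.1 h
      simp at this
      simpa using hgm (Fin.le_def.2 this)
  have t1 : ∀ h : Fin t → ℕ, tail (Fin.append (0 : Fin s → ℕ) h) s = ∑ j, h j := fun h => by
    rw [tail_append, Nat.sub_self, tail_zero]
    simp [tail]
  have t2 : tail (fun j : Fin (s + t) => q * (j : ℕ)) s =
      tail (fun j : Fin t => q * (j : ℕ)) 0 + t * (q * s) := by
    rw [tail, Fin.sum_univ_add, tail_zero, Finset.sum_eq_zero (s := univ (α := Fin s))]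
    · simp [mul_add, Finset.sum_add_distrib]
      ring
    · intro j _
      simp
  have t3 : tail (Fin.append f g) s = ∑ j, g j := by
    rw [tail_append, Nat.sub_self, tail_zero, tail_eq_zero f le_rfl, zero_add]
  have t4 : tail (Fin.append μ₁ fun j => q * s + μ₂ j) s =
      ∑ j, g j + (tail (fun j : Fin t => q * (j : ℕ)) 0 + t * (q * s)) := by
    rw [tail_append, Nat.sub_self, tail_zero, tail_eq_zero μ₁ le_rfl, zero_add, tail_zero,
      Finset.sum_add_distrib, hμ]
    simp only [rootPartition, Finset.sum_add_distrib]
    simp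
    ring
  have key := coeff_coeff_tailHom (i := s) (monomialPoly (Fin.append f g) * vandPoly q (s + t))
    (∑ j, g j + (tail (fun j : Fin t => q * (j : ℕ)) 0 + t * (q * s)))
    (expo (Fin.append μ₁ fun j => q * s + μ₂ j))
  have t5 : tail (expo (Fin.append μ₁ fun j => q * s + μ₂ j)) s =
    tail (Fin.append μ₁ fun j => q * s + μ₂ j) s := rfl
  rw [t5, if_pos t4] at key
  rw [monCoeff, ← key, map_mul, Polynomial.coeff_mul_add_eq_of_natDegree_le
    (t3 ▸ natDegree_tailHom_monomialPoly hb s) (t2 ▸ natDegree_tailHom_vandPoly q (s + t) s),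
    coeff_tailHom_monomialPoly hf hg, coeff_tailHom_vandPoly]
  have e : expo (Fin.append μ₁ fun j => q * s + μ₂ j) =
      expo (Fin.append μ₁ μ₂) + expo (Fin.append 0 fun _ => q * s) := by
    ext j
    refine Fin.addCases (fun i => ?_) (fun i => ?_) j <;> simp [add_comm]
  rw [e, ← mul_assoc, MvPolynomial.coeff_mul_monomial, mul_one, mul_mul_mul_comm, ← map_mul,
    ← map_mul, coeff_rename_mul_rename]
  rfl

theorem monCoeff_shift {q N : ℕ} (k : ℕ) (b μ : Fin N → ℕ) :
    monCoeff q (fun j => k + b j) (fun j => k + μ j) = monCoeff q b μ := by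
  have e : ∀ μ : Fin N → ℕ, expo (fun j => k + μ j) = expo μ + expo fun _ => k := fun μ => by
    ext j; simp [add_comm]
  have h : monomialPoly (fun j => k + b j) =
      monomialPoly b * MvPolynomial.monomial (expo fun _ => k) 1 := by
    rw [monomialPoly, monomialPoly, Finset.sum_mul]
    symm
    refine Finset.sum_bij (fun β _ j => k + β j) ?_ ?_ ?_ ?_
    · intro β hβ
      obtain ⟨σ, rfl⟩ := mem_rearr.1 hβ
      exact mem_rearr.2 ⟨σ, rfl⟩
    · intro β _ β' _ h
      funext j
      simpa using congrFun h j
    · intro β hβ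
      obtain ⟨σ, rfl⟩ := mem_rearr.1 hβ
      exact ⟨b ∘ σ, mem_rearr.2 ⟨σ, rfl⟩, rfl⟩
    · intro β _
      rw [MvPolynomial.monomial_mul, mul_one, e]
  rw [monCoeff, h, mul_right_comm, e, MvPolynomial.coeff_mul_monomial, mul_one]
  rfl

/-! ### Weights of partitions and renewal points -/

/-- The weight of the partition `μ` in the expansion of the wavefunction of `b`; it is shown
below to be the squared modulus of the expansion coefficient. -/
noncomputable def weight (q : ℕ) (γ : ℝ) {N : ℕ} (b μ : Fin N → ℕ) : ℝ :=
  monCoeff q b μ ^ 2 / multFactorial μ *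
    Real.exp (-(γ ^ 2 * (∑ j, (rootPartition q b j : ℝ) ^ 2 - ∑ j, (μ j : ℝ) ^ 2)))

theorem weight_nonneg (q : ℕ) (γ : ℝ) {N : ℕ} (b μ : Fin N → ℕ) : 0 ≤ weight q γ b μ := by
  unfold weight; positivity

open Classical in
/-- The total weight of the partitions dominated by the root partition of `b` which satisfy `P`. -/
noncomputable def partWeight (q : ℕ) (γ : ℝ) {N : ℕ} (b : Fin N → ℕ)
    (P : (Fin N → ℕ) → Prop) : ℝ :=
  ∑ μ ∈ (dominatedSet q b).filter P, weight q γ b μ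

theorem partWeight_nonneg (q : ℕ) (γ : ℝ) {N : ℕ} (b : Fin N → ℕ) (P : (Fin N → ℕ) → Prop) :
    0 ≤ partWeight q γ b P := Finset.sum_nonneg fun _ _ => weight_nonneg _ _ _ _

theorem partWeight_congr {q : ℕ} {γ : ℝ} {N : ℕ} {b : Fin N → ℕ} {P Q : (Fin N → ℕ) → Prop}
    (h : ∀ μ, Dominated μ (rootPartition q b) → (P μ ↔ Q μ)) :
    partWeight q γ b P = partWeight q γ b Q := by
  classical
  unfold partWeight
  refine Finset.sum_congr (Finset.ext fun μ => ?_) fun _ _ => rfl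
  rw [mem_filter, mem_filter, mem_dominatedSet]
  exact and_congr_right (h μ)

/-! ### Concatenation -/

theorem multFactorial_eq_prod {N : ℕ} (b : Fin N → ℕ) {T : Finset ℕ} (hT : ∀ j, b j ∈ T) :
    multFactorial b = ∏ k ∈ T, (#{j | b j = k}).factorial := by
  refine Finset.prod_subset (fun k hk => ?_) fun k _ hk => ?_
  · obtain ⟨j, -, rfl⟩ := mem_image.1 hk
    exact hT j
  · rw [card_eq_zero.2, Nat.factorial_zero]
    refine filter_eq_empty_iff.2 fun j _ hj => hk (mem_image.2 ⟨j, mem_univ j, hj⟩)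

theorem multFactorial_append {s t : ℕ} {f : Fin s → ℕ} {g : Fin t → ℕ}
    (h : ∀ i j, f i < g j) :
    multFactorial (Fin.append f g) = multFactorial f * multFactorial g := by
  set T := univ.image (Fin.append f g)
  have hT : ∀ j, Fin.append f g j ∈ T := fun j => mem_image_of_mem _ (mem_univ j)
  rw [multFactorial_eq_prod (Fin.append f g) hT,
    multFactorial_eq_prod f (T := T) fun j => by simpa using hT (Fin.castAdd t j),
    multFactorial_eq_prod g (T := T) fun j => by simpa using hT (Fin.natAdd s j),
    ← Finset.prod_mul_distrib]
  refine Finset.prod_congr rfl fun k _ => ?_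
  have split : #{j | Fin.append f g j = k} = #{j | f j = k} + #{j | g j = k} := by
    simp only [card_filter, Fin.sum_univ_add, Fin.append_left, Fin.append_right]
  rw [split]
  by_cases hk : ∃ i, f i = k
  · obtain ⟨i, rfl⟩ := hk
    rw [card_eq_zero.2 (filter_eq_empty_iff.2 fun j _ => (h i j).ne')]
    simp
  · push Not at hk
    rw [card_eq_zero.2 (filter_eq_empty_iff.2 fun j _ => hk j)]
    simp

theorem multFactorial_shift {N : ℕ} (k : ℕ) (b : Fin N → ℕ) :
    multFactorial (fun j => k + b j) = multFactorial b := by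
  have : univ.image (fun j => k + b j) = (univ.image b).image (k + ·) := by
    rw [image_image]; rfl
  rw [multFactorial, this, Finset.prod_image fun _ _ _ _ h => Nat.add_left_cancel h]
  simp [multFactorial]

theorem le_lastEntry {s : ℕ} {b : Fin s → ℕ} (hb : Monotone b) (j : Fin s) : b j ≤ lastEntry b := by
  have hs : 0 < s := j.pos
  rw [lastEntry, dif_pos hs]
  exact hb (Fin.le_def.2 (by simp only; omega))

/-- The entries in front of a renewal point stay at least `q` below the shift of those behind it. -/
theorem le_root_last {q s : ℕ} {b μ : Fin s → ℕ} (hμ : Dominated μ (rootPartition q b))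
    (j : Fin s) : μ j + q ≤ q * s + lastEntry b := by
  have hs : 0 < s := j.pos
  obtain ⟨h1, -, -, h4⟩ := (dominated_iff _ _).1 hμ
  have h5 := h4 (s - 1)
  have e := fun ν : Fin s → ℕ => tail_eq_add_tail_succ ν ⟨s - 1, by omega⟩
  simp only at e
  rw [e, e, tail_eq_zero _ (by omega), tail_eq_zero _ (by omega)] at h5
  have h6 : μ j ≤ μ ⟨s - 1, by omega⟩ := h1 (Fin.le_def.2 (by simp only; omega))
  rw [lastEntry, dif_pos hs]
  have h7 : q * (s - 1) + q = q * s := by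
    rw [← Nat.mul_succ]
    congr 1
    omega
  simp only [rootPartition] at h5
  omega

theorem monotone_append {s t : ℕ} {f : Fin s → ℕ} {g : Fin t → ℕ} (hf : Monotone f)
    (hg : Monotone g) (h : ∀ i j, f i ≤ g j) : Monotone (Fin.append f g) := by
  intro i j
  refine Fin.addCases (fun i => ?_) (fun i => ?_) i <;>
    refine Fin.addCases (fun j => ?_) (fun j => ?_) j <;> intro hij
  · simpa using hf hij
  · simpa using h i j
  · have := Fin.le_def.1 hij
    simp at this
    omega
  · have := Fin.le_def.1 hij
    simp at this
    simpa using hg (Fin.le_def.2 this)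

theorem rootPartition_compose (q : ℕ) {s t : ℕ} (b₁ : Fin s → ℕ) (b₂ : Fin t → ℕ) :
    rootPartition q (compose b₁ b₂) = concat q b₁ (rootPartition q b₁) (rootPartition q b₂) := by
  funext j
  refine Fin.addCases (fun i => ?_) (fun i => ?_) j
  · simp [rootPartition, compose, concat]
  · simp [rootPartition, compose, concat]
    ring

theorem monotone_compose {s t : ℕ} {b₁ : Fin s → ℕ} {b₂ : Fin t → ℕ} (h₁ : Monotone b₁)
    (h₂ : Monotone b₂) : Monotone (compose b₁ b₂) :=
  monotone_append h₁ (fun _ _ h => Nat.add_le_add_left (h₂ h) _)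
    fun i _ => (le_lastEntry h₁ i).trans (Nat.le_add_right _ _)

theorem tail_concat (q : ℕ) {s t : ℕ} (b₁ μ₁ : Fin s → ℕ) (μ₂ : Fin t → ℕ) (i : ℕ) :
    tail (concat q b₁ μ₁ μ₂) i =
      tail μ₁ i + (tail (fun _ : Fin t => q * s + lastEntry b₁) (i - s) + tail μ₂ (i - s)) := by
  rw [concat, tail_append]
  congr 1
  exact tail_add _ _ _

theorem dominated_concat {q s t : ℕ} {b₁ μ₁ : Fin s → ℕ} {b₂ μ₂ : Fin t → ℕ}
    (h₁ : Monotone b₁) (h₂ : Monotone b₂) (d₁ : Dominated μ₁ (rootPartition q b₁))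
    (d₂ : Dominated μ₂ (rootPartition q b₂)) :
    Dominated (concat q b₁ μ₁ μ₂) (rootPartition q (compose b₁ b₂)) := by
  obtain ⟨m₁, -, e₁, l₁⟩ := (dominated_iff _ _).1 d₁
  obtain ⟨m₂, -, e₂, l₂⟩ := (dominated_iff _ _).1 d₂
  refine (dominated_iff _ _).2 ⟨?_, monotone_rootPartition q (monotone_compose h₁ h₂), ?_, ?_⟩
  · refine monotone_append m₁ (fun _ _ h => Nat.add_le_add_left (m₂ h) _) fun i _ => ?_
    have := le_root_last d₁ i
    omega
  · rw [rootPartition_compose, tail_concat, tail_concat, e₁, Nat.zero_sub, e₂]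
  · intro i
    rw [rootPartition_compose, tail_concat, tail_concat]
    have := l₁ i
    have := l₂ (i - s)
    omega

/-- The product rule: weights are multiplicative under concatenation. -/
theorem weight_concat {q : ℕ} (hq : 1 ≤ q) (γ : ℝ) {s t : ℕ} {b₁ μ₁ : Fin s → ℕ}
    {b₂ μ₂ : Fin t → ℕ} (h₁ : Monotone b₁) (h₂ : Monotone b₂)
    (d₁ : Dominated μ₁ (rootPartition q b₁)) (d₂ : Dominated μ₂ (rootPartition q b₂)) :
    weight q γ (compose b₁ b₂) (concat q b₁ μ₁ μ₂) = weight q γ b₁ μ₁ * weight q γ b₂ μ₂ := by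
  have e1 : monCoeff q (compose b₁ b₂) (concat q b₁ μ₁ μ₂) =
      monCoeff q b₁ μ₁ * monCoeff q b₂ μ₂ := by
    have hc : concat q b₁ μ₁ μ₂ = Fin.append μ₁ fun j => q * s + (lastEntry b₁ + μ₂ j) := by
      rw [concat]
      congr 1
      funext j
      rw [add_assoc]
    rw [hc, compose, monCoeff_append (v := lastEntry b₁) h₁
      (fun _ _ h => Nat.add_le_add_left (h₂ h) _)
      (le_lastEntry h₁) (fun _ => Nat.le_add_right _ _), monCoeff_shift]
    have := d₂.sum_eq
    simp only [rootPartition, Finset.sum_add_distrib] at this ⊢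
    omega
  have e2 : multFactorial (concat q b₁ μ₁ μ₂) = multFactorial μ₁ * multFactorial μ₂ := by
    rw [concat, multFactorial_append, multFactorial_shift]
    intro i j
    have := le_root_last d₁ i
    omega
  have e3 : ∑ j, (rootPartition q (compose b₁ b₂) j : ℝ) ^ 2 -
      ∑ j, (concat q b₁ μ₁ μ₂ j : ℝ) ^ 2 =
      (∑ j, (rootPartition q b₁ j : ℝ) ^ 2 - ∑ j, (μ₁ j : ℝ) ^ 2) +
      (∑ j, (rootPartition q b₂ j : ℝ) ^ 2 - ∑ j, (μ₂ j : ℝ) ^ 2) := by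
    have hs : ∑ j, (μ₂ j : ℝ) = ∑ j, (rootPartition q b₂ j : ℝ) := by exact_mod_cast d₂.sum_eq
    rw [rootPartition_compose]
    simp only [concat, Fin.sum_univ_add, Fin.append_left, Fin.append_right, Nat.cast_add, add_sq,
      Finset.sum_add_distrib, ← Finset.mul_sum, hs]
    ring
  rw [weight, weight, weight, e1, e2, e3, mul_add, neg_add, Real.exp_add]
  push_cast
  ring

/-! ### Renewal points in terms of tail sums -/

theorem lastEntry_castAdd {s t : ℕ} (b : Fin (s + t) → ℕ) (hs : 1 ≤ s) :
    lastEntry (b ∘ Fin.castAdd t) = b ⟨s - 1, by omega⟩ := by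
  rw [lastEntry, dif_pos (by omega)]
  rfl

/-- Every boundary sequence is composed of the parts in front of and behind any given position. -/
theorem compose_split {s t : ℕ} {b : Fin (s + t) → ℕ} (hb : Monotone b) (hs : 1 ≤ s) :
    compose (b ∘ Fin.castAdd t) (fun j => b (Fin.natAdd s j) - lastEntry (b ∘ Fin.castAdd t)) =
      b := by
  funext j
  refine Fin.addCases (fun i => ?_) (fun i => ?_) j
  · simp [compose]
  · simp only [compose, Fin.append_right]
    refine Nat.add_sub_cancel' ?_
    rw [lastEntry_castAdd b hs]
    exact hb (Fin.le_def.2 (by simp; omega))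

theorem monotone_split {s t : ℕ} {b : Fin (s + t) → ℕ} (hb : Monotone b) (l : ℕ) :
    Monotone (b ∘ Fin.castAdd t) ∧ Monotone fun j => b (Fin.natAdd s j) - l :=
  ⟨fun _ _ h => hb h, fun _ _ h => Nat.sub_le_sub_right (hb (by
    have := Fin.le_def.1 h
    rw [Fin.le_def, Fin.val_natAdd, Fin.val_natAdd]
    omega)) _⟩

theorem hasRenewalPoint_add_iff {q s t : ℕ} {b μ : Fin (s + t) → ℕ} (hs : 1 ≤ s) (ht : 1 ≤ t)
    (hb : Monotone b) (hμ : Dominated μ (rootPartition q b)) :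
    HasRenewalPoint q b μ s ↔ tail μ s = tail (rootPartition q b) s := by
  constructor
  · rintro ⟨-, t', h, -, b₁, μ₁, b₂, μ₂, m₁, m₂, d₁, d₂, rfl, rfl⟩
    obtain rfl : t = t' := by omega
    obtain ⟨-, -, e₂, -⟩ := (dominated_iff _ _).1 d₂
    change tail (concat q b₁ μ₁ μ₂) s = tail (rootPartition q (compose b₁ b₂)) s
    rw [rootPartition_compose, tail_concat, tail_concat, Nat.sub_self, e₂,
      tail_eq_zero μ₁ le_rfl, tail_eq_zero _ le_rfl]
  · intro h
    obtain ⟨hm, -, e, l⟩ := (dominated_iff _ _).1 hμ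
    obtain ⟨m₁, m₂⟩ := monotone_split hb (lastEntry (b ∘ Fin.castAdd t))
    set b₁ := b ∘ Fin.castAdd t with hb₁
    set b₂ : Fin t → ℕ := fun j => b (Fin.natAdd s j) - lastEntry b₁
    have hc : compose b₁ b₂ = b := compose_split hb hs
    set k := q * s + lastEntry b₁ with hk
    -- equality of the tails forces the entry behind the renewal point to be large
    have hge : ∀ j : Fin t, k ≤ μ (Fin.natAdd s j) := by
      intro j
      have h1 := tail_eq_add_tail_succ μ ⟨s, by omega⟩
      have h2 := tail_eq_add_tail_succ (rootPartition q b) ⟨s, by omega⟩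
      have h3 := l (s + 1)
      simp only at h1 h2
      have h4 : μ ⟨s, by omega⟩ ≤ μ (Fin.natAdd s j) := hm (Fin.le_def.2 (by simp))
      have h5 : lastEntry b₁ ≤ b ⟨s, by omega⟩ := by
        rw [hb₁, lastEntry_castAdd b hs]
        exact hb (Fin.le_def.2 (by simp))
      simp only [rootPartition] at h2
      omega
    have hcat : concat q b₁ (μ ∘ Fin.castAdd t) (fun j => μ (Fin.natAdd s j) - k) = μ := by
      funext j
      refine Fin.addCases (fun i => ?_) (fun i => ?_) j
      · simp [concat]
      · simp only [concat, Fin.append_right]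
        exact Nat.add_sub_cancel' (hge i)
    have tl : ∀ i, tail (μ ∘ Fin.castAdd t) i + (tail (fun _ : Fin t => k) (i - s) +
        tail (fun j => μ (Fin.natAdd s j) - k) (i - s)) = tail μ i := fun i => by
      rw [← tail_concat, hcat]
    have tr : ∀ i, tail (rootPartition q b₁) i + (tail (fun _ : Fin t => k) (i - s) +
        tail (rootPartition q b₂) (i - s)) = tail (rootPartition q b) i := fun i => by
      rw [← tail_concat, ← rootPartition_compose, hc]
    have hz : tail (fun j => μ (Fin.natAdd s j) - k) 0 = tail (rootPartition q b₂) 0 := by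
      have h1 := tl s
      have h2 := tr s
      rw [tail_eq_zero _ le_rfl, Nat.sub_self] at h1 h2
      omega
    refine ⟨hs, t, rfl, ht, b₁, μ ∘ Fin.castAdd t, b₂, fun j => μ (Fin.natAdd s j) - k,
      m₁, m₂, ?_, ?_, ?_, ?_⟩
    · refine (dominated_iff _ _).2 ⟨(monotone_split hm 0).1, monotone_rootPartition q m₁, ?_, ?_⟩
      · have h1 := tl 0
        have h2 := tr 0
        rw [Nat.zero_sub] at h1 h2
        omega
      · intro i
        by_cases hi : i < s
        · have h1 := tl i
          have h2 := tr i
          have h3 := l i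
          rw [Nat.sub_eq_zero_of_le hi.le] at h1 h2
          omega
        · rw [tail_eq_zero _ (by omega)]
          exact Nat.zero_le _
    · refine (dominated_iff _ _).2 ⟨(monotone_split hm k).2, monotone_rootPartition q m₂, hz, ?_⟩
      intro i
      have h1 := tl (s + i)
      have h2 := tr (s + i)
      have h3 := l (s + i)
      rw [tail_eq_zero _ (by omega), Nat.add_sub_cancel_left] at h1 h2
      omega
    · exact hc.symm
    · exact hcat.symm

/-- A dominated partition has a renewal point exactly where its tail sum is maximal. -/
theorem hasRenewalPoint_iff {q N : ℕ} {b μ : Fin N → ℕ} (hb : Monotone b)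
    (hμ : Dominated μ (rootPartition q b)) (s : ℕ) :
    HasRenewalPoint q b μ s ↔ 1 ≤ s ∧ s < N ∧ tail μ s = tail (rootPartition q b) s := by
  by_cases h : 1 ≤ s ∧ s < N
  · obtain ⟨t, rfl⟩ := Nat.exists_eq_add_of_lt h.2
    rw [and_iff_right h.1, and_iff_right h.2]
    exact hasRenewalPoint_add_iff (t := t + 1) h.1 (by omega) hb hμ
  · constructor
    · rintro ⟨h1, t, rfl, ht, -⟩
      exact absurd ⟨h1, by omega⟩ h
    · rintro ⟨h1, h2, -⟩
      exact absurd ⟨h1, h2⟩ h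

/-! ### Decomposition according to the first renewal point -/

/-- Renewal points of a concatenation in front of the junction are those of its first part. -/
theorem hasRenewalPoint_concat_iff {q s t : ℕ} {b₁ μ₁ : Fin s → ℕ} {b₂ μ₂ : Fin t → ℕ}
    (h₁ : Monotone b₁) (h₂ : Monotone b₂) (d₁ : Dominated μ₁ (rootPartition q b₁))
    (d₂ : Dominated μ₂ (rootPartition q b₂)) {i : ℕ} (hi : i < s) :
    HasRenewalPoint q (compose b₁ b₂) (concat q b₁ μ₁ μ₂) i ↔ HasRenewalPoint q b₁ μ₁ i := by
  obtain ⟨-, -, e₂, -⟩ := (dominated_iff _ _).1 d₂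
  rw [hasRenewalPoint_iff h₁ d₁, hasRenewalPoint_iff (monotone_compose h₁ h₂)
    (dominated_concat h₁ h₂ d₁ d₂), rootPartition_compose, tail_concat, tail_concat,
    Nat.sub_eq_zero_of_le hi.le, e₂]
  constructor
  · rintro ⟨a, b, c⟩; exact ⟨a, hi, by omega⟩
  · rintro ⟨a, b, c⟩; exact ⟨a, by omega, by omega⟩

theorem irred_iff {q N : ℕ} {b μ : Fin N → ℕ} (hb : Monotone b)
    (hμ : Dominated μ (rootPartition q b)) :
    Irred q b μ ↔ ∀ s, s < N → ¬ HasRenewalPoint q b μ s := by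
  refine ⟨fun h s _ => h s, fun h s hs => h s ?_ hs⟩
  exact ((hasRenewalPoint_iff hb hμ s).1 hs).2.1

/-- Partitions whose first renewal point is `s` are concatenations of an irreducible partition of
length `s` and of an arbitrary one. -/
theorem partWeight_first_renewal {q : ℕ} (hq : 1 ≤ q) (γ : ℝ) {s t : ℕ} (hs : 1 ≤ s) (ht : 1 ≤ t)
    {b₁ : Fin s → ℕ} {b₂ : Fin t → ℕ} (h₁ : Monotone b₁) (h₂ : Monotone b₂) :
    partWeight q γ (compose b₁ b₂) (fun μ => HasRenewalPoint q (compose b₁ b₂) μ s ∧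
      ∀ i < s, ¬ HasRenewalPoint q (compose b₁ b₂) μ i) =
      partWeight q γ b₁ (Irred q b₁) * partWeight q γ b₂ fun _ => True := by
  classical
  unfold partWeight
  rw [Finset.sum_mul_sum, ← Finset.sum_product']
  symm
  refine Finset.sum_bij (fun p _ => concat q b₁ p.1 p.2) ?_ ?_ ?_ ?_
  · intro p hp
    simp only [mem_product, mem_filter, mem_dominatedSet, and_true] at hp ⊢
    obtain ⟨⟨d₁, hi⟩, d₂⟩ := hp
    refine ⟨dominated_concat h₁ h₂ d₁ d₂, ⟨hs, t, rfl, ht, b₁, p.1, b₂, p.2, h₁, h₂, d₁, d₂,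
      rfl, rfl⟩, fun i his => ?_⟩
    rw [hasRenewalPoint_concat_iff h₁ h₂ d₁ d₂ his]
    exact hi i
  · intro p hp p' hp' h
    obtain ⟨e1, e2⟩ := append_eq_append_iff.1 h
    refine Prod.ext e1 (funext fun j => ?_)
    have := congrFun e2 j
    simpa using this
  · intro μ hμ
    simp only [mem_filter, mem_dominatedSet] at hμ
    obtain ⟨-, ⟨-, t', h, -, c₁, μ₁, c₂, μ₂, m₁, m₂, d₁, d₂, hc, rfl⟩, hf⟩ := hμ
    obtain rfl : t = t' := by omega
    obtain ⟨rfl, e⟩ := append_eq_append_iff.1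
      (show Fin.append b₁ (fun j => lastEntry b₁ + b₂ j) =
        Fin.append c₁ (fun j => lastEntry c₁ + c₂ j) from hc)
    obtain rfl : b₂ = c₂ := funext fun j => by simpa using congrFun e j
    refine ⟨(μ₁, μ₂), ?_, rfl⟩
    simp only [mem_product, mem_filter, mem_dominatedSet, and_true]
    refine ⟨⟨d₁, (irred_iff h₁ d₁).2 fun i hi => ?_⟩, d₂⟩
    rw [← hasRenewalPoint_concat_iff h₁ h₂ d₁ d₂ hi]
    exact hf i hi
  · intro p hp
    simp only [mem_product, mem_filter, mem_dominatedSet, and_true] at hp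
    exact (weight_concat hq γ h₁ h₂ hp.1.1 hp.2).symm

/-- Every partition either has a first renewal point in `[1, L]` or no renewal point there. -/
theorem partWeight_eq_sum_first {q : ℕ} (γ : ℝ) {N : ℕ} (b : Fin N → ℕ) (L : ℕ) :
    partWeight q γ b (fun _ => True) =
      ∑ s ∈ (Ico 1 N).filter (· ≤ L), partWeight q γ b (fun μ => HasRenewalPoint q b μ s ∧
        ∀ i < s, ¬ HasRenewalPoint q b μ i) +
      partWeight q γ b (fun μ => ∀ s, s ≤ L → ¬ HasRenewalPoint q b μ s) := by
  classical
  unfold partWeight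
  simp only [Finset.filter_true, Finset.sum_filter (s := dominatedSet q b)]
  rw [Finset.sum_comm, ← Finset.sum_add_distrib]
  refine Finset.sum_congr rfl fun μ _ => ?_
  by_cases h : ∃ s, s ≤ L ∧ HasRenewalPoint q b μ s
  · have h1 := Nat.find_spec h
    have h2 : ∀ i < Nat.find h, ¬ HasRenewalPoint q b μ i := fun i hi hr =>
      Nat.find_min h hi ⟨hi.le.trans h1.1, hr⟩
    rw [Finset.sum_eq_single (Nat.find h), if_pos ⟨h1.2, h2⟩, if_neg, add_zero]
    · intro hn
      exact hn _ h1.1 h1.2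
    · intro s _ hne
      refine if_neg fun hs => ?_
      rcases lt_or_gt_of_ne hne with hlt | hlt
      · exact h2 s hlt hs.1
      · exact hs.2 _ hlt h1.2
    · intro hn
      refine absurd ?_ hn
      obtain ⟨h3, t, h4, h5, -⟩ := id h1.2
      rw [mem_filter, mem_Ico]
      exact ⟨⟨h3, by omega⟩, h1.1⟩
  · push Not at h
    rw [if_pos h, Finset.sum_eq_zero, zero_add]
    · intro s hs
      exact if_neg fun hr => h s (mem_filter.1 hs).2 hr.1

/-! ### Invariance under shifts -/

theorem rootPartition_shift (q k : ℕ) {N : ℕ} (b : Fin N → ℕ) :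
    rootPartition q (fun j => k + b j) = fun j => k + rootPartition q b j := by
  funext j
  simp only [rootPartition]
  ring

theorem dominated_shift {N : ℕ} (k : ℕ) {μ ν : Fin N → ℕ} :
    Dominated (fun j => k + μ j) (fun j => k + ν j) ↔ Dominated μ ν := by
  have m : ∀ f : Fin N → ℕ, Monotone (fun j => k + f j) ↔ Monotone f := fun f =>
    ⟨fun h i j hij => Nat.le_of_add_le_add_left (h hij), fun h i j hij =>
      Nat.add_le_add_left (h hij) _⟩
  have e : ∀ (f : Fin N → ℕ) i, tail (fun j => k + f j) i =
      tail (fun _ : Fin N => k) i + tail f i :=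
    fun f i => tail_add _ _ i
  simp only [dominated_iff, m, e, Nat.add_left_cancel_iff, Nat.add_le_add_iff_left]

theorem le_of_dominated {N : ℕ} {μ ν : Fin N → ℕ} (h : Dominated μ ν) {k : ℕ}
    (hk : ∀ j, k ≤ ν j) (j : Fin N) : k ≤ μ j := by
  obtain ⟨h1, -, h3, h4⟩ := (dominated_iff _ _).1 h
  have hN : 0 < N := j.pos
  have e1 := tail_eq_add_tail_succ μ ⟨0, hN⟩
  have e2 := tail_eq_add_tail_succ ν ⟨0, hN⟩
  simp only at e1 e2
  have h5 := h4 (0 + 1)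
  have h6 : μ ⟨0, hN⟩ ≤ μ j := h1 (Fin.le_def.2 (Nat.zero_le _))
  have := hk ⟨0, hN⟩
  omega

theorem weight_shift (q k : ℕ) (γ : ℝ) {N : ℕ} {b μ : Fin N → ℕ}
    (h : Dominated μ (rootPartition q b)) :
    weight q γ (fun j => k + b j) (fun j => k + μ j) = weight q γ b μ := by
  have hs : ∑ j, (μ j : ℝ) = ∑ j, (rootPartition q b j : ℝ) := by exact_mod_cast h.sum_eq
  rw [weight, weight, monCoeff_shift, multFactorial_shift, rootPartition_shift]
  congr 4
  simp only [Nat.cast_add, add_sq, Finset.sum_add_distrib, ← Finset.mul_sum, hs]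
  ring

theorem hasRenewalPoint_shift (q k : ℕ) {N : ℕ} {b μ : Fin N → ℕ} (hb : Monotone b)
    (h : Dominated μ (rootPartition q b)) (s : ℕ) :
    HasRenewalPoint q (fun j => k + b j) (fun j => k + μ j) s ↔ HasRenewalPoint q b μ s := by
  rw [hasRenewalPoint_iff hb h, hasRenewalPoint_iff (fun _ _ hij => Nat.add_le_add_left (hb hij) _)
    (by rw [rootPartition_shift, dominated_shift]; exact h), rootPartition_shift,
    show (fun j => k + μ j) = fun j => (fun _ => k) j + μ j from rfl,
    show (fun j => k + rootPartition q b j) =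
      fun j => (fun _ => k) j + rootPartition q b j from rfl,
    tail_add, tail_add, Nat.add_left_cancel_iff]

theorem partWeight_shift {q : ℕ} (k : ℕ) (γ : ℝ) {N : ℕ} {b : Fin N → ℕ}
    {P Q : (Fin N → ℕ) → Prop}
    (h : ∀ μ, Dominated μ (rootPartition q b) → (P (fun j => k + μ j) ↔ Q μ)) :
    partWeight q γ (fun j => k + b j) P = partWeight q γ b Q := by
  classical
  unfold partWeight
  symm
  refine Finset.sum_bij (fun μ _ j => k + μ j) ?_ ?_ ?_ ?_
  · intro μ hμ
    simp only [mem_filter, mem_dominatedSet, rootPartition_shift, dominated_shift] at hμ ⊢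
    exact ⟨hμ.1, (h μ hμ.1).2 hμ.2⟩
  · intro μ _ μ' _ e
    funext j
    simpa using congrFun e j
  · intro μ hμ
    simp only [mem_filter, mem_dominatedSet, rootPartition_shift] at hμ
    have hk := le_of_dominated hμ.1 (k := k) fun j => Nat.le_add_right _ _
    have e : μ = fun j => k + (μ j - k) := funext fun j => (Nat.add_sub_cancel' (hk j)).symm
    have d : Dominated (fun j => μ j - k) (rootPartition q b) := by
      rw [← dominated_shift k, ← e]
      exact hμ.1
    refine ⟨fun j => μ j - k, ?_, e.symm⟩
    simp only [mem_filter, mem_dominatedSet]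
    refine ⟨d, (h _ d).1 ?_⟩
    rw [← e]
    exact hμ.2
  · intro μ hμ
    simp only [mem_filter, mem_dominatedSet] at hμ
    exact (weight_shift q k γ hμ.1).symm

theorem partWeight_true_shift (q k : ℕ) (γ : ℝ) {N : ℕ} (b : Fin N → ℕ) :
    partWeight q γ (fun j => k + b j) (fun _ => True) = partWeight q γ b fun _ => True :=
  partWeight_shift k γ fun _ _ => Iff.rfl

theorem partWeight_irred_shift (q k : ℕ) (γ : ℝ) {N : ℕ} {b : Fin N → ℕ} (hb : Monotone b) :
    partWeight q γ (fun j => k + b j) (Irred q fun j => k + b j) = partWeight q γ b (Irred q b) :=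
  partWeight_shift k γ fun _ hμ =>
    forall_congr' fun s => not_congr (hasRenewalPoint_shift q k hb hμ s)

/-! ### Blocks of a boundary sequence -/

/-- The block of length `n` that starts at index `i`. -/
def block (b : ℕ → ℕ) (i n : ℕ) : Fin n → ℕ := fun j => b (i + j)

theorem monotone_block {b : ℕ → ℕ} (hb : Monotone b) (i n : ℕ) : Monotone (block b i n) :=
  fun _ _ h => hb (Nat.add_le_add_left h i)

/-- The total weight of a block. -/
noncomputable def blockWeight (q : ℕ) (γ : ℝ) (b : ℕ → ℕ) (i n : ℕ) : ℝ :=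
  partWeight q γ (block b i n) fun _ => True

/-- The weight of the irreducible partitions of a block. -/
noncomputable def irredWeight (q : ℕ) (γ : ℝ) (b : ℕ → ℕ) (i n : ℕ) : ℝ :=
  partWeight q γ (block b i n) (Irred q (block b i n))

theorem blockWeight_shift {q : ℕ} (γ : ℝ) {b b' : ℕ → ℕ} {i n k : ℕ}
    (h : ∀ j < n, b' (i + j) = k + b (i + j)) :
    blockWeight q γ b' i n = blockWeight q γ b i n := by
  have : block b' i n = fun j => k + block b i n j := funext fun j => h j j.2
  rw [blockWeight, this]
  exact partWeight_true_shift q k γ _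

theorem irredWeight_shift {q : ℕ} (γ : ℝ) {b b' : ℕ → ℕ} (hb : Monotone b) {i n k : ℕ}
    (h : ∀ j < n, b' (i + j) = k + b (i + j)) :
    irredWeight q γ b' i n = irredWeight q γ b i n := by
  have : block b' i n = fun j => k + block b i n j := funext fun j => h j j.2
  rw [irredWeight, this]
  exact partWeight_irred_shift q k γ (monotone_block hb i n)

/-- The renewal equation, with renewal points up to `L` taken into account. -/
theorem blockWeight_eq {q : ℕ} (hq : 1 ≤ q) (γ : ℝ) {b : ℕ → ℕ} (hb : Monotone b) (i n L : ℕ) :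
    blockWeight q γ b i n =
      ∑ s ∈ (Ico 1 n).filter (· ≤ L), irredWeight q γ b i s * blockWeight q γ b (i + s) (n - s) +
      partWeight q γ (block b i n)
        (fun μ => ∀ s, s ≤ L → ¬ HasRenewalPoint q (block b i n) μ s) := by
  rw [blockWeight, partWeight_eq_sum_first γ _ L]
  congr 1
  refine Finset.sum_congr rfl fun s hs => ?_
  obtain ⟨hs, -⟩ := mem_filter.1 hs
  obtain ⟨h1, h2⟩ := mem_Ico.1 hs
  obtain ⟨t, rfl⟩ := Nat.exists_eq_add_of_lt h2
  have hm := monotone_block hb i (s + (t + 1))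
  have hc := compose_split (t := t + 1) hm h1
  obtain ⟨m₁, m₂⟩ := monotone_split hm (lastEntry (block b i (s + (t + 1)) ∘ Fin.castAdd (t + 1)))
  have := partWeight_first_renewal hq γ h1 (Nat.le_add_left 1 t) m₁ m₂
  rw [hc] at this
  refine this.trans ?_
  have e : s + t + 1 - s = t + 1 := by omega
  rw [e]
  congr 1
  rw [← partWeight_true_shift q (lastEntry (block b i (s + (t + 1)) ∘ Fin.castAdd (t + 1)))]
  rw [blockWeight]
  congr 1
  funext j
  have := congrFun hc (Fin.natAdd s j)
  rw [compose, Fin.append_right] at this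
  rw [this, block, block, Fin.val_natAdd, add_assoc]

/-! ### Energy estimates -/

/-- Abel summation: a sequence with nonnegative tail sums has a nonnegative pairing with every
nondecreasing sequence, up to the contribution of the total sum. -/
theorem mul_sum_le_sum_mul_of_tail_nonneg : ∀ {N : ℕ} (a g : Fin N → ℝ), Monotone g →
    (∀ i : ℕ, 0 ≤ ∑ j : Fin N, if i ≤ (j : ℕ) then a j else 0) → ∀ c, (∀ j, c ≤ g j) →
    c * ∑ j, a j ≤ ∑ j, a j * g j := by
  intro N
  induction N with
  | zero => intro a g _ _ c _; simp
  | succ n ih =>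
    intro a g hg ha c hc
    have h1 := ih (fun j => a j.succ) (fun j => g j.succ)
      (fun i j h => hg (Fin.succ_le_succ_iff.2 h))
      (fun i => by simpa [Fin.sum_univ_succ] using ha (i + 1)) (g 0) (fun j => hg (Fin.zero_le _))
    have h2 := ha 0
    simp only [Nat.zero_le, if_true] at h2
    calc c * ∑ j, a j ≤ g 0 * ∑ j, a j := mul_le_mul_of_nonneg_right (hc 0) h2
      _ = a 0 * g 0 + g 0 * ∑ j : Fin n, a j.succ := by rw [Fin.sum_univ_succ]; ring
      _ ≤ a 0 * g 0 + ∑ j : Fin n, a j.succ * g j.succ := by linarith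
      _ = ∑ j, a j * g j := by rw [Fin.sum_univ_succ]

/-- The tail sums add up to the first moment. -/
theorem sum_tail {N : ℕ} (μ : Fin N → ℕ) :
    ∑ i ∈ Ico 1 N, tail μ i = ∑ j : Fin N, (j : ℕ) * μ j := by
  simp only [tail]
  rw [Finset.sum_comm]
  refine Finset.sum_congr rfl fun j _ => ?_
  rw [← Finset.sum_filter]
  have : (Ico 1 N).filter (· ≤ (j : ℕ)) = Ico 1 ((j : ℕ) + 1) := by
    ext i
    have := j.2
    simp only [mem_filter, mem_Ico]
    omega
  rw [this]
  simp

/-- The displacement between two sequences: `∑ⱼ j (νⱼ - μⱼ)`, the sum of the differences of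
their tail sums. -/
def displacement {N : ℕ} (ν μ : Fin N → ℕ) : ℕ :=
  ∑ j : Fin N, (j : ℕ) * ν j - ∑ j : Fin N, (j : ℕ) * μ j

theorem displacement_eq {N : ℕ} {μ ν : Fin N → ℕ} (h : Dominated μ ν) :
    displacement ν μ = ∑ i ∈ Ico 1 N, (tail ν i - tail μ i) := by
  obtain ⟨-, -, -, h4⟩ := (dominated_iff _ _).1 h
  rw [displacement, ← sum_tail, ← sum_tail, Finset.sum_tsub_distrib _ fun i _ => h4 i]

theorem displacement_add {N : ℕ} {μ ν : Fin N → ℕ} (h : Dominated μ ν) :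
    ∑ j : Fin N, (j : ℕ) * μ j + displacement ν μ = ∑ j : Fin N, (j : ℕ) * ν j := by
  obtain ⟨-, -, -, h4⟩ := (dominated_iff _ _).1 h
  rw [displacement, ← sum_tail, ← sum_tail]
  exact Nat.add_sub_cancel' (Finset.sum_le_sum fun i _ => h4 i)

/-- At every position without a renewal point the tail sums differ by at least one. -/
theorem le_displacement_of_no_renewal {q N : ℕ} {b μ : Fin N → ℕ} (hb : Monotone b)
    (h : Dominated μ (rootPartition q b)) {L : ℕ} (hL : L + 1 ≤ N)
    (hr : ∀ s, s ≤ L → ¬ HasRenewalPoint q b μ s) :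
    L ≤ displacement (rootPartition q b) μ := by
  rw [displacement_eq h]
  calc L = ∑ i ∈ Ico 1 (L + 1), 1 := by simp
    _ ≤ ∑ i ∈ Ico 1 (L + 1), (tail (rootPartition q b) i - tail μ i) := by
      refine Finset.sum_le_sum fun i hi => ?_
      obtain ⟨h1, h2⟩ := mem_Ico.1 hi
      have h3 := hr i (by omega)
      rw [hasRenewalPoint_iff hb h] at h3
      have h4 := ((dominated_iff _ _).1 h).2.2.2 i
      have h5 : ¬ tail μ i = tail (rootPartition q b) i := fun e => h3 ⟨h1, by omega, e⟩
      omega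
    _ ≤ _ := Finset.sum_le_sum_of_subset (Ico_subset_Ico le_rfl hL)

/-- The loss of the quadratic energy `∑ⱼ λⱼ² - ∑ⱼ μⱼ²` of a dominated partition. -/
noncomputable def energyGap (q : ℕ) {N : ℕ} (b μ : Fin N → ℕ) : ℝ :=
  ∑ j, (rootPartition q b j : ℝ) ^ 2 - ∑ j, (μ j : ℝ) ^ 2

/-- From `λⱼ² - μⱼ² = (λⱼ - μⱼ)(q j + (bⱼ + μⱼ))`: the first summand yields the displacement, and
the second one a nonnegative term by Abel summation. -/
theorem mul_displacement_le_energyGap {q N : ℕ} {b μ : Fin N → ℕ} (hb : Monotone b)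
    (h : Dominated μ (rootPartition q b)) :
    (q : ℝ) * displacement (rootPartition q b) μ ≤ energyGap q b μ := by
  obtain ⟨h1, -, h3, h4⟩ := (dominated_iff _ _).1 h
  have key := mul_sum_le_sum_mul_of_tail_nonneg
    (fun j => (rootPartition q b j : ℝ) - μ j) (fun j => (b j : ℝ) + μ j)
    (fun i j hij => add_le_add (Nat.cast_le.2 (hb hij)) (Nat.cast_le.2 (h1 hij)))
    (fun i => by
      have e : ∀ ν : Fin N → ℕ, (tail ν i : ℝ) =
          ∑ j : Fin N, if i ≤ (j : ℕ) then (ν j : ℝ) else 0 :=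
        fun ν => by rw [tail]; push_cast; rfl
      have h5 : (tail μ i : ℝ) ≤ tail (rootPartition q b) i := by exact_mod_cast h4 i
      rw [e, e] at h5
      have : (∑ j : Fin N, if i ≤ (j : ℕ) then (rootPartition q b j : ℝ) - μ j else 0) =
          (∑ j : Fin N, if i ≤ (j : ℕ) then (rootPartition q b j : ℝ) else 0) -
            ∑ j : Fin N, if i ≤ (j : ℕ) then (μ j : ℝ) else 0 := by
        rw [← Finset.sum_sub_distrib]
        refine Finset.sum_congr rfl fun j _ => ?_
        split_ifs <;> simp
      rw [this]
      linarith) 0 (fun j => by positivity)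
  have e1 : (displacement (rootPartition q b) μ : ℝ) =
      ∑ j : Fin N, (j : ℝ) * rootPartition q b j - ∑ j : Fin N, (j : ℝ) * μ j := by
    have := displacement_add h
    rw [eq_sub_iff_add_eq']
    exact_mod_cast this
  have e2 : energyGap q b μ - q * displacement (rootPartition q b) μ =
      ∑ j, ((rootPartition q b j : ℝ) - μ j) * ((b j : ℝ) + μ j) := by
    rw [e1, energyGap, ← Finset.sum_sub_distrib, ← Finset.sum_sub_distrib, Finset.mul_sum,
      ← Finset.sum_sub_distrib]
    refine Finset.sum_congr rfl fun j _ => ?_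
    simp only [rootPartition]
    push_cast
    ring
  rw [zero_mul] at key
  linarith

/-! ### Estimates for sums of coefficients -/

theorem mem_rearr_init {n : ℕ} {b β : Fin (n + 1) → ℕ} (h : β ∈ rearr b) {i : Fin (n + 1)}
    (hi : β (Fin.last n) = b i) :
    (fun j => β (Fin.castSucc j)) ∈ rearr fun j => b (i.succAbove j) := by
  refine mem_rearr_of_count fun k => ?_
  have h1 := card_eq_of_mem_rearr h k
  simp only [card_filter] at h1 ⊢
  rw [Fin.sum_univ_castSucc, Fin.sum_univ_succAbove _ i, hi] at h1
  omega

/-- The monomial symmetric polynomial at `wⱼ = 2^j` exceeds its largest term by a factor of at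
most `2^N`. The rearrangements are grouped according to their last entry: moving `bᵢ` to the
end costs a factor of at least `2^{n - i}`, because the `n - i` larger entries behind it move one
step down. -/
theorem sum_rearr_two_pow_le : ∀ {N : ℕ} {b : Fin N → ℕ}, Monotone b →
    ∑ β ∈ rearr b, 2 ^ (∑ j : Fin N, (j : ℕ) * β j) ≤ 2 ^ N * 2 ^ (∑ j : Fin N, (j : ℕ) * b j) := by
  intro N
  induction N with
  | zero =>
    intro b _
    have : rearr b = {b} := by
      ext β
      rw [Subsingleton.elim β b]
      simp [self_mem_rearr]
    simp [this]
  | succ n ih =>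
    intro b hb
    set I : Finset (Fin (n + 1)) := univ.filter fun i => ∀ j, i < j → b i < b j with hI
    set F : (Fin (n + 1) → ℕ) → ℕ := fun β => 2 ^ (∑ j : Fin (n + 1), (j : ℕ) * β j) with hF
    set S := ∑ j : Fin (n + 1), (j : ℕ) * b j with hS
    -- the last entry of a rearrangement is `b i` for an index `i` after which `b` increases
    have hex : ∀ β ∈ rearr b, ∃ i ∈ I, β (Fin.last n) = b i := by
      intro β hβ
      obtain ⟨σ, rfl⟩ := mem_rearr.1 hβ
      set T : Finset (Fin (n + 1)) := univ.filter fun i => b i = b (σ (Fin.last n))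
      have hT : T.Nonempty := ⟨σ (Fin.last n), by simp [T]⟩
      refine ⟨T.max' hT, ?_, ?_⟩
      · rw [hI, mem_filter]
        refine ⟨mem_univ _, fun j hj => lt_of_le_of_ne (hb hj.le) fun e => ?_⟩
        have h1 := (mem_filter.1 (T.max'_mem hT)).2
        exact absurd (T.le_max' j (mem_filter.2 ⟨mem_univ _, e ▸ h1⟩)) (not_le.2 hj)
      · exact (mem_filter.1 (T.max'_mem hT)).2.symm
    have hstep : ∀ i ∈ I, ∑ β ∈ (rearr b).filter (fun β => β (Fin.last n) = b i), F β ≤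
        2 ^ (S + i) := by
      intro i hi
      have hi' := (mem_filter.1 hi).2
      set b' : Fin n → ℕ := fun j => b (i.succAbove j) with hb'
      have hm : Monotone b' := fun _ _ h => hb (i.strictMono_succAbove.monotone h)
      have hle : ∑ β ∈ (rearr b).filter (fun β => β (Fin.last n) = b i), F β ≤
          ∑ β ∈ rearr b', 2 ^ (∑ j : Fin n, (j : ℕ) * β j) * 2 ^ (n * b i) := by
        have e : ∀ β ∈ (rearr b).filter (fun β => β (Fin.last n) = b i), F β =
            2 ^ (∑ j : Fin n, (j : ℕ) * β (Fin.castSucc j)) * 2 ^ (n * b i) := by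
          intro β hβ
          rw [hF]
          simp only
          rw [Fin.sum_univ_castSucc, (mem_filter.1 hβ).2, pow_add]
          simp
        rw [Finset.sum_congr rfl e]
        refine (Finset.sum_image (s := (rearr b).filter (fun β => β (Fin.last n) = b i))
          (g := fun β j => β (Fin.castSucc j))
          (f := fun β : Fin n → ℕ => 2 ^ (∑ j : Fin n, (j : ℕ) * β j) * 2 ^ (n * b i))
          ?_).symm.le.trans ?_
        · intro β hβ β' hβ' h
          funext j
          refine Fin.lastCases ?_ (fun j => ?_) j
          · rw [(mem_filter.1 hβ).2, (mem_filter.1 hβ').2]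
          · exact congrFun h j
        · refine Finset.sum_le_sum_of_subset fun β hβ => ?_
          obtain ⟨β', h', rfl⟩ := mem_image.1 hβ
          exact mem_rearr_init (mem_filter.1 h').1 (mem_filter.1 h').2
      refine hle.trans ?_
      rw [← Finset.sum_mul]
      refine (Nat.mul_le_mul_right _ (ih hm)).trans ?_
      rw [← pow_add, ← pow_add]
      refine Nat.pow_le_pow_right two_pos ?_
      have e1 : S = i * b i + (∑ j : Fin n, (j : ℕ) * b' j +
          ∑ j : Fin n, if (i : ℕ) ≤ j then b' j else 0) := by
        rw [hS, Fin.sum_univ_succAbove _ i, ← Finset.sum_add_distrib]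
        congr 1
        refine Finset.sum_congr rfl fun j _ => ?_
        by_cases hj : (i : ℕ) ≤ j
        · rw [Fin.succAbove_of_le_castSucc _ _ (Fin.le_def.2 hj), if_pos hj, hb']
          simp only
          rw [Fin.succAbove_of_le_castSucc _ _ (Fin.le_def.2 hj), Fin.val_succ]
          ring
        · rw [Fin.succAbove_of_castSucc_lt _ _ (Fin.lt_def.2 (not_le.1 hj)), if_neg hj, hb']
          simp only
          rw [Fin.succAbove_of_castSucc_lt _ _ (Fin.lt_def.2 (not_le.1 hj)), Fin.val_castSucc]
          ring
      have e2 : (n - i) * (b i + 1) ≤ ∑ j : Fin n, if (i : ℕ) ≤ j then b' j else 0 := by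
        calc (n - i) * (b i + 1) = ∑ j : Fin n, if (i : ℕ) ≤ j then b i + 1 else 0 := by
              rw [Fin.sum_univ_eq_sum_range (fun j => if (i : ℕ) ≤ j then b i + 1 else 0) n,
                ← Finset.sum_filter, Finset.sum_const, smul_eq_mul]
              congr 1
              have : (range n).filter (fun j => (i : ℕ) ≤ j) = Ico (i : ℕ) n := by
                ext j
                simp only [mem_filter, mem_range, mem_Ico]
                omega
              rw [this, Nat.card_Ico]
          _ ≤ _ := by
              refine Finset.sum_le_sum fun j _ => ?_
              split_ifs with hj
              · refine hi' _ ?_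
                rw [Fin.succAbove_of_le_castSucc _ _ (Fin.le_def.2 hj), Fin.lt_def, Fin.val_succ]
                omega
              · exact le_rfl
      have e3 : (n - i) * (b i + 1) + i * (b i + 1) = n * (b i + 1) := by
        rw [← Nat.add_mul, Nat.sub_add_cancel (by omega)]
      nlinarith
    calc ∑ β ∈ rearr b, F β
        ≤ ∑ β ∈ rearr b, ∑ i ∈ I, if β (Fin.last n) = b i then F β else 0 := by
          refine Finset.sum_le_sum fun β hβ => ?_
          obtain ⟨i, hi, e⟩ := hex β hβ
          refine le_trans ?_ (Finset.single_le_sum (fun _ _ => Nat.zero_le _) hi)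
          rw [if_pos e]
      _ = ∑ i ∈ I, ∑ β ∈ (rearr b).filter (fun β => β (Fin.last n) = b i), F β := by
          rw [Finset.sum_comm]
          exact Finset.sum_congr rfl fun i _ => (Finset.sum_filter _ _).symm
      _ ≤ ∑ i ∈ I, 2 ^ (S + i) := Finset.sum_le_sum hstep
      _ ≤ ∑ i : Fin (n + 1), 2 ^ (S + i) := Finset.sum_le_sum_of_subset (subset_univ _)
      _ = 2 ^ S * ∑ i ∈ range (n + 1), 2 ^ i := by
          rw [Fin.sum_univ_eq_sum_range (fun i => 2 ^ (S + i)) (n + 1), Finset.mul_sum]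
          exact Finset.sum_congr rfl fun i _ => pow_add _ _ _
      _ ≤ 2 ^ (n + 1) * 2 ^ S := by
          rw [mul_comm]
          exact Nat.mul_le_mul_right _ (Nat.geomSum_lt le_rfl (by simp)).le

/-- The polynomial `m_b ∏_{j<k} (wₖ + wⱼ)^q`, whose coefficients bound those of the
wavefunction. -/
noncomputable def majorantPoly (q : ℕ) {N : ℕ} (b : Fin N → ℕ) : MvPolynomial (Fin N) ℝ :=
  monomialPoly b * ∏ j, ∏ k ∈ Ioi j, (MvPolynomial.X k + MvPolynomial.X j) ^ q

/-- Coefficientwise domination of a polynomial. -/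
def Majorizes {N : ℕ} (P p : MvPolynomial (Fin N) ℝ) : Prop :=
  ∀ m, |MvPolynomial.coeff m p| ≤ MvPolynomial.coeff m P

theorem Majorizes.mul {N : ℕ} {P p Q r : MvPolynomial (Fin N) ℝ} (h : Majorizes P p)
    (h' : Majorizes Q r) : Majorizes (P * Q) (p * r) := by
  classical
  intro m
  rw [MvPolynomial.coeff_mul, MvPolynomial.coeff_mul]
  refine (Finset.abs_sum_le_sum_abs _ _).trans (Finset.sum_le_sum fun x _ => ?_)
  rw [abs_mul]
  exact mul_le_mul (h _) (h' _) (abs_nonneg _) ((abs_nonneg _).trans (h _))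

theorem Majorizes.one {N : ℕ} : Majorizes (1 : MvPolynomial (Fin N) ℝ) 1 := by
  classical
  intro m
  rw [MvPolynomial.coeff_one]
  split_ifs <;> simp

theorem Majorizes.pow {N : ℕ} {P p : MvPolynomial (Fin N) ℝ} (h : Majorizes P p) (n : ℕ) :
    Majorizes (P ^ n) (p ^ n) := by
  induction n with
  | zero => simpa using Majorizes.one
  | succ n ih => rw [pow_succ, pow_succ]; exact ih.mul h

theorem Majorizes.prod {N : ℕ} {ι : Type*} {P p : ι → MvPolynomial (Fin N) ℝ} {s : Finset ι}
    (h : ∀ i ∈ s, Majorizes (P i) (p i)) : Majorizes (∏ i ∈ s, P i) (∏ i ∈ s, p i) := by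
  classical
  induction s using Finset.induction_on with
  | empty => simpa using Majorizes.one
  | insert a s ha ih =>
    rw [Finset.prod_insert ha, Finset.prod_insert ha]
    exact (h a (mem_insert_self _ _)).mul (ih fun i hi => h i (mem_insert_of_mem hi))

theorem majorizes_monomialPoly {N : ℕ} (b : Fin N → ℕ) :
    Majorizes (monomialPoly b) (monomialPoly b) := by
  classical
  intro m
  refine (abs_of_nonneg ?_).le
  rw [monomialPoly, MvPolynomial.coeff_sum]
  refine Finset.sum_nonneg fun β _ => ?_
  rw [MvPolynomial.coeff_monomial]
  split_ifs <;> simp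

theorem majorizes_majorantPoly (q : ℕ) {N : ℕ} (b : Fin N → ℕ) :
    Majorizes (majorantPoly q b) (monomialPoly b * vandPoly q N) := by
  classical
  refine (majorizes_monomialPoly b).mul (Majorizes.prod fun j _ => Majorizes.prod fun k _ =>
    Majorizes.pow (fun m => ?_) q)
  rw [MvPolynomial.coeff_sub, MvPolynomial.coeff_add, MvPolynomial.coeff_X, MvPolynomial.coeff_X]
  split_ifs <;> norm_num

/-- As `∏_{j<k} (1 + 2^{j-k}) ≤ exp (∑_{j<k} 2^{j-k}) ≤ e`. -/
theorem prod_Iio_le {k N : ℕ} (hk : k < N) :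
    ∏ j ∈ Iio (⟨k, hk⟩ : Fin N), ((2 : ℝ) ^ k + 2 ^ (j : ℕ)) ≤ (2 ^ k) ^ k * Real.exp 1 := by
  have e1 : ∏ j ∈ Iio (⟨k, hk⟩ : Fin N), ((2 : ℝ) ^ k + 2 ^ (j : ℕ)) =
      ∏ j ∈ range k, ((2 : ℝ) ^ k + 2 ^ j) := by
    have h := Finset.prod_map (Iio (⟨k, hk⟩ : Fin N)) Fin.valEmbedding
      (fun j => (2 : ℝ) ^ k + 2 ^ j)
    rw [Fin.map_valEmbedding_Iio] at h
    rw [← Nat.Iio_eq_range, h]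
    rfl
  rw [e1]
  have e2 : ∀ j ∈ range k, (2 : ℝ) ^ k + 2 ^ j ≤ 2 ^ k * Real.exp (2 ^ j / 2 ^ k) := by
    intro j _
    have := Real.add_one_le_exp ((2 : ℝ) ^ j / 2 ^ k)
    calc (2 : ℝ) ^ k + 2 ^ j = 2 ^ k * (2 ^ j / 2 ^ k + 1) := by field_simp; ring
      _ ≤ _ := mul_le_mul_of_nonneg_left this (by positivity)
  refine (Finset.prod_le_prod (fun j _ => by positivity) e2).trans ?_
  rw [Finset.prod_mul_distrib, Finset.prod_const, card_range, ← Real.exp_sum, ← Finset.sum_div]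
  refine mul_le_mul_of_nonneg_left (Real.exp_le_exp.2 ?_) (by positivity)
  rw [div_le_one (by positivity)]
  have : (∑ j ∈ range k, 2 ^ j : ℕ) < 2 ^ k := Nat.geomSum_lt le_rfl (by simp)
  exact_mod_cast this.le

/-- The majorant at `wⱼ = 2^j` exceeds the root term by a factor of at most `(2 e^q)^N`. -/
theorem eval_majorantPoly_le (q : ℕ) {N : ℕ} {b : Fin N → ℕ} (hb : Monotone b) :
    MvPolynomial.eval (fun j : Fin N => (2 : ℝ) ^ (j : ℕ)) (majorantPoly q b) ≤
      (2 * Real.exp q) ^ N * 2 ^ (∑ j : Fin N, (j : ℕ) * rootPartition q b j) := by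
  rw [majorantPoly, map_mul]
  have h1 : MvPolynomial.eval (fun j : Fin N => (2 : ℝ) ^ (j : ℕ)) (monomialPoly b) ≤
      2 ^ N * 2 ^ (∑ j : Fin N, (j : ℕ) * b j) := by
    rw [monomialPoly, map_sum]
    have e : ∀ β : Fin N → ℕ, MvPolynomial.eval (fun j : Fin N => (2 : ℝ) ^ (j : ℕ))
        (MvPolynomial.monomial (expo β) 1) = 2 ^ (∑ j : Fin N, (j : ℕ) * β j) := fun β => by
      rw [MvPolynomial.eval_monomial, one_mul, Finsupp.prod_fintype _ _ (fun _ => pow_zero _)]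
      simp only [expo_apply, ← pow_mul, Finset.prod_pow_eq_pow_sum]
    simp only [e]
    exact_mod_cast sum_rearr_two_pow_le hb
  have h2 : MvPolynomial.eval (fun j : Fin N => (2 : ℝ) ^ (j : ℕ))
      (∏ j, ∏ k ∈ Ioi j, (MvPolynomial.X k + MvPolynomial.X j) ^ q) ≤
      Real.exp q ^ N * 2 ^ (∑ j : Fin N, (j : ℕ) * (q * j)) := by
    simp only [map_prod, map_pow, map_add, MvPolynomial.eval_X]
    rw [Finset.prod_comm' (t' := univ) (s' := fun k => Iio k) (by simp)]
    have h3 : ∀ k ∈ (univ : Finset (Fin N)), ∏ j ∈ Iio k, ((2 : ℝ) ^ (k : ℕ) + 2 ^ (j : ℕ)) ^ q ≤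
        Real.exp q * 2 ^ ((k : ℕ) * (q * k)) := by
      intro k _
      rw [Finset.prod_pow]
      refine (pow_le_pow_left₀ (Finset.prod_nonneg fun j _ => by positivity)
        (prod_Iio_le k.2) q).trans (le_of_eq ?_)
      rw [mul_pow, ← Real.exp_nat_mul, mul_one, ← pow_mul, ← pow_mul, mul_comm]
      congr 2
      ring
    refine (Finset.prod_le_prod (fun k _ => by positivity) h3).trans (le_of_eq ?_)
    rw [Finset.prod_mul_distrib, Finset.prod_pow_eq_pow_sum]
    simp
  refine (mul_le_mul h1 h2 ?_ (by positivity)).trans (le_of_eq ?_)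
  · simp only [map_prod, map_pow, map_add, MvPolynomial.eval_X]
    positivity
  · have : ∑ j : Fin N, (j : ℕ) * rootPartition q b j =
        ∑ j : Fin N, (j : ℕ) * b j + ∑ j : Fin N, (j : ℕ) * (q * j) := by
      rw [← Finset.sum_add_distrib]
      exact Finset.sum_congr rfl fun j _ => by rw [rootPartition]; ring
    rw [this, pow_add, mul_pow]
    ring

/-- A bound on all coefficients at once: each of them is damped by `2` to the power of the
displacement of its exponent. -/
theorem sum_abs_monCoeff_le (q : ℕ) {N : ℕ} {b : Fin N → ℕ} (hb : Monotone b)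
    (S : Finset (Fin N → ℕ)) :
    ∑ μ ∈ S, |monCoeff q b μ| * 2 ^ (∑ j : Fin N, (j : ℕ) * μ j) ≤
      (2 * Real.exp q) ^ N * 2 ^ (∑ j : Fin N, (j : ℕ) * rootPartition q b j) := by
  classical
  refine le_trans ?_ (eval_majorantPoly_le q hb)
  set P := majorantPoly q b
  have hP : ∀ m, 0 ≤ MvPolynomial.coeff m P := fun m =>
    (abs_nonneg _).trans (majorizes_majorantPoly q b m)
  set G : (Fin N →₀ ℕ) → ℝ := fun m => MvPolynomial.coeff m P *
    ∏ j : Fin N, ((2 : ℝ) ^ (j : ℕ)) ^ m j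
  have hG : ∀ m, 0 ≤ G m := fun m => mul_nonneg (hP m) (by positivity)
  calc ∑ μ ∈ S, |monCoeff q b μ| * 2 ^ (∑ j : Fin N, (j : ℕ) * μ j)
      ≤ ∑ μ ∈ S, G (expo μ) := by
        refine Finset.sum_le_sum fun μ _ => ?_
        have : ∏ j : Fin N, ((2 : ℝ) ^ (j : ℕ)) ^ (expo μ j) =
            2 ^ (∑ j : Fin N, (j : ℕ) * μ j) := by
          simp only [expo_apply, ← pow_mul, Finset.prod_pow_eq_pow_sum]
        simp only [G]
        rw [this]
        exact mul_le_mul_of_nonneg_right (majorizes_majorantPoly q b _) (by positivity)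
    _ = ∑ m ∈ S.image expo, G m := (Finset.sum_image fun _ _ _ _ h => expo_injective h).symm
    _ ≤ ∑ m ∈ S.image expo ∪ P.support, G m :=
        Finset.sum_le_sum_of_subset_of_nonneg subset_union_left fun _ _ _ => hG _
    _ = ∑ m ∈ P.support, G m := by
        refine (Finset.sum_subset subset_union_right fun m _ hm => ?_).symm
        simp only [G]
        rw [MvPolynomial.notMem_support_iff.1 hm, zero_mul]
    _ = _ := (MvPolynomial.eval_eq' _ _).symm

/-- The weight of partitions whose energy gap is at least `q k` decays exponentially in `k`. -/
theorem partWeight_le {q : ℕ} {γ : ℝ} (hy : 4 * Real.exp (-(γ ^ 2 * q)) ≤ 1) {N : ℕ}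
    {b : Fin N → ℕ} (hb : Monotone b) {P : (Fin N → ℕ) → Prop} (k : ℕ)
    (hP : ∀ μ, Dominated μ (rootPartition q b) → P μ → (q : ℝ) * k ≤ energyGap q b μ) :
    partWeight q γ b P ≤ ((2 * Real.exp q) ^ N) ^ 2 * (4 * Real.exp (-(γ ^ 2 * q))) ^ k := by
  classical
  set x := Real.exp (-(γ ^ 2 * q / 2)) with hx
  have hxy : 4 * Real.exp (-(γ ^ 2 * q)) = (2 * x) ^ 2 := by
    rw [mul_pow, hx, ← Real.exp_nat_mul]
    norm_num
    ring
  have hx0 : 0 < x := Real.exp_pos _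
  have hx1 : 2 * x ≤ 1 := by
    rw [hxy] at hy
    nlinarith
  set S := (dominatedSet q b).filter P
  set D := fun μ : Fin N → ℕ => displacement (rootPartition q b) μ
  have hterm : ∀ μ ∈ S, weight q γ b μ ≤
      (|monCoeff q b μ| * ((1 / 2 : ℝ) ^ D μ * (2 * x) ^ k)) ^ 2 := by
    intro μ hμ
    obtain ⟨hμ1, hμ2⟩ := mem_filter.1 hμ
    rw [mem_dominatedSet] at hμ1
    -- the energy gap is at least `q D μ` and at least `q k`; of the resulting `x ^ e`, a factor
    -- `2 ^ (-D μ)` is kept for the sum over `μ` and a factor `(2 x) ^ k` is the decay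
    set e := max (D μ) k
    have he : (q : ℝ) * e ≤ energyGap q b μ := by
      rcases max_choice (D μ) k with h | h
      · rw [show e = D μ from h]; exact mul_displacement_le_energyGap hb hμ1
      · rw [show e = k from h]; exact hP μ hμ1 hμ2
    have h1 : Real.exp (-(γ ^ 2 * energyGap q b μ)) ≤ (x ^ e) ^ 2 := by
      rw [hx, ← Real.exp_nat_mul, ← Real.exp_nat_mul]
      refine Real.exp_le_exp.2 ?_
      have := mul_le_mul_of_nonneg_left he (sq_nonneg γ)
      push_cast
      linarith
    have h2 : x ^ e ≤ (1 / 2 : ℝ) ^ D μ * (2 * x) ^ k := by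
      calc x ^ e = (1 / 2 : ℝ) ^ e * (2 * x) ^ e := by rw [← mul_pow]; congr 1; ring
        _ ≤ _ := mul_le_mul (pow_le_pow_of_le_one (by norm_num) (by norm_num) (le_max_left _ _))
              (pow_le_pow_of_le_one (by positivity) hx1 (le_max_right _ _)) (by positivity)
              (by positivity)
    calc weight q γ b μ = monCoeff q b μ ^ 2 / multFactorial μ *
          Real.exp (-(γ ^ 2 * energyGap q b μ)) := rfl
      _ ≤ monCoeff q b μ ^ 2 * (x ^ e) ^ 2 := by
          refine mul_le_mul (div_le_self (sq_nonneg _) ?_) h1 (Real.exp_pos _).le (sq_nonneg _)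
          exact_mod_cast multFactorial_pos μ
      _ = (|monCoeff q b μ| * x ^ e) ^ 2 := by rw [mul_pow, sq_abs]
      _ ≤ _ := by gcongr
  calc partWeight q γ b P = ∑ μ ∈ S, weight q γ b μ := rfl
    _ ≤ ∑ μ ∈ S, (|monCoeff q b μ| * ((1 / 2 : ℝ) ^ D μ * (2 * x) ^ k)) ^ 2 :=
        Finset.sum_le_sum hterm
    _ ≤ (∑ μ ∈ S, |monCoeff q b μ| * ((1 / 2 : ℝ) ^ D μ * (2 * x) ^ k)) ^ 2 :=
        Finset.sum_sq_le_sq_sum_of_nonneg fun μ _ => by positivity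
    _ ≤ ((2 * Real.exp q) ^ N * (2 * x) ^ k) ^ 2 := by
        refine pow_le_pow_left₀ (Finset.sum_nonneg fun μ _ => by positivity) ?_ 2
        simp only [← mul_assoc]
        rw [← Finset.sum_mul]
        refine mul_le_mul_of_nonneg_right ?_ (by positivity)
        have h := sum_abs_monCoeff_le q hb S
        set s := ∑ j : Fin N, (j : ℕ) * rootPartition q b j
        have h3 : ∀ μ ∈ S, |monCoeff q b μ| * (1 / 2 : ℝ) ^ D μ =
            |monCoeff q b μ| * 2 ^ (∑ j : Fin N, (j : ℕ) * μ j) / 2 ^ s := by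
          intro μ hμ
          have hμ1 := (mem_dominatedSet q b μ).1 (mem_filter.1 hμ).1
          rw [show s = ∑ j : Fin N, (j : ℕ) * μ j + D μ from (displacement_add hμ1).symm, pow_add,
            one_div, inv_pow]
          field_simp
        rw [Finset.sum_congr rfl h3, ← Finset.sum_div, div_le_iff₀ (by positivity)]
        exact h
    _ = _ := by rw [mul_pow, hxy, ← pow_mul (2 * x), ← pow_mul (2 * x), mul_comm k 2]

/-! ### Irreducible weights -/

theorem partWeight_no_renewal_le {q : ℕ} {γ : ℝ} (hy : 4 * Real.exp (-(γ ^ 2 * q)) ≤ 1) {N : ℕ}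
    {b : Fin N → ℕ} (hb : Monotone b) {P : (Fin N → ℕ) → Prop} {L : ℕ} (hL : L + 1 ≤ N)
    (hP : ∀ μ, P μ → ∀ s, s ≤ L → ¬ HasRenewalPoint q b μ s) :
    partWeight q γ b P ≤ ((2 * Real.exp q) ^ N) ^ 2 * (4 * Real.exp (-(γ ^ 2 * q))) ^ L := by
  refine partWeight_le hy hb L fun μ hμ hr => le_trans ?_ (mul_displacement_le_energyGap hb hμ)
  exact mul_le_mul_of_nonneg_left
    (Nat.cast_le.2 (le_displacement_of_no_renewal hb hμ hL (hP μ hr))) (Nat.cast_nonneg q)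

theorem irredWeight_le {q : ℕ} {γ : ℝ} (hy : 4 * Real.exp (-(γ ^ 2 * q)) ≤ 1) {b : ℕ → ℕ}
    (hb : Monotone b) (i : ℕ) {n : ℕ} (hn : 1 ≤ n) :
    irredWeight q γ b i n ≤
      ((2 * Real.exp q) ^ n) ^ 2 * (4 * Real.exp (-(γ ^ 2 * q))) ^ (n - 1) :=
  partWeight_no_renewal_le hy (monotone_block hb i n) (by omega) fun _ h s _ => h s

/-- A jump of the boundary sequence inside a block of length two costs an additional factor. -/
theorem irredWeight_two_le {q : ℕ} {γ : ℝ} (hy : 4 * Real.exp (-(γ ^ 2 * q)) ≤ 1) {b : ℕ → ℕ}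
    (hb : Monotone b) {i : ℕ} (hi : b i < b (i + 1)) :
    irredWeight q γ b i 2 ≤
      ((2 * Real.exp q) ^ 2) ^ 2 * (4 * Real.exp (-(γ ^ 2 * q))) ^ 2 := by
  have hm := monotone_block hb i 2
  refine partWeight_le hy hm 2 fun μ hμ hr => ?_
  have h1 := mt (hasRenewalPoint_iff hm hμ 1).2 (hr 1)
  obtain ⟨h2, -, h3, h4⟩ := (dominated_iff _ _).1 hμ
  have h5 := h4 1
  simp only [tail, Fin.sum_univ_two, rootPartition, block] at h1 h3 h5
  simp at h1 h3 h5
  have h6 : μ 0 ≤ μ 1 := h2 (Fin.zero_le _)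
  rw [energyGap, Fin.sum_univ_two, Fin.sum_univ_two]
  simp only [rootPartition, block]
  simp only [Fin.val_zero, Fin.val_one, mul_zero, add_zero, zero_add, mul_one, Nat.cast_add,
    Nat.cast_ofNat]
  obtain ⟨m, hm0⟩ : ∃ m, q + b (i + 1) = μ 1 + m := ⟨_, (Nat.add_sub_cancel' h5).symm⟩
  obtain ⟨d, hd⟩ : ∃ d, b (i + 1) = b i + 1 + d := ⟨b (i + 1) - (b i + 1), by omega⟩
  have e0 : (μ 0 : ℝ) = b i + m := by
    have : μ 0 = b i + m := by omega
    exact_mod_cast this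
  have e1 : (μ 1 : ℝ) = q + b (i + 1) - m := by
    rw [eq_sub_iff_add_eq]
    exact_mod_cast hm0.symm
  have e2 : (b (i + 1) : ℝ) = b i + 1 + d := by exact_mod_cast hd
  have m1 : (1 : ℝ) ≤ m := by
    have : 1 ≤ m := by omega
    exact_mod_cast this
  have m2 : (b i + m : ℝ) ≤ q + b (i + 1) - m := by
    rw [← e0, ← e1]
    exact_mod_cast h6
  rw [e0, e1]
  rw [e2] at m2 ⊢
  have d0 : (0 : ℝ) ≤ d := Nat.cast_nonneg d
  nlinarith [mul_nonneg (sub_nonneg.2 m1) (show (0 : ℝ) ≤ q + d - m by linarith)]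

theorem vandPoly_of_le_one (q : ℕ) {N : ℕ} (hN : N ≤ 1) : vandPoly q N = 1 := by
  refine Finset.prod_eq_one fun j _ => Finset.prod_eq_one fun k hk => ?_
  have := Fin.lt_def.1 (mem_Ioi.1 hk)
  omega

/-- For at most one particle the root partition is the only one, with weight one. -/
theorem partWeight_of_le_one (q : ℕ) (γ : ℝ) {N : ℕ} (hN : N ≤ 1) {b : Fin N → ℕ}
    {P : (Fin N → ℕ) → Prop} (hP : P (rootPartition q b)) : partWeight q γ b P = 1 := by
  classical
  have hs : Subsingleton (Fin N) := ⟨fun i j => Fin.ext (by omega)⟩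
  have hm : ∀ f : Fin N → ℕ, Monotone f := fun f i j _ => by rw [Subsingleton.elim i j]
  have hroot : rootPartition q b = b := funext fun j => by
    have : (j : ℕ) = 0 := by omega
    simp [rootPartition, this]
  have h1 : (dominatedSet q b).filter P = {b} := by
    ext μ
    rw [mem_filter, mem_dominatedSet, mem_singleton]
    constructor
    · rintro ⟨h, -⟩
      funext j
      have h2 := h.sum_eq
      rwa [Fintype.sum_subsingleton _ j, Fintype.sum_subsingleton _ j, hroot] at h2
    · rintro rfl
      rw [hroot] at hP ⊢
      exact ⟨⟨hm _, hm _, rfl, fun _ => le_rfl⟩, hP⟩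
  have h2 : rearr b = {b} := by
    ext β
    rw [mem_singleton]
    constructor
    · intro h
      exact eq_of_mem_rearr_of_monotone h (hm _) (hm _)
    · rintro rfl
      exact self_mem_rearr _
  have h3 : multFactorial b = 1 := by
    have h := card_rearr_mul b
    rw [h2, card_singleton, mul_one] at h
    rw [h]
    exact Nat.factorial_eq_one.2 hN
  unfold partWeight
  rw [h1, Finset.sum_singleton, weight, hroot, h3, monCoeff, vandPoly_of_le_one q hN, mul_one,
    monomialPoly, h2, Finset.sum_singleton, MvPolynomial.coeff_monomial]
  simp

theorem irredWeight_one (q : ℕ) (γ : ℝ) (b : ℕ → ℕ) (i : ℕ) : irredWeight q γ b i 1 = 1 := by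
  refine partWeight_of_le_one q γ le_rfl fun s hs => ?_
  obtain ⟨h1, t, h2, h3, -⟩ := hs
  omega

theorem blockWeight_zero (q : ℕ) (γ : ℝ) (b : ℕ → ℕ) (i : ℕ) : blockWeight q γ b i 0 = 1 :=
  partWeight_of_le_one q γ zero_le_one trivial

/-- The coefficient of `X₀ X₁^(q-1)` in `(X₁ - X₀)^q`. -/
theorem coeff_X_sub_X_pow {q : ℕ} (hq : 1 ≤ q) :
    MvPolynomial.coeff (expo ![1, q - 1])
      ((MvPolynomial.X 1 - MvPolynomial.X 0 : MvPolynomial (Fin 2) ℝ) ^ q) = -q := by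
  classical
  have e : ∀ m ∈ range (q + 1), (MvPolynomial.X 1 : MvPolynomial (Fin 2) ℝ) ^ m *
      (-MvPolynomial.X 0) ^ (q - m) * (q.choose m : MvPolynomial (Fin 2) ℝ) =
      MvPolynomial.monomial (expo ![q - m, m]) ((-1) ^ (q - m) * (q.choose m : ℝ)) := by
    intro m _
    rw [MvPolynomial.monomial_eq, Finsupp.prod_fintype _ _ (fun _ => pow_zero _),
      Fin.prod_univ_two, neg_pow]
    simp only [expo_apply, map_mul, map_pow, map_neg, map_one, map_natCast, Matrix.cons_val_zero,
      Matrix.cons_val_one]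
    ring
  rw [sub_eq_add_neg, add_pow, Finset.sum_congr rfl e, MvPolynomial.coeff_sum,
    Finset.sum_eq_single (q - 1)]
  · have : q - (q - 1) = 1 := by omega
    rw [this, MvPolynomial.coeff_monomial, if_pos rfl]
    obtain ⟨k, rfl⟩ := Nat.exists_eq_add_of_le' hq
    simp
  · intro m hm hne
    rw [MvPolynomial.coeff_monomial, if_neg]
    intro h
    have := congrArg (fun f => f 1) h
    simp at this
    exact hne this
  · intro h
    exact absurd (mem_range.2 (by omega)) h

/-- The irreducible weight of two particles is at least that of the partition `(1, q - 1)`. -/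
theorem exp_le_irredWeight_two {q : ℕ} (hq : 2 ≤ q) (γ : ℝ) :
    Real.exp (-(γ ^ 2 * (2 * (q - 1)))) ≤ irredWeight q γ 0 0 2 := by
  classical
  have hm : Monotone (block 0 0 2) := monotone_block (fun _ _ _ => le_rfl) 0 2
  set μ : Fin 2 → ℕ := ![1, q - 1] with hμ
  have hd : Dominated μ (rootPartition q (block 0 0 2)) := by
    refine (dominated_iff _ _).2 ⟨?_, monotone_rootPartition q hm, ?_, fun i => ?_⟩
    · refine (Fin.monotone_iff_le_succ).2 fun i => ?_
      fin_cases i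
      simp [hμ]
      omega
    · simp [tail, Fin.sum_univ_two, hμ, rootPartition, block]
      omega
    · rcases i with _ | _ | i
      · simp [tail, Fin.sum_univ_two, hμ, rootPartition, block]
        omega
      · simp [tail, Fin.sum_univ_two, hμ, rootPartition, block]
      · rw [tail_eq_zero _ (by omega)]
        exact Nat.zero_le _
  have hi : Irred q (block 0 0 2) μ := by
    intro s hs
    obtain ⟨h1, h2, h3⟩ := (hasRenewalPoint_iff hm hd s).1 hs
    obtain rfl : s = 1 := by omega
    simp [tail, Fin.sum_univ_two, hμ, rootPartition, block] at h3
    omega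
  have hmem : μ ∈ (dominatedSet q (block 0 0 2)).filter (Irred q (block 0 0 2)) :=
    mem_filter.2 ⟨(mem_dominatedSet _ _ _).2 hd, hi⟩
  refine le_trans ?_ (Finset.single_le_sum (fun _ _ => weight_nonneg _ _ _ _) hmem)
  have h0 : block 0 0 2 = fun _ => 0 := rfl
  have hr : rearr (block 0 0 2) = {block 0 0 2} := by
    ext β
    rw [mem_rearr, mem_singleton, h0]
    exact ⟨fun ⟨_, h⟩ => h.symm, fun h => ⟨1, h.symm⟩⟩
  have hc : monCoeff q (block 0 0 2) μ = -q := by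
    have h1 : monomialPoly (block 0 0 2) = 1 := by
      rw [monomialPoly, hr, Finset.sum_singleton]
      have : expo (block 0 0 2) = 0 := by ext j; rfl
      rw [this]
      rfl
    have h2 : vandPoly q 2 = (MvPolynomial.X 1 - MvPolynomial.X 0) ^ q := by
      rw [vandPoly, Fin.prod_univ_two]
      have e1 : Ioi (0 : Fin 2) = {1} := rfl
      have e2 : Ioi (1 : Fin 2) = ∅ := rfl
      rw [e1, e2]
      simp
    rw [monCoeff, h1, one_mul, h2, coeff_X_sub_X_pow (by omega)]
  have hM : (multFactorial μ : ℝ) ≤ 2 := by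
    have h1 := card_rearr_mul μ
    have h2 : 1 ≤ #(rearr μ) := card_pos.2 ⟨μ, self_mem_rearr μ⟩
    have h3 : multFactorial μ ≤ 2 := by
      calc multFactorial μ = multFactorial μ * 1 := (mul_one _).symm
        _ ≤ multFactorial μ * #(rearr μ) := Nat.mul_le_mul_left _ h2
        _ = 2 := h1
    exact_mod_cast h3
  have hM0 : (0 : ℝ) < multFactorial μ := by exact_mod_cast multFactorial_pos μ
  have hE : ∑ j, (rootPartition q (block 0 0 2) j : ℝ) ^ 2 - ∑ j, (μ j : ℝ) ^ 2 =
      2 * (q - 1) := by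
    rw [Fin.sum_univ_two, Fin.sum_univ_two, hμ]
    simp [rootPartition, block, Nat.cast_sub (show 1 ≤ q by omega)]
    ring
  rw [weight, hc, hE]
  refine le_mul_of_one_le_left (Real.exp_pos _).le ?_
  rw [le_div_iff₀ hM0]
  have : (2 : ℝ) ≤ q := by exact_mod_cast hq
  nlinarith

/-! ### Comparison of boundary sequences -/

theorem blockWeight_nonneg (q : ℕ) (γ : ℝ) (b : ℕ → ℕ) (i n : ℕ) : 0 ≤ blockWeight q γ b i n :=
  partWeight_nonneg _ _ _ _

theorem irredWeight_nonneg (q : ℕ) (γ : ℝ) (b : ℕ → ℕ) (i n : ℕ) : 0 ≤ irredWeight q γ b i n :=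
  partWeight_nonneg _ _ _ _

/-- The renewal equation with the irreducible term included as the block of full length. -/
theorem blockWeight_eq_sum {q : ℕ} (hq : 1 ≤ q) (γ : ℝ) {b : ℕ → ℕ} (hb : Monotone b) (i : ℕ)
    {n : ℕ} (hn : 1 ≤ n) :
    blockWeight q γ b i n =
      ∑ t ∈ Ioc 0 n, irredWeight q γ b i t * blockWeight q γ b (i + t) (n - t) := by
  obtain ⟨m, rfl⟩ := Nat.exists_eq_add_of_le' hn
  rw [blockWeight_eq hq γ hb i (m + 1) (m + 1)]
  have e1 : (Ico 1 (m + 1)).filter (· ≤ m + 1) = Ioc 0 m := by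
    ext t
    simp only [mem_filter, mem_Ico, mem_Ioc]
    omega
  have e2 : partWeight q γ (block b i (m + 1)) (fun μ => ∀ s, s ≤ m + 1 →
      ¬ HasRenewalPoint q (block b i (m + 1)) μ s) = irredWeight q γ b i (m + 1) := by
    refine partWeight_congr fun μ hμ => ?_
    rw [irred_iff (monotone_block hb i _) hμ]
    refine ⟨fun h s hs => h s (by omega), fun h s hs hr => ?_⟩
    exact h s ((hasRenewalPoint_iff (monotone_block hb i _) hμ s).1 hr).2.1 hr
  rw [e1, e2, Finset.sum_Ioc_succ_top (Nat.zero_le m), Nat.sub_self, blockWeight_zero, mul_one]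

/-- Removing the first particle: the block of length one has weight one. -/
theorem blockWeight_succ_le {q : ℕ} (hq : 1 ≤ q) (γ : ℝ) {b : ℕ → ℕ} (hb : Monotone b) (i n : ℕ) :
    blockWeight q γ b (i + 1) n ≤ blockWeight q γ b i (n + 1) := by
  rw [blockWeight_eq_sum hq γ hb i (Nat.le_add_left 1 n)]
  refine le_trans (le_of_eq ?_) (Finset.single_le_sum (fun t _ => mul_nonneg
    (irredWeight_nonneg _ _ _ _ _) (blockWeight_nonneg _ _ _ _ _))
    (mem_Ioc.2 ⟨zero_lt_one, Nat.le_add_left 1 n⟩))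
  rw [irredWeight_one, one_mul, Nat.add_sub_cancel]

theorem one_le_blockWeight {q : ℕ} (hq : 1 ≤ q) (γ : ℝ) {b : ℕ → ℕ} (hb : Monotone b) :
    ∀ n i : ℕ, 1 ≤ blockWeight q γ b i n := by
  intro n
  induction n with
  | zero => intro i; rw [blockWeight_zero]
  | succ n ih => intro i; exact (ih (i + 1)).trans (blockWeight_succ_le hq γ hb i n)

/-- Comparison of two renewal recursions on `{0, …, N}` which differ only in the weights of
the blocks that contain `s` in their interior: if the block `[s - 1, s + 1]` gains more than
all these blocks weigh together then the solution increases. -/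
theorem renewal_compare {N s : ℕ} (hs : 1 ≤ s) (hsN : s < N) {z z' : ℕ → ℝ} {a a' : ℕ → ℕ → ℝ}
    {C : ℝ} (ha : ∀ i t, 0 ≤ a i t) (ha' : ∀ i t, 0 ≤ a' i t)
    (h : ∀ i < N, z i = ∑ t ∈ Ioc 0 (N - i), a i t * z (i + t))
    (h' : ∀ i < N, z' i = ∑ t ∈ Ioc 0 (N - i), a' i t * z' (i + t))
    (hz : ∀ i, 0 ≤ z i) (hz' : ∀ i, 0 ≤ z' i) (hmono : ∀ i j, i ≤ j → j ≤ N → z j ≤ z i)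
    (hzz : ∀ i, s ≤ i → i ≤ N → z' i = z i) (haa : ∀ i t, i + t ≤ s → a' i t = a i t)
    (ha1 : ∀ i, a i 1 = 1)
    (hC0 : 0 ≤ C) (hC : ∀ i < s, ∑ t ∈ Ioc (s - i) (N - i), a i t ≤ C * (1 / 2) ^ (s - i))
    (hgain : C ≤ a' (s - 1) 2) : ∀ i, i ≤ s → z i ≤ z' i := by
  set κ := a' (s - 1) 2
  have bound : ∀ m : ℕ, (κ - C * (1 - (1 / 2) ^ m)) * z (s + 1) ≥ 0 := fun m => by
    have h1 : (0 : ℝ) ≤ (1 / 2) ^ m := by positivity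
    refine mul_nonneg ?_ (hz _)
    nlinarith
  -- the loss from the blocks that start at `i` and contain `s` in their interior
  have loss : ∀ i < s, ∑ t ∈ Ioc (s - i) (N - i), a i t * z (i + t) ≤
      C * (1 / 2) ^ (s - i) * z (s + 1) := by
    intro i hi
    refine le_trans (Finset.sum_le_sum fun t ht => ?_)
      ((Finset.sum_mul _ _ _).symm.le.trans (mul_le_mul_of_nonneg_right (hC i hi) (hz _)))
    rw [mem_Ioc] at ht
    exact mul_le_mul_of_nonneg_left (hmono _ _ (by omega) (by omega)) (ha i t)
  -- at the distance `m` from `s`, the gain `κ` has been diminished by `C / 2, C / 4, …`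
  have key : ∀ m, 1 ≤ m → ∀ i, i + m = s →
      (κ - C * (1 - (1 / 2) ^ m)) * z (s + 1) ≤ z' i - z i := by
    intro m
    induction m using Nat.strong_induction_on with
    | _ m ih =>
      intro hm i hi
      have e1 : s - i = m := by omega
      have split : ∀ F : ℕ → ℝ, ∑ t ∈ Ioc 0 (N - i), F t =
          ∑ t ∈ Ioc 0 m, F t + ∑ t ∈ Ioc m (N - i), F t := fun F =>
        (Finset.sum_Ioc_consecutive F (Nat.zero_le _) (by omega)).symm
      have hl := loss i (by omega)
      rw [e1] at hl
      rw [h i (by omega), h' i (by omega), split, split]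
      have hnn : ∀ t ∈ Ioc 0 m, 0 ≤ a i t * (z' (i + t) - z (i + t)) := by
        intro t ht
        rw [mem_Ioc] at ht
        refine mul_nonneg (ha i t) ?_
        rcases eq_or_lt_of_le ht.2 with e | hlt
        · rw [hzz (i + t) (by omega) (by omega), sub_self]
        · exact (bound (m - t)).le.trans (ih (m - t) (by omega) (by omega) (i + t) (by omega))
      have e2 : ∑ t ∈ Ioc 0 m, a' i t * z' (i + t) - ∑ t ∈ Ioc 0 m, a i t * z (i + t) =
          ∑ t ∈ Ioc 0 m, a i t * (z' (i + t) - z (i + t)) := by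
        rw [← Finset.sum_sub_distrib]
        refine Finset.sum_congr rfl fun t ht => ?_
        rw [mem_Ioc] at ht
        rw [haa i t (by omega)]
        ring
      rcases eq_or_lt_of_le hm with rfl | hlt
      · -- the block `[s - 1, s + 1]` provides the gain
        have hg : κ * z (s + 1) ≤ ∑ t ∈ Ioc 1 (N - i), a' i t * z' (i + t) := by
          refine le_trans (le_of_eq ?_) (Finset.single_le_sum
            (fun t _ => mul_nonneg (ha' i t) (hz' _)) (mem_Ioc.2 ⟨one_lt_two, by omega⟩))
          have e3 : s - 1 = i := by omega
          rw [hzz _ (by omega) (by omega), ← hi]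
          change a' (s - 1) 2 * z (i + 2) = _
          rw [e3]
        have hp := Finset.sum_nonneg hnn
        rw [← e2] at hp
        linarith
      · have hg : (κ - C * (1 - (1 / 2) ^ (m - 1))) * z (s + 1) ≤
            ∑ t ∈ Ioc 0 m, a i t * (z' (i + t) - z (i + t)) := by
          refine le_trans ?_ (Finset.single_le_sum hnn (mem_Ioc.2 ⟨zero_lt_one, hm⟩))
          rw [ha1, one_mul]
          exact ih (m - 1) (by omega) (by omega) (i + 1) (by omega)
        rw [← e2] at hg
        have hp : 0 ≤ ∑ t ∈ Ioc m (N - i), a' i t * z' (i + t) :=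
          Finset.sum_nonneg fun t _ => mul_nonneg (ha' i t) (hz' _)
        have e3 : ((1 : ℝ) / 2) ^ (m - 1) = 2 * (1 / 2) ^ m := by
          obtain ⟨k, rfl⟩ := Nat.exists_eq_add_of_le' hm
          rw [Nat.add_sub_cancel, pow_succ]
          ring
        rw [e3] at hg
        linarith
  intro i hi
  rcases eq_or_lt_of_le hi with rfl | hlt
  · rw [hzz i le_rfl hsN.le]
  · have h1 := key (s - i) (by omega) i (by omega)
    have h2 := bound (s - i)
    linarith

theorem sum_Ioc_half_pow_le (m n : ℕ) : ∑ t ∈ Ioc m n, (1 / 2 : ℝ) ^ t ≤ (1 / 2) ^ m := by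
  rcases le_total n m with h | h
  · rw [Ioc_eq_empty (by omega), Finset.sum_empty]
    positivity
  · obtain ⟨k, rfl⟩ := Nat.exists_eq_add_of_le h
    have : ∑ t ∈ Ioc m (m + k), (1 / 2 : ℝ) ^ t = (1 / 2) ^ m - (1 / 2) ^ (m + k) := by
      clear h
      induction k with
      | zero => simp
      | succ k ih =>
        rw [← add_assoc, Finset.sum_Ioc_succ_top (by omega), ih, pow_succ _ (m + k)]
        ring
    rw [this]
    have : (0 : ℝ) ≤ (1 / 2) ^ (m + k) := by positivity
    linarith

theorem four_exp_le {q : ℕ} (hq : 2 ≤ q) {γ : ℝ} (hγ : 8 * (q : ℝ) + 2 ≤ γ ^ 2) :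
    4 * (2 * Real.exp q) ^ 2 * Real.exp (-(γ ^ 2 * q)) ≤ 1 / 2 := by
  have hq' : (2 : ℝ) ≤ q := by exact_mod_cast hq
  have h1 : (2 * Real.exp q) ^ 2 = 4 * Real.exp (2 * q) := by
    rw [mul_pow, ← Real.exp_nat_mul]
    norm_num
  have h2 : (32 : ℝ) ≤ Real.exp 32 := by linarith [Real.add_one_le_exp (32 : ℝ)]
  have h3 : Real.exp (2 * q) * Real.exp (-(γ ^ 2 * q)) ≤ Real.exp (-32) := by
    rw [← Real.exp_add]
    refine Real.exp_le_exp.2 ?_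
    nlinarith
  have h4 : Real.exp (-32) ≤ 1 / 32 := by
    rw [Real.exp_neg, ← one_div]
    exact one_div_le_one_div_of_le (by norm_num) h2
  rw [h1]
  nlinarith

/-- Blocks with a jump weigh at most `C 2^{-n}`, with a constant that is smaller than the
irreducible weight of two particles without a jump. -/
theorem irredWeight_jump_le {q : ℕ} (hq : 2 ≤ q) {γ : ℝ} (hγ : 8 * (q : ℝ) + 2 ≤ γ ^ 2)
    {b : ℕ → ℕ} (hb : Monotone b) {i n : ℕ} (hn : 2 ≤ n) (hi : b i < b (i + (n - 1))) :
    irredWeight q γ b i n ≤ Real.exp (-(γ ^ 2 * (2 * (q - 1)))) * (1 / 2) ^ n := by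
  set y := Real.exp (-(γ ^ 2 * q)) with hy
  set h := 2 * Real.exp q with hh
  have hy0 : 0 < y := Real.exp_pos _
  have hx := four_exp_le hq hγ
  have h1 : 1 ≤ h := by
    have := Real.add_one_le_exp (q : ℝ)
    have : (0 : ℝ) ≤ q := Nat.cast_nonneg q
    linarith
  have hy4 : 4 * y ≤ 1 := by nlinarith [one_le_pow₀ h1 (n := 2)]
  set x := 4 * h ^ 2 * y with hxdef
  have hx0 : 0 < x := by positivity
  -- both cases are bounded by `8 h² x² 2⁻ⁿ`
  have hbound : irredWeight q γ b i n ≤ 8 * h ^ 2 * x ^ 2 * (1 / 2) ^ n := by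
    rcases eq_or_lt_of_le hn with rfl | hn3
    · refine (irredWeight_two_le hy4 hb hi).trans ?_
      have : (h ^ 2) ^ 2 * (4 * y) ^ 2 = x ^ 2 := by rw [hxdef]; ring
      rw [this]
      nlinarith [mul_nonneg (sub_nonneg.2 (one_le_pow₀ h1 (n := 2))) (sq_nonneg x), sq_nonneg x]
    · refine (irredWeight_le hy4 hb i (by omega)).trans ?_
      obtain ⟨k, rfl⟩ := Nat.exists_eq_add_of_le (show 3 ≤ n from hn3)
      have e : (h ^ (3 + k)) ^ 2 * (4 * y) ^ (3 + k - 1) = h ^ 2 * x ^ 2 * x ^ k := by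
        rw [show 3 + k - 1 = 2 + k by omega, ← pow_mul h, mul_comm (3 + k), pow_mul h, hxdef,
          show 4 * h ^ 2 * y = h ^ 2 * (4 * y) by ring, mul_pow (h ^ 2) (4 * y) k, pow_add (h ^ 2),
          pow_add (4 * y)]
        ring
      rw [e, pow_add (1 / 2 : ℝ)]
      calc h ^ 2 * x ^ 2 * x ^ k ≤ h ^ 2 * x ^ 2 * (1 / 2) ^ k :=
            mul_le_mul_of_nonneg_left (pow_le_pow_left₀ hx0.le hx k) (by positivity)
        _ = _ := by ring
  refine hbound.trans (mul_le_mul_of_nonneg_right ?_ (by positivity))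
  have hq' : (2 : ℝ) ≤ q := by exact_mod_cast hq
  have e1 : 8 * h ^ 2 * x ^ 2 = 2 ^ 13 * Real.exp (6 * q - γ ^ 2 * (2 * q)) := by
    rw [hxdef, hh, hy, sub_eq_add_neg, Real.exp_add,
      show (6 * q : ℝ) = (6 : ℕ) * q by norm_num, Real.exp_nat_mul,
      show -(γ ^ 2 * (2 * q)) = (2 : ℕ) * (-(γ ^ 2 * q)) by push_cast; ring, Real.exp_nat_mul]
    ring
  have e2 : (2 : ℝ) ^ 13 ≤ Real.exp 13 := by
    have h2 : (2 : ℝ) ≤ Real.exp 1 := by linarith [Real.add_one_le_exp (1 : ℝ)]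
    calc (2 : ℝ) ^ 13 ≤ Real.exp 1 ^ 13 := pow_le_pow_left₀ (by norm_num) h2 13
      _ = Real.exp 13 := by rw [← Real.exp_nat_mul]; norm_num
  rw [e1]
  calc (2 : ℝ) ^ 13 * Real.exp (6 * q - γ ^ 2 * (2 * q))
      ≤ Real.exp 13 * Real.exp (6 * q - γ ^ 2 * (2 * q)) :=
        mul_le_mul_of_nonneg_right e2 (Real.exp_pos _).le
    _ ≤ _ := by
      rw [← Real.exp_add]
      refine Real.exp_le_exp.2 ?_
      nlinarith

/-- Among all boundary sequences the constant ones have the largest total weight. -/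
theorem blockWeight_le_zero {q : ℕ} (hq : 2 ≤ q) {γ : ℝ} (hγ : 8 * (q : ℝ) + 2 ≤ γ ^ 2) (N : ℕ) :
    ∀ (d : ℕ) (b : ℕ → ℕ), Monotone b → b (N - 1) = b 0 + d →
      blockWeight q γ b 0 N ≤ blockWeight q γ 0 0 N := by
  have hq1 : 1 ≤ q := by omega
  intro d
  induction d using Nat.strong_induction_on with
  | _ d ih =>
    intro b hb hd
    rcases Nat.eq_zero_or_pos d with rfl | hd0
    · refine (blockWeight_shift (k := b 0) γ fun j hj => ?_).le
      have h1 : b j ≤ b (N - 1) := hb (by omega)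
      have h2 : b 0 ≤ b j := hb (Nat.zero_le _)
      rw [Nat.zero_add, Pi.zero_apply]
      omega
    -- close the first jump, at position `s`
    have hex : ∃ s, b 0 < b s := ⟨N - 1, by omega⟩
    set s := Nat.find hex with hsdef
    have hs : b 0 < b s := Nat.find_spec hex
    have hs1 : 1 ≤ s := by
      rcases Nat.eq_zero_or_pos s with h | h
      · rw [h] at hs; exact absurd hs (lt_irrefl _)
      · exact h
    have hlt : ∀ i < s, b i = b 0 := fun i hi =>
      le_antisymm (not_lt.1 (Nat.find_min hex hi)) (hb (Nat.zero_le _))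
    have hsN : s < N := by
      have : s ≤ N - 1 := Nat.find_min' hex (by omega)
      have : 0 < N - 1 := by
        by_contra hc
        rw [show N - 1 = 0 by omega] at hd
        omega
      omega
    set e := b s - b 0 with he
    set b' : ℕ → ℕ := fun j => if j < s then b j else b j - e with hb'
    have hge : ∀ j, s ≤ j → b j = e + b' j := by
      intro j hj
      have h1 : b s ≤ b j := hb hj
      simp only [hb', if_neg (not_lt.2 hj)]
      omega
    have hlow : ∀ j, j ≤ s → b' j = b 0 := by
      intro j hj
      rcases eq_or_lt_of_le hj with rfl | h
      · have := hge _ le_rfl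
        omega
      · simp only [hb', if_pos h, hlt j h]
    have hm' : Monotone b' := by
      intro i j hij
      rcases lt_or_ge j s with hj | hj
      · rw [hlow i (by omega), hlow j hj.le]
      · have h2 := hge j hj
        have h3 : b s ≤ b j := hb hj
        rcases lt_or_ge i s with hi | hi
        · rw [hlow i hi.le]
          omega
        · have h4 := hge i hi
          have h5 : b i ≤ b j := hb hij
          omega
    refine le_trans ?_ (ih (d - e) (by omega) b' hm' ?_)
    swap
    · have h1 := hge (N - 1) (by omega)
      have h2 := hlow 0 (Nat.zero_le _)
      have h3 : b s ≤ b (N - 1) := hb (by omega)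
      omega
    have rec_eq : ∀ c : ℕ → ℕ, Monotone c → ∀ i < N, blockWeight q γ c i (N - i) =
        ∑ t ∈ Ioc 0 (N - i), irredWeight q γ c i t * blockWeight q γ c (i + t) (N - (i + t)) := by
      intro c hc i hi
      rw [blockWeight_eq_sum hq1 γ hc i (by omega)]
      exact Finset.sum_congr rfl fun t _ => by rw [Nat.sub_sub]
    refine renewal_compare (N := N) (s := s) hs1 hsN (z := fun i => blockWeight q γ b i (N - i))
      (z' := fun i => blockWeight q γ b' i (N - i)) (a := irredWeight q γ b)
      (a' := irredWeight q γ b') (C := Real.exp (-(γ ^ 2 * (2 * (q - 1)))))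
      (irredWeight_nonneg q γ b) (irredWeight_nonneg q γ b')
      (rec_eq b hb) (rec_eq b' hm') (fun i => blockWeight_nonneg _ _ _ _ _)
      (fun i => blockWeight_nonneg _ _ _ _ _) ?_ ?_ ?_ (irredWeight_one q γ b)
      (Real.exp_pos _).le ?_ ?_ 0 (Nat.zero_le _)
    · intro i j hij hjN
      obtain ⟨k, rfl⟩ := Nat.exists_eq_add_of_le hij
      clear hij
      induction k with
      | zero => exact le_rfl
      | succ k ihk =>
        refine le_trans ?_ (ihk (by omega))
        have h1 := blockWeight_succ_le hq1 γ hb (i + k) (N - (i + k + 1))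
        rwa [show N - (i + k + 1) + 1 = N - (i + k) by omega] at h1
    · intro i hi _
      exact (blockWeight_shift (k := e) γ fun j _ => hge _ (by omega)).symm
    · intro i t hit
      refine irredWeight_shift (k := 0) γ hb fun j hj => ?_
      rw [zero_add, hlow (i + j) (by omega), hlt (i + j) (by omega)]
    · intro i hi
      refine le_trans (Finset.sum_le_sum (g := fun t =>
        Real.exp (-(γ ^ 2 * (2 * (q - 1)))) * (1 / 2) ^ t) fun t ht => ?_) ?_
      · rw [mem_Ioc] at ht
        refine irredWeight_jump_le hq hγ hb (by omega) ?_
        rw [hlt i hi]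
        exact hs.trans_le (hb (by omega))
      · rw [← Finset.mul_sum]
        exact mul_le_mul_of_nonneg_left (sum_Ioc_half_pow_le _ _) (Real.exp_pos _).le
    · refine (exp_le_irredWeight_two hq γ).trans (le_of_eq ?_)
      have h0 : irredWeight q γ 0 (s - 1) 2 = irredWeight q γ 0 0 2 := rfl
      rw [← h0]
      refine (irredWeight_shift (k := b 0) γ (fun _ _ _ => le_rfl) fun j hj => ?_).symm
      rw [hlow _ (by omega)]
      rfl

/-! ### Orthonormality of the orbitals -/

/-- The normalization constant of the orbitals. -/
noncomputable def orbitalConst (γ : ℝ) (k : ℕ) : ℝ :=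
  Real.sqrt (γ / (2 * Real.pi ^ (3 / 2 : ℝ))) * Real.exp (-(γ ^ 2 * (k : ℝ) ^ 2 / 2))

theorem orbitalConst_pos {γ : ℝ} (hγ : 0 < γ) (k : ℕ) : 0 < orbitalConst γ k := by
  unfold orbitalConst
  have : 0 < Real.pi ^ (3 / 2 : ℝ) := Real.rpow_pos_of_pos Real.pi_pos _
  positivity

theorem orbital_eq (γ : ℝ) (k : ℕ) (z : ℂ) :
    orbital γ k z = (orbitalConst γ k : ℂ) * Complex.exp (γ * z * k) := rfl

theorem measurable_density : Measurable fun z : ℂ => ENNReal.ofReal (Real.exp (-z.re ^ 2)) := by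
  have := Complex.measurable_re
  fun_prop

instance sigmaFinite_orbitalMeasure (γ : ℝ) : SigmaFinite (orbitalMeasure γ) := by
  unfold orbitalMeasure
  exact SigmaFinite.withDensity_of_ne_top
    (Filter.Eventually.of_forall fun _ => ENNReal.ofReal_ne_top)

theorem integral_orbitalMeasure (γ : ℝ) (f : ℂ → ℂ) :
    ∫ z, f z ∂orbitalMeasure γ = ∫ z in strip γ, (Real.exp (-z.re ^ 2) : ℂ) * f z := by
  rw [orbitalMeasure, integral_withDensity_eq_integral_toReal_smul measurable_density
    (Filter.Eventually.of_forall fun _ => ENNReal.ofReal_lt_top)]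
  refine integral_congr_ae (Filter.Eventually.of_forall fun z => ?_)
  simp only [ENNReal.toReal_ofReal (Real.exp_pos _).le]
  rw [Complex.real_smul]

theorem integrable_orbitalMeasure_iff (γ : ℝ) (f : ℂ → ℂ) :
    Integrable f (orbitalMeasure γ) ↔
      IntegrableOn (fun z => (Real.exp (-z.re ^ 2) : ℂ) * f z) (strip γ) := by
  rw [orbitalMeasure, integrable_withDensity_iff_integrable_smul' measurable_density
    (Filter.Eventually.of_forall fun _ => ENNReal.ofReal_lt_top), IntegrableOn]
  refine integrable_congr (Filter.Eventually.of_forall fun z => ?_)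
  simp only [ENNReal.toReal_ofReal (Real.exp_pos _).le]
  rw [Complex.real_smul]

/-- The two factors of the product of two orbitals with the Gaussian density. -/
theorem exp_mul_orbital_mul_orbital (γ : ℝ) (j k : ℕ) (z : ℂ) :
    (Real.exp (-z.re ^ 2) : ℂ) * ((starRingEnd ℂ) (orbital γ j z) * orbital γ k z) =
      (orbitalConst γ j * orbitalConst γ k : ℂ) *
        (Complex.exp (-1 * (z.re : ℂ) ^ 2 + (γ * (j + k)) * z.re + 0) *
          Complex.exp ((γ * (k - j) * Complex.I) * z.im)) := by
  have h : (starRingEnd ℂ) z = z.re - z.im * Complex.I := by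
    apply Complex.ext <;> simp
  rw [orbital_eq, orbital_eq, map_mul, Complex.conj_ofReal, ← Complex.exp_conj, map_mul, map_mul,
    Complex.conj_ofReal, Complex.conj_natCast, h]
  rw [Complex.ofReal_exp, ← Complex.exp_add]
  have e : ∀ a b c u v w : ℂ, Complex.exp a * (b * Complex.exp u * (c * Complex.exp v)) =
      b * c * Complex.exp (a + u + v) := fun a b c u v w => by
    rw [Complex.exp_add, Complex.exp_add]; ring
  rw [e _ _ _ _ _ 0]
  congr 2
  conv_lhs => rw [← Complex.re_add_im z]
  simp only [Complex.add_re, Complex.ofReal_re, Complex.mul_re, Complex.I_re, Complex.I_im,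
    Complex.ofReal_im, Complex.add_im, Complex.mul_im]
  push_cast
  ring

theorem setIntegral_strip_mul (γ : ℝ) (f g : ℝ → ℂ) :
    ∫ z in strip γ, f z.re * g z.im =
      (∫ x, f x) * ∫ y in Set.Ico 0 (2 * Real.pi / γ), g y := by
  have h := Complex.volume_preserving_equiv_real_prod.setIntegral_preimage_emb
    Complex.measurableEquivRealProd.measurableEmbedding (fun p : ℝ × ℝ => f p.1 * g p.2)
    (Set.univ ×ˢ Set.Ico 0 (2 * Real.pi / γ))
  have e : Complex.measurableEquivRealProd ⁻¹' (Set.univ ×ˢ Set.Ico 0 (2 * Real.pi / γ)) =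
      strip γ := by
    ext z
    simp [strip, Complex.measurableEquivRealProd_apply]
  rw [e] at h
  refine Eq.trans ?_ (h.trans ?_)
  · rfl
  · rw [Measure.volume_eq_prod, ← Measure.prod_restrict, Measure.restrict_univ, integral_prod_mul]

theorem integrableOn_strip_mul (γ : ℝ) {f g : ℝ → ℂ} (hf : Integrable f)
    (hg : IntegrableOn g (Set.Ico 0 (2 * Real.pi / γ))) :
    IntegrableOn (fun z : ℂ => f z.re * g z.im) (strip γ) := by
  have h := Complex.volume_preserving_equiv_real_prod.integrableOn_comp_preimage
    Complex.measurableEquivRealProd.measurableEmbedding (f := fun p : ℝ × ℝ => f p.1 * g p.2)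
    (s := Set.univ ×ˢ Set.Ico 0 (2 * Real.pi / γ))
  have e : Complex.measurableEquivRealProd ⁻¹' (Set.univ ×ˢ Set.Ico 0 (2 * Real.pi / γ)) =
      strip γ := by
    ext z
    simp [strip, Complex.measurableEquivRealProd_apply]
  rw [e] at h
  refine h.2 ?_
  rw [IntegrableOn, Measure.volume_eq_prod, ← Measure.prod_restrict, Measure.restrict_univ]
  exact hf.mul_prod hg

theorem integrable_orbital_mul (γ : ℝ) (j k : ℕ) :
    Integrable (fun z => (starRingEnd ℂ) (orbital γ j z) * orbital γ k z) (orbitalMeasure γ) := by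
  rw [integrable_orbitalMeasure_iff]
  simp only [exp_mul_orbital_mul_orbital]
  refine Integrable.const_mul ?_ _
  refine integrableOn_strip_mul γ
    (f := fun x => Complex.exp (-1 * (x : ℂ) ^ 2 + (γ * (j + k)) * x + 0))
    (g := fun y => Complex.exp ((γ * (k - j) * Complex.I) * y)) ?_ ?_
  · exact integrable_cexp_quadratic' (by simp) _ _
  · refine (Continuous.integrableOn_Icc ?_).mono_set Set.Ico_subset_Icc_self
    fun_prop

/-- The orbitals are orthonormal: the integral over `y` is one over a full period, and on the
diagonal the integral over `x` is Gaussian. -/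
theorem integral_orbital_mul {γ : ℝ} (hγ : 0 < γ) (j k : ℕ) :
    ∫ z, (starRingEnd ℂ) (orbital γ j z) * orbital γ k z ∂orbitalMeasure γ =
      if j = k then 1 else 0 := by
  rw [integral_orbitalMeasure]
  simp only [exp_mul_orbital_mul_orbital]
  rw [integral_const_mul, setIntegral_strip_mul γ
    (fun x => Complex.exp (-1 * (x : ℂ) ^ 2 + (γ * (j + k)) * x + 0))
    (fun y => Complex.exp ((γ * (k - j) * Complex.I) * y)),
    integral_Ico_eq_integral_Ioc, ← intervalIntegral.integral_of_le (by positivity)]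
  split_ifs with h
  · subst h
    rw [integral_cexp_quadratic (by simp)]
    simp only [sub_self, mul_zero, zero_mul, Complex.exp_zero, intervalIntegral.integral_const,
      sub_zero]
    have e1 : ((Real.pi : ℂ) / -(-1)) ^ (1 / 2 : ℂ) = (Real.sqrt Real.pi : ℝ) := by
      rw [neg_neg, div_one, Real.sqrt_eq_rpow, Complex.ofReal_cpow Real.pi_pos.le]
      norm_num
    have e2 : (0 : ℂ) - (γ * ((j : ℂ) + j)) ^ 2 / (4 * (-1)) = ((γ ^ 2 * (j : ℝ) ^ 2 : ℝ) : ℂ) := by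
      push_cast
      ring
    rw [e1, e2, ← Complex.ofReal_exp]
    rw [Complex.real_smul, mul_one]
    norm_cast
    have e3 : orbitalConst γ j * orbitalConst γ j =
        γ / (2 * Real.pi ^ (3 / 2 : ℝ)) * Real.exp (-(γ ^ 2 * (j : ℝ) ^ 2)) := by
      have hp : 0 < Real.pi ^ (3 / 2 : ℝ) := Real.rpow_pos_of_pos Real.pi_pos _
      rw [orbitalConst, mul_mul_mul_comm, Real.mul_self_sqrt (by positivity), ← Real.exp_add]
      congr 2
      ring
    have e4 : Real.pi ^ (3 / 2 : ℝ) = Real.pi * Real.sqrt Real.pi := by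
      rw [Real.sqrt_eq_rpow, show (3 / 2 : ℝ) = 1 + 1 / 2 by norm_num, Real.rpow_add Real.pi_pos,
        Real.rpow_one]
    have hs : 0 < Real.sqrt Real.pi := Real.sqrt_pos.2 Real.pi_pos
    have hpi := Real.pi_pos
    rw [e3, e4, Real.exp_neg, Nat.cast_pow]
    have := Real.exp_pos (γ ^ 2 * (j : ℝ) ^ 2)
    field_simp
  · have hc : (γ * ((k : ℂ) - j) * Complex.I) ≠ 0 := by
      refine mul_ne_zero (mul_ne_zero (Complex.ofReal_ne_zero.2 hγ.ne') ?_) Complex.I_ne_zero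
      rw [sub_ne_zero]
      exact fun e => h (Nat.cast_injective e).symm
    have hper : Complex.exp (γ * ((k : ℂ) - j) * Complex.I * ((2 * Real.pi / γ : ℝ) : ℂ)) = 1 := by
      rw [Complex.exp_eq_one_iff]
      refine ⟨(k : ℤ) - j, ?_⟩
      push_cast
      have : (γ : ℂ) ≠ 0 := Complex.ofReal_ne_zero.2 hγ.ne'
      field_simp
    rw [integral_exp_mul_complex hc, hper]
    simp

/-! ### Finite expansions in products of orbitals -/

/-- The product of orbitals with the given indices. -/
noncomputable def orbitalProd (γ : ℝ) {N : ℕ} (ν : Fin N → ℕ) (z : Fin N → ℂ) : ℂ :=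
  ∏ j, orbital γ (ν j) (z j)

theorem conj_orbitalProd_mul (γ : ℝ) {N : ℕ} (ν ν' : Fin N → ℕ) (z : Fin N → ℂ) :
    (starRingEnd ℂ) (orbitalProd γ ν z) * orbitalProd γ ν' z =
      ∏ j, (starRingEnd ℂ) (orbital γ (ν j) (z j)) * orbital γ (ν' j) (z j) := by
  rw [orbitalProd, orbitalProd, map_prod, Finset.prod_mul_distrib]

theorem integrable_orbitalProd_mul (γ : ℝ) {N : ℕ} (ν ν' : Fin N → ℕ) :
    Integrable (fun z => (starRingEnd ℂ) (orbitalProd γ ν z) * orbitalProd γ ν' z)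
      (manyBodyMeasure γ N) := by
  simp only [conj_orbitalProd_mul]
  exact Integrable.fintype_prod fun j => integrable_orbital_mul γ (ν j) (ν' j)

theorem braket_orbitalProd {γ : ℝ} (hγ : 0 < γ) {N : ℕ} (ν ν' : Fin N → ℕ) :
    braket γ (orbitalProd γ ν) (orbitalProd γ ν') = if ν = ν' then 1 else 0 := by
  rw [braket, manyBodyMeasure]
  simp only [conj_orbitalProd_mul]
  rw [integral_fintype_prod_eq_prod (fun j z => (starRingEnd ℂ) (orbital γ (ν j) z) *
    orbital γ (ν' j) z)]
  simp only [integral_orbital_mul hγ]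
  split_ifs with h
  · subst h; simp
  · obtain ⟨j, hj⟩ := Function.ne_iff.1 h
    exact Finset.prod_eq_zero (mem_univ j) (if_neg hj)

/-- A finite combination of products of orbitals. -/
noncomputable def orbitalSum (γ : ℝ) {N : ℕ} {ι : Type*} (S : Finset ι) (a : ι → ℂ)
    (ν : ι → Fin N → ℕ) (z : Fin N → ℂ) : ℂ :=
  ∑ i ∈ S, a i * orbitalProd γ (ν i) z

theorem braket_orbitalSum {γ : ℝ} (hγ : 0 < γ) {N : ℕ} {ι κ : Type*} (S : Finset ι) (T : Finset κ)
    (a : ι → ℂ) (c : κ → ℂ) (ν : ι → Fin N → ℕ) (ν' : κ → Fin N → ℕ) :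
    braket γ (orbitalSum γ S a ν) (orbitalSum γ T c ν') =
      ∑ i ∈ S, ∑ k ∈ T, (starRingEnd ℂ) (a i) * c k * if ν i = ν' k then 1 else 0 := by
  have e : ∀ z, (starRingEnd ℂ) (orbitalSum γ S a ν z) * orbitalSum γ T c ν' z =
      ∑ i ∈ S, ∑ k ∈ T, (starRingEnd ℂ) (a i) * c k *
        ((starRingEnd ℂ) (orbitalProd γ (ν i) z) * orbitalProd γ (ν' k) z) := fun z => by
    rw [orbitalSum, orbitalSum, map_sum, Finset.sum_mul_sum]
    refine Finset.sum_congr rfl fun i _ => Finset.sum_congr rfl fun k _ => ?_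
    rw [map_mul]
    ring
  rw [braket]
  simp only [e]
  have hint : ∀ i k, Integrable (fun z => (starRingEnd ℂ) (a i) * c k *
      ((starRingEnd ℂ) (orbitalProd γ (ν i) z) * orbitalProd γ (ν' k) z))
      (manyBodyMeasure γ N) := fun i k => (integrable_orbitalProd_mul γ _ _).const_mul _
  rw [integral_finsetSum _ fun i _ => integrable_finsetSum _ fun k _ => hint i k]
  refine Finset.sum_congr rfl fun i _ => ?_
  rw [integral_finsetSum _ fun k _ => hint i k]
  refine Finset.sum_congr rfl fun k _ => ?_
  rw [integral_const_mul]
  congr 1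
  exact braket_orbitalProd hγ _ _

theorem normSq_eq_braket (γ : ℝ) {N : ℕ} (f : (Fin N → ℂ) → ℂ) :
    (normSq γ f : ℂ) = braket γ f f := by
  rw [normSq, braket, ← integral_complex_ofReal]
  refine integral_congr_ae (Filter.Eventually.of_forall fun z => ?_)
  simp only
  rw [Complex.conj_mul']
  push_cast
  rfl

/-! ### Expansion of the wavefunctions -/

theorem rename_monomialPoly {N : ℕ} (σ : Equiv.Perm (Fin N)) (b : Fin N → ℕ) :
    MvPolynomial.rename σ (monomialPoly b) = monomialPoly b := by
  have e : ∀ β : Fin N → ℕ, Finsupp.mapDomain σ (expo β) = expo (β ∘ ⇑σ⁻¹) := fun β => by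
    ext j
    rw [Finsupp.mapDomain_equiv_apply]
    rfl
  simp only [monomialPoly, map_sum, MvPolynomial.rename_monomial, e]
  refine Finset.sum_bij' (fun β _ => β ∘ ⇑σ⁻¹) (fun β _ => β ∘ σ) ?_ ?_ ?_ ?_ fun _ _ => rfl
  · intro β hβ
    obtain ⟨τ, rfl⟩ := mem_rearr.1 hβ
    exact mem_rearr.2 ⟨τ * σ⁻¹, rfl⟩
  · intro β hβ
    obtain ⟨τ, rfl⟩ := mem_rearr.1 hβ
    exact mem_rearr.2 ⟨τ * σ, rfl⟩
  · intro β _; funext j; simp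
  · intro β _; funext j; simp

theorem vandPoly_eq_det (q N : ℕ) :
    vandPoly q N = (Matrix.vandermonde fun j : Fin N =>
      (MvPolynomial.X j : MvPolynomial (Fin N) ℝ)).det ^ q := by
  rw [Matrix.det_vandermonde, vandPoly]
  simp only [Finset.prod_pow]

theorem rename_vandPoly (q : ℕ) {N : ℕ} (σ : Equiv.Perm (Fin N)) :
    MvPolynomial.rename σ (vandPoly q N) =
      MvPolynomial.C (((Equiv.Perm.sign σ : ℤ) : ℝ) ^ q) * vandPoly q N := by
  have h : MvPolynomial.rename σ
      (Matrix.vandermonde fun j : Fin N => (MvPolynomial.X j : MvPolynomial (Fin N) ℝ)).det =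
      MvPolynomial.C ((Equiv.Perm.sign σ : ℤ) : ℝ) *
      (Matrix.vandermonde fun j : Fin N => (MvPolynomial.X j : MvPolynomial (Fin N) ℝ)).det := by
    have e1 := Matrix.det_permute σ
      (Matrix.vandermonde fun j : Fin N => (MvPolynomial.X j : MvPolynomial (Fin N) ℝ))
    have e2 : MvPolynomial.C ((Equiv.Perm.sign σ : ℤ) : ℝ) =
        ((Equiv.Perm.sign σ : ℤ) : MvPolynomial (Fin N) ℝ) := by simp
    rw [e2, ← e1, AlgHom.map_det]
    congr 1
    ext i j
    simp [Matrix.vandermonde]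
  rw [vandPoly_eq_det, map_pow, h, mul_pow, map_pow]

/-- The polynomial is symmetric up to `(sgn σ)^q`, and so are its coefficients. -/
theorem monCoeff_comp_inv (q : ℕ) {N : ℕ} (b ν : Fin N → ℕ) (σ : Equiv.Perm (Fin N)) :
    monCoeff q b (ν ∘ ⇑σ⁻¹) = ((Equiv.Perm.sign σ : ℤ) : ℝ) ^ q * monCoeff q b ν := by
  have e : Finsupp.mapDomain σ (expo ν) = expo (ν ∘ ⇑σ⁻¹) := by
    ext j
    rw [Finsupp.mapDomain_equiv_apply]
    rfl
  have h := MvPolynomial.coeff_rename_mapDomain σ σ.injective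
    (monomialPoly b * vandPoly q N) (expo ν)
  rw [map_mul, rename_monomialPoly, rename_vandPoly, mul_left_comm,
    MvPolynomial.coeff_C_mul, e] at h
  have hs : (((Equiv.Perm.sign σ : ℤ) : ℝ) ^ q) * ((Equiv.Perm.sign σ : ℤ) : ℝ) ^ q = 1 := by
    rw [← mul_pow]
    norm_cast
    simp
  calc monCoeff q b (ν ∘ ⇑σ⁻¹) = (((Equiv.Perm.sign σ : ℤ) : ℝ) ^ q *
        ((Equiv.Perm.sign σ : ℤ) : ℝ) ^ q) * monCoeff q b (ν ∘ ⇑σ⁻¹) := by rw [hs, one_mul]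
    _ = _ := by
      rw [mul_assoc]
      congr 1

/-- The sign by which the Vandermonde product changes if all its factors are reversed. -/
noncomputable def vandSign (q N : ℕ) : ℂ := ∏ j : Fin N, ∏ _k ∈ Ioi j, (-1) ^ q

theorem norm_vandSign (q N : ℕ) : ‖vandSign q N‖ = 1 := by
  simp [vandSign]

/-- The coefficient of the wavefunction of `b` at a product of orbitals. -/
noncomputable def amplitude (q : ℕ) (γ : ℝ) {N : ℕ} (b ν : Fin N → ℕ) : ℂ :=
  (kappa q γ b : ℂ) * vandSign q N * ((monCoeff q b ν * ∏ j, (orbitalConst γ (ν j))⁻¹ : ℝ) : ℂ)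

theorem amplitude_comp_inv (q : ℕ) (γ : ℝ) {N : ℕ} (b ν : Fin N → ℕ) (σ : Equiv.Perm (Fin N)) :
    amplitude q γ b (ν ∘ ⇑σ⁻¹) = ((Equiv.Perm.sign σ : ℤ) : ℂ) ^ q * amplitude q γ b ν := by
  have h : ∏ j, (orbitalConst γ ((ν ∘ ⇑σ⁻¹) j))⁻¹ = ∏ j, (orbitalConst γ (ν j))⁻¹ :=
    Equiv.prod_comp σ⁻¹ fun j => (orbitalConst γ (ν j))⁻¹
  rw [amplitude, amplitude, monCoeff_comp_inv, h]
  push_cast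
  ring

theorem monomialSymm_eq {N : ℕ} (b : Fin N → ℕ) (w : Fin N → ℂ) :
    monomialSymm b w = MvPolynomial.aeval w (monomialPoly b) := by
  have e : ∀ σ : Equiv.Perm (Fin N), ∏ j, w (σ j) ^ b j = ∏ j, w j ^ (b ∘ ⇑σ⁻¹) j := fun σ => by
    rw [← Equiv.prod_comp σ fun j => w j ^ (b ∘ ⇑σ⁻¹) j]
    simp
  have hM : (multFactorial b : ℂ) ≠ 0 := Nat.cast_ne_zero.2 (multFactorial_pos b).ne'
  rw [monomialSymm]
  simp only [e]
  rw [sum_perm_inv_eq b fun β => ∏ j, w j ^ β j, nsmul_eq_mul, ← mul_assoc, one_div,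
    inv_mul_cancel₀ hM, one_mul, monomialPoly, map_sum]
  refine Finset.sum_congr rfl fun β _ => ?_
  rw [MvPolynomial.aeval_monomial, Finsupp.prod_fintype _ _ (fun _ => pow_zero _), map_one, one_mul]
  rfl

theorem prod_sub_pow_eq (q : ℕ) {N : ℕ} (w : Fin N → ℂ) :
    ∏ j, ∏ k ∈ Ioi j, (w j - w k) ^ q = vandSign q N * MvPolynomial.aeval w (vandPoly q N) := by
  simp only [vandPoly, vandSign, map_prod, map_pow, map_sub, MvPolynomial.aeval_X,
    ← Finset.prod_mul_distrib, ← mul_pow]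
  refine Finset.prod_congr rfl fun j _ => Finset.prod_congr rfl fun k _ => ?_
  congr 1
  ring

/-- The wavefunction as a finite combination of products of orbitals; any finite index set that
contains all nonzero coefficients may be used. -/
theorem psi_eq_orbitalSum (q : ℕ) {γ : ℝ} (hγ : 0 < γ) {N : ℕ} (b : Fin N → ℕ)
    {U : Finset (Fin N → ℕ)} (hU : ∀ ν, monCoeff q b ν ≠ 0 → ν ∈ U) (z : Fin N → ℂ) :
    psi q γ b z = orbitalSum γ U (amplitude q γ b) id z := by
  classical
  rw [psi, monomialSymm_eq, prod_sub_pow_eq, mul_mul_mul_comm, ← map_mul,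
    MvPolynomial.aeval_def, MvPolynomial.eval₂_eq', Finset.mul_sum, orbitalSum]
  have hterm : ∀ ν : Fin N → ℕ, (kappa q γ b : ℂ) * vandSign q N *
      (algebraMap ℝ ℂ (monCoeff q b ν) * ∏ j, Complex.exp (γ * z j) ^ ν j) =
      amplitude q γ b ν * orbitalProd γ ν z := by
    intro ν
    rw [amplitude, mul_assoc (_ * _)]
    congr 1
    rw [orbitalProd]
    push_cast
    rw [mul_assoc, ← Finset.prod_mul_distrib]
    congr 1
    refine Finset.prod_congr rfl fun j _ => ?_
    have : (orbitalConst γ (ν j) : ℂ) ≠ 0 := Complex.ofReal_ne_zero.2 (orbitalConst_pos hγ _).ne'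
    rw [orbital_eq, ← mul_assoc, inv_mul_cancel₀ this, one_mul, ← Complex.exp_nat_mul]
    congr 1
    ring
  rw [← Finset.sum_subset (s₁ := (monomialPoly b * vandPoly q N).support.image
    fun m : Fin N →₀ ℕ => (m : Fin N → ℕ))
    (s₂ := U)]
  · rw [Finset.sum_image fun m _ m' _ h => DFunLike.coe_injective h]
    refine Finset.sum_congr rfl fun m _ => ?_
    rw [id, ← hterm m, monCoeff, expo_coe]
  · intro ν hν
    obtain ⟨m, hm, rfl⟩ := mem_image.1 hν
    refine hU _ ?_
    rw [monCoeff, expo_coe]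
    exact MvPolynomial.mem_support_iff.1 hm
  · intro ν _ hν
    have h0 : monCoeff q b ν = 0 := by
      by_contra h
      exact hν (mem_image.2 ⟨expo ν, MvPolynomial.mem_support_iff.2 h, rfl⟩)
    rw [amplitude, h0]
    simp

/-- All rearrangements of the partitions in a finite set. -/
def allRearr {N : ℕ} (S : Finset (Fin N → ℕ)) : Finset (Fin N → ℕ) := S.biUnion rearr

theorem mem_allRearr_of_monCoeff_ne_zero {q N : ℕ} {b : Fin N → ℕ} (hb : Monotone b)
    {ν : Fin N → ℕ} (h : monCoeff q b ν ≠ 0) : ν ∈ allRearr (dominatedSet q b) := by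
  refine mem_biUnion.2 ⟨ν ∘ Tuple.sort ν, (mem_dominatedSet q b _).2 ?_, mem_rearr_sort ν⟩
  refine dominated_of_monCoeff_ne_zero hb (Tuple.monotone_sort ν) ?_
  have := monCoeff_comp_inv q b ν (Tuple.sort ν)⁻¹
  rw [inv_inv] at this
  rw [this]
  refine mul_ne_zero (pow_ne_zero _ ?_) h
  exact_mod_cast (Equiv.Perm.sign (Tuple.sort ν)⁻¹).ne_zero

theorem sum_allRearr {N : ℕ} {E : Type*} [AddCommMonoid E] {S : Finset (Fin N → ℕ)}
    (hS : ∀ μ ∈ S, Monotone μ) (F : (Fin N → ℕ) → E) :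
    ∑ ν ∈ allRearr S, F ν = ∑ μ ∈ S, ∑ ν ∈ rearr μ, F ν := by
  refine Finset.sum_biUnion fun μ hμ μ' hμ' hne => ?_
  rw [Function.onFun, Finset.disjoint_left]
  intro ν hν hν'
  refine hne (eq_of_mem_rearr_of_monotone (b := μ') ?_ (hS _ hμ') (hS _ hμ))
  rw [← rearr_eq_of_mem hν', rearr_eq_of_mem hν]
  exact self_mem_rearr μ

/-- The normalization constant of the Slater determinants and permanents. -/
noncomputable def slaterConst {N : ℕ} (μ : Fin N → ℕ) : ℝ :=
  1 / Real.sqrt (multFactorial μ * N.factorial)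

theorem slaterConst_sq {N : ℕ} (μ : Fin N → ℕ) :
    slaterConst μ * slaterConst μ = 1 / (multFactorial μ * N.factorial) := by
  rw [slaterConst, div_mul_div_comm, Real.mul_self_sqrt (by positivity), one_mul]

theorem slater_eq_orbitalSum (q : ℕ) (γ : ℝ) {N : ℕ} (μ : Fin N → ℕ) :
    slater q γ μ = orbitalSum γ univ
      (fun σ : Equiv.Perm (Fin N) => (slaterConst μ : ℂ) * ((Equiv.Perm.sign σ : ℤ) : ℂ) ^ q)
      (fun σ => μ ∘ ⇑σ⁻¹) := by
  funext z
  rw [slater, orbitalSum, Finset.mul_sum]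
  refine Finset.sum_congr rfl fun σ _ => ?_
  rw [mul_assoc, orbitalProd, ← Equiv.prod_comp σ fun j => orbital γ ((μ ∘ ⇑σ⁻¹) j) (z j)]
  simp [slaterConst]

theorem sign_pow_mul_self {N : ℕ} (q : ℕ) (σ : Equiv.Perm (Fin N)) :
    (((Equiv.Perm.sign σ : ℤ) : ℂ)) ^ q * ((Equiv.Perm.sign σ : ℤ) : ℂ) ^ q = 1 := by
  rw [← mul_pow]
  norm_cast
  simp

/-- All `N!` terms of the Slater determinant or permanent contribute equally. -/
theorem coeff_eq (q : ℕ) {γ : ℝ} (hγ : 0 < γ) {N : ℕ} {b : Fin N → ℕ} (hb : Monotone b)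
    (μ : Fin N → ℕ) :
    coeff q γ b μ = slaterConst μ * N.factorial * amplitude q γ b μ := by
  classical
  have hpsi : psi q γ b = orbitalSum γ (allRearr (dominatedSet q b)) (amplitude q γ b) id :=
    funext fun z => psi_eq_orbitalSum q hγ b (fun ν => mem_allRearr_of_monCoeff_ne_zero hb) z
  rw [coeff, slater_eq_orbitalSum, hpsi, braket_orbitalSum hγ]
  have h1 : ∀ σ : Equiv.Perm (Fin N), ∑ ν ∈ allRearr (dominatedSet q b),
      (starRingEnd ℂ) ((slaterConst μ : ℂ) * ((Equiv.Perm.sign σ : ℤ) : ℂ) ^ q) *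
        amplitude q γ b ν * (if μ ∘ ⇑σ⁻¹ = id ν then 1 else 0) =
      slaterConst μ * amplitude q γ b μ := by
    intro σ
    simp only [id, mul_ite, mul_one, mul_zero, Finset.sum_ite_eq]
    have h2 : (starRingEnd ℂ) ((slaterConst μ : ℂ) * ((Equiv.Perm.sign σ : ℤ) : ℂ) ^ q) *
        amplitude q γ b (μ ∘ ⇑σ⁻¹) = slaterConst μ * amplitude q γ b μ := by
      rw [amplitude_comp_inv, map_mul, map_pow, Complex.conj_ofReal, map_intCast, mul_assoc,
        ← mul_assoc (_ ^ q), sign_pow_mul_self, one_mul]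
    split_ifs with h3
    · exact h2
    · have h4 : monCoeff q b (μ ∘ ⇑σ⁻¹) = 0 := by
        by_contra h
        exact h3 (mem_allRearr_of_monCoeff_ne_zero hb h)
      rw [← h2, amplitude, h4]
      simp
  rw [Finset.sum_congr rfl fun σ _ => h1 σ, Finset.sum_const, card_univ, Fintype.card_perm,
    Fintype.card_fin, nsmul_eq_mul]
  ring

open Classical in
/-- The expansion in Slater determinants or permanents, regrouped into products of orbitals. -/
theorem psiPart_eq_orbitalSum (q : ℕ) {γ : ℝ} (hγ : 0 < γ) {N : ℕ} {b : Fin N → ℕ}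
    (hb : Monotone b) (P : (Fin N → ℕ) → Prop) :
    psiPart q γ b P =
      orbitalSum γ (allRearr ((dominatedSet q b).filter P)) (amplitude q γ b) id := by
  funext z
  rw [psiPart, orbitalSum, sum_allRearr]
  swap
  · intro μ hμ
    exact ((mem_dominatedSet q b μ).1 (mem_filter.1 hμ).1).mono_left
  refine Finset.sum_congr rfl fun μ _ => ?_
  have hM : (multFactorial μ : ℂ) ≠ 0 := Nat.cast_ne_zero.2 (multFactorial_pos μ).ne'
  have hN : (N.factorial : ℂ) ≠ 0 := Nat.cast_ne_zero.2 N.factorial_pos.ne'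
  have h1 : ∀ σ : Equiv.Perm (Fin N), coeff q γ b μ *
      ((slaterConst μ : ℂ) * ((Equiv.Perm.sign σ : ℤ) : ℂ) ^ q * orbitalProd γ (μ ∘ ⇑σ⁻¹) z) =
      (1 / multFactorial μ : ℂ) *
        (amplitude q γ b (μ ∘ ⇑σ⁻¹) * orbitalProd γ (μ ∘ ⇑σ⁻¹) z) := by
    intro σ
    have h2 : (slaterConst μ : ℂ) * slaterConst μ = 1 / (multFactorial μ * N.factorial) := by
      have := congrArg (fun x : ℝ => (x : ℂ)) (slaterConst_sq μ)
      push_cast at this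
      exact this
    rw [coeff_eq q hγ hb, amplitude_comp_inv]
    calc _ = ((slaterConst μ : ℂ) * slaterConst μ) * N.factorial *
          (((Equiv.Perm.sign σ : ℤ) : ℂ) ^ q * amplitude q γ b μ *
            orbitalProd γ (μ ∘ ⇑σ⁻¹) z) := by ring
      _ = _ := by
        rw [h2]
        congr 1
        field_simp
  rw [slater_eq_orbitalSum, orbitalSum, Finset.mul_sum, Finset.sum_congr rfl fun σ _ => h1 σ,
    ← Finset.mul_sum, sum_perm_inv_eq μ fun ν => amplitude q γ b ν * orbitalProd γ ν z,
    nsmul_eq_mul, ← mul_assoc, one_div, inv_mul_cancel₀ hM, one_mul]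
  rfl

/-- The normalization constants of the wavefunction and of the orbitals combine to the weight. -/
theorem norm_amplitude_sq (q : ℕ) {γ : ℝ} (hγ : 0 < γ) {N : ℕ} (b ν : Fin N → ℕ) :
    ‖amplitude q γ b ν‖ ^ 2 = multFactorial ν / N.factorial * weight q γ b ν := by
  have hp : 0 < Real.pi ^ (3 / 2 : ℝ) := Real.rpow_pos_of_pos Real.pi_pos _
  set p := 2 * Real.pi ^ (3 / 2 : ℝ) / γ with hpdef
  have hp0 : 0 < p := by positivity
  have h1 : ∀ k : ℕ, ((orbitalConst γ k)⁻¹) ^ 2 = p * Real.exp (γ ^ 2 * (k : ℝ) ^ 2) := by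
    intro k
    rw [orbitalConst, inv_pow, mul_pow, Real.sq_sqrt (by positivity), ← Real.exp_nat_mul, mul_inv,
      ← Real.exp_neg, inv_div, hpdef]
    congr 2
    push_cast
    ring
  have h2 : (∏ j, (orbitalConst γ (ν j))⁻¹) ^ 2 =
      p ^ N * Real.exp (γ ^ 2 * ∑ j, (ν j : ℝ) ^ 2) := by
    rw [← Finset.prod_pow]
    simp only [h1]
    rw [Finset.prod_mul_distrib, Finset.prod_const, card_univ, Fintype.card_fin, ← Real.exp_sum,
      Finset.mul_sum]
  have hs : (Real.sqrt p ^ N) ^ 2 = p ^ N := by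
    rw [← pow_mul, mul_comm N 2, pow_mul, Real.sq_sqrt hp0.le]
  have h3 : kappa q γ b ^ 2 = (N.factorial * p ^ N *
      Real.exp (γ ^ 2 * ∑ j, (rootPartition q b j : ℝ) ^ 2))⁻¹ := by
    rw [kappa, one_div, inv_pow, mul_pow, mul_pow, mul_pow, ← pow_mul, mul_comm _ 2,
      pow_mul (-1 : ℝ), ← Real.exp_nat_mul, Real.sq_sqrt (by positivity), hs,
      neg_one_sq, one_pow, one_mul]
    congr 3
    push_cast
    ring
  have hM : (multFactorial ν : ℝ) ≠ 0 := Nat.cast_ne_zero.2 (multFactorial_pos ν).ne'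
  have hN : (N.factorial : ℝ) ≠ 0 := Nat.cast_ne_zero.2 N.factorial_pos.ne'
  rw [amplitude, norm_mul, norm_mul, norm_vandSign, mul_one, Complex.norm_real, Complex.norm_real,
    mul_pow, Real.norm_eq_abs, Real.norm_eq_abs, sq_abs, sq_abs, mul_pow, h2, h3, weight, mul_sub,
    neg_sub, Real.exp_sub]
  have he := Real.exp_pos (γ ^ 2 * ∑ j, (rootPartition q b j : ℝ) ^ 2)
  field_simp

/-- The squared norm of a part of the wavefunction is the total weight of its partitions. -/
theorem normSq_psiPart (q : ℕ) {γ : ℝ} (hγ : 0 < γ) {N : ℕ} {b : Fin N → ℕ} (hb : Monotone b)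
    (P : (Fin N → ℕ) → Prop) : normSq γ (psiPart q γ b P) = partWeight q γ b P := by
  classical
  have h1 : (normSq γ (psiPart q γ b P) : ℂ) = (partWeight q γ b P : ℝ) := by
    rw [normSq_eq_braket, psiPart_eq_orbitalSum q hγ hb, braket_orbitalSum hγ]
    simp only [id, mul_ite, mul_one, mul_zero, Finset.sum_ite_eq]
    have h2 : ∀ ν ∈ allRearr ((dominatedSet q b).filter P),
        (if ν ∈ allRearr ((dominatedSet q b).filter P) then
          (starRingEnd ℂ) (amplitude q γ b ν) * amplitude q γ b ν else 0) =
        ((‖amplitude q γ b ν‖ ^ 2 : ℝ) : ℂ) := by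
      intro ν hν
      rw [if_pos hν, Complex.conj_mul']
      push_cast
      rfl
    rw [Finset.sum_congr rfl h2, ← Complex.ofReal_sum, Complex.ofReal_inj, sum_allRearr]
    swap
    · intro μ hμ
      exact ((mem_dominatedSet q b μ).1 (mem_filter.1 hμ).1).mono_left
    refine Finset.sum_congr rfl fun μ _ => ?_
    have h3 : ∀ ν ∈ rearr μ, ‖amplitude q γ b ν‖ ^ 2 = ‖amplitude q γ b μ‖ ^ 2 := by
      intro ν hν
      obtain ⟨σ, rfl⟩ := mem_rearr.1 hν
      have := amplitude_comp_inv q γ b μ σ⁻¹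
      rw [inv_inv] at this
      rw [this, norm_mul, norm_pow]
      have h4 : ‖((Equiv.Perm.sign σ⁻¹ : ℤ) : ℂ)‖ = 1 := by
        rcases Int.units_eq_one_or (Equiv.Perm.sign σ⁻¹) with h | h <;> rw [h] <;> simp
      rw [h4, one_pow, one_mul]
    have hN : (N.factorial : ℝ) ≠ 0 := Nat.cast_ne_zero.2 N.factorial_pos.ne'
    rw [Finset.sum_congr rfl h3, Finset.sum_const, nsmul_eq_mul, norm_amplitude_sq q hγ,
      ← mul_assoc, mul_div_assoc', ← Nat.cast_mul, mul_comm _ (multFactorial μ), card_rearr_mul,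
      div_self hN, one_mul]
  exact_mod_cast h1

/-- All partitions in the expansion are dominated by the root partition, so nothing is lost. -/
theorem normSq_psi (q : ℕ) {γ : ℝ} (hγ : 0 < γ) {N : ℕ} {b : Fin N → ℕ} (hb : Monotone b) :
    normSq γ (psi q γ b) = partWeight q γ b fun _ => True := by
  classical
  rw [← normSq_psiPart q hγ hb, psiPart_eq_orbitalSum q hγ hb]
  congr 1
  funext z
  refine psi_eq_orbitalSum q hγ b (fun ν h => ?_) z
  exact Finset.biUnion_subset_biUnion_of_subset_left _
    (fun _ hμ => (@mem_filter _ _ (fun _ => Classical.propDecidable _) _ _).2 ⟨hμ, trivial⟩)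
    (mem_allRearr_of_monCoeff_ne_zero hb h)

/-! ### Renewal sequences with exponentially small tails -/

theorem sum_range_antidiagonal_le {p v : ℕ → ℝ} (hp : ∀ n, 0 ≤ p n) (hv : ∀ n, 0 ≤ v n) (N : ℕ) :
    ∑ n ∈ range N, ∑ x ∈ antidiagonal n, p x.1 * v x.2 ≤
      (∑ n ∈ range N, p n) * ∑ n ∈ range N, v n := by
  classical
  set S := (range N ×ˢ range N).filter fun x : ℕ × ℕ => x.1 + x.2 < N
  have h1 : ∀ n ∈ range N, antidiagonal n = S.filter fun x => x.1 + x.2 = n := by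
    intro n hn
    ext x
    simp only [S, HasAntidiagonal.mem_antidiagonal, mem_filter, mem_product, mem_range] at hn ⊢
    omega
  rw [Finset.sum_congr rfl fun n hn => Finset.sum_congr (h1 n hn) fun _ _ => rfl,
    Finset.sum_fiberwise_of_maps_to (fun x hx => mem_range.2 (mem_filter.1 hx).2),
    Finset.sum_mul_sum, ← Finset.sum_product']
  exact Finset.sum_le_sum_of_subset_of_nonneg (filter_subset _ _) fun x _ _ =>
    mul_nonneg (hp _) (hv _)

/-- The tails `1 - f₀ - … - fₖ` of a probability distribution. -/
noncomputable def distTail (f : ℕ → ℝ) (k : ℕ) : ℝ := 1 - ∑ j ∈ range (k + 1), f j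

theorem distTail_succ (f : ℕ → ℝ) (k : ℕ) : distTail f (k + 1) = distTail f k - f (k + 1) := by
  rw [distTail, distTail, Finset.sum_range_succ _ (k + 1)]
  ring

/-- The increments `uₙ - uₙ₋₁` of a sequence, with `u₋₁ = 0`. -/
def increment (u : ℕ → ℝ) : ℕ → ℝ
  | 0 => u 0
  | n + 1 => u (n + 1) - u n

theorem sum_increment (u : ℕ → ℝ) (n : ℕ) : ∑ k ∈ range (n + 1), increment u k = u n := by
  induction n with
  | zero => simp [increment]
  | succ n ih => rw [Finset.sum_range_succ, ih]; simp [increment]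

/-- The renewal equation `u = f * u + b` turns into `T * v = b` for the tails `T` of `f` and the
increments `v` of `u`: in terms of generating functions, `1 - f(z) = (1 - z) T(z)` and
`v(z) = (1 - z) u(z)`. -/
theorem sum_distTail_mul_increment {f u b : ℕ → ℝ} (hf0 : f 0 = 0)
    (hu : ∀ n, u n = ∑ x ∈ antidiagonal n, f x.1 * u x.2 + b n) (n : ℕ) :
    ∑ x ∈ antidiagonal n, distTail f x.1 * increment u x.2 = b n := by
  have h1 : PowerSeries.mk u = PowerSeries.mk f * PowerSeries.mk u + PowerSeries.mk b := by
    ext n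
    rw [map_add, PowerSeries.coeff_mul]
    simp only [PowerSeries.coeff_mk]
    exact hu n
  have h2 : PowerSeries.mk (increment u) = PowerSeries.mk u * (1 - PowerSeries.X) := by
    ext n
    rw [mul_sub, mul_one, map_sub]
    cases n with
    | zero => simp [increment]
    | succ n => simp [increment, PowerSeries.coeff_succ_mul_X]
  have h3 : PowerSeries.mk (distTail f) * (1 - PowerSeries.X) = 1 - PowerSeries.mk f := by
    ext n
    rw [mul_sub, mul_one, map_sub, map_sub]
    cases n with
    | zero => simp [distTail, hf0]
    | succ n => simp [distTail_succ, PowerSeries.coeff_succ_mul_X, PowerSeries.coeff_one]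
  have h4 : PowerSeries.mk (distTail f) * PowerSeries.mk (increment u) = PowerSeries.mk b := by
    rw [h2, mul_comm (PowerSeries.mk u), ← mul_assoc, h3, sub_mul, one_mul, sub_eq_iff_eq_add']
    exact h1
  have h5 := congrArg (PowerSeries.coeff n) h4
  rw [PowerSeries.coeff_mul] at h5
  simpa only [PowerSeries.coeff_mk] using h5

theorem distTail_nonneg {f : ℕ → ℝ} (hf : ∀ n, 0 ≤ f n) (hs : HasSum f 1) (k : ℕ) :
    0 ≤ distTail f k :=
  sub_nonneg.2 (sum_le_hasSum _ (fun i _ => hf i) hs)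

/-- A contraction argument: if the tails weighted with `wᵏ`, `k ≥ 1`, add up to less than one then
the increments decay as fast as `w⁻ⁿ`. -/
theorem summable_increment {f u b : ℕ → ℝ} (hf : ∀ n, 0 ≤ f n) (hf0 : f 0 = 0) (hs : HasSum f 1)
    (hu : ∀ n, u n = ∑ x ∈ antidiagonal n, f x.1 * u x.2 + b n) {w θ : ℝ} (hw : 0 < w)
    (hθ : θ < 1) (hT : ∀ N, ∑ k ∈ range N, distTail f (k + 1) * w ^ (k + 1) ≤ θ)
    (hb : Summable fun n => |b n| * w ^ n) : Summable fun n => |increment u n| * w ^ n := by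
  set v := fun n => |increment u n| * w ^ n with hv
  have hv0 : ∀ n, 0 ≤ v n := fun n => by positivity
  have hb0 : ∀ n, 0 ≤ |b n| * w ^ n := fun n => by positivity
  set p : ℕ → ℝ := fun k => if k = 0 then 0 else distTail f k * w ^ k with hp
  have hp0 : ∀ n, 0 ≤ p n := fun n => by
    simp only [hp]
    split_ifs
    · exact le_rfl
    · exact mul_nonneg (distTail_nonneg hf hs n) (by positivity)
  have hpθ : ∀ N, ∑ k ∈ range N, p k ≤ θ := by
    intro N
    cases N with
    | zero => simpa using hT 0
    | succ N =>
      rw [Finset.sum_range_succ']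
      simpa [hp] using hT N
  have hstep : ∀ n, v n ≤ |b n| * w ^ n + ∑ x ∈ antidiagonal n, p x.1 * v x.2 := by
    intro n
    have h1 := sum_distTail_mul_increment hf0 hu n
    have h2 : increment u n = b n - ∑ x ∈ antidiagonal n,
        (if x.1 = 0 then 0 else distTail f x.1) * increment u x.2 := by
      rw [← h1, ← Finset.sum_sub_distrib, Finset.sum_eq_single (0, n)]
      · simp [distTail, hf0]
      · intro x hx hne
        have h3 := HasAntidiagonal.mem_antidiagonal.1 hx
        have : x.1 ≠ 0 := fun h => hne (Prod.ext h (by simp only; omega))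
        simp [this]
      · intro h
        exact absurd (HasAntidiagonal.mem_antidiagonal.2 (Nat.zero_add n)) h
    have h3 : |increment u n| ≤ |b n| + ∑ x ∈ antidiagonal n,
        (if x.1 = 0 then 0 else distTail f x.1) * |increment u x.2| := by
      rw [h2]
      refine (abs_sub _ _).trans (add_le_add_right ((Finset.abs_sum_le_sum_abs _ _).trans
        (Finset.sum_le_sum fun x _ => ?_)) _)
      rw [abs_mul]
      refine mul_le_mul_of_nonneg_right (le_of_eq (abs_of_nonneg ?_)) (abs_nonneg _)
      split_ifs
      · exact le_rfl
      · exact distTail_nonneg hf hs _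
    calc v n ≤ (|b n| + ∑ x ∈ antidiagonal n,
        (if x.1 = 0 then 0 else distTail f x.1) * |increment u x.2|) * w ^ n :=
          mul_le_mul_of_nonneg_right h3 (by positivity)
      _ = _ := by
        rw [add_mul, Finset.sum_mul]
        congr 1
        refine Finset.sum_congr rfl fun x hx => ?_
        rw [← HasAntidiagonal.mem_antidiagonal.1 hx, pow_add]
        simp only [hp, hv]
        split_ifs <;> ring
  refine summable_of_sum_range_le (c := (∑' n, |b n| * w ^ n) / (1 - θ)) hv0 fun N => ?_
  have h1 : ∑ n ∈ range N, v n ≤ ∑' n, |b n| * w ^ n + θ * ∑ n ∈ range N, v n := by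
    calc ∑ n ∈ range N, v n
        ≤ ∑ n ∈ range N, (|b n| * w ^ n + ∑ x ∈ antidiagonal n, p x.1 * v x.2) :=
          Finset.sum_le_sum fun n _ => hstep n
      _ = ∑ n ∈ range N, |b n| * w ^ n + ∑ n ∈ range N, ∑ x ∈ antidiagonal n, p x.1 * v x.2 :=
          Finset.sum_add_distrib
      _ ≤ _ := add_le_add (hb.sum_le_tsum _ fun n _ => hb0 n)
          ((sum_range_antidiagonal_le hp0 hv0 N).trans
            (mul_le_mul_of_nonneg_right (hpθ N) (Finset.sum_nonneg fun n _ => hv0 n)))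
  rw [le_div_iff₀ (by linarith)]
  linarith

/-- Summation by parts. -/
theorem sum_range_distTail (f : ℕ → ℝ) (N : ℕ) :
    ∑ k ∈ range N, distTail f k = ∑ j ∈ range (N + 1), j * f j + N * distTail f N := by
  induction N with
  | zero => simp
  | succ N ih =>
    rw [Finset.sum_range_succ, ih, Finset.sum_range_succ _ (N + 1), distTail_succ]
    push_cast
    ring

/-- The mean of a distribution is the sum of its tails. -/
theorem hasSum_mul_of_distTail_le {f : ℕ → ℝ} (hf : ∀ n, 0 ≤ f n) (hs : HasSum f 1) {K ξ : ℝ}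
    (hξ0 : 0 ≤ ξ) (hξ : ξ < 1) (hT : ∀ k, distTail f k ≤ K * ξ ^ k) :
    Summable (distTail f) ∧ HasSum (fun n : ℕ => n * f n) (∑' k, distTail f k) := by
  have h1 : Summable (distTail f) :=
    Summable.of_nonneg_of_le (distTail_nonneg hf hs) hT
      ((summable_geometric_of_lt_one hξ0 hξ).mul_left K)
  refine ⟨h1, ?_⟩
  rw [hasSum_iff_tendsto_nat_of_nonneg fun n => mul_nonneg (Nat.cast_nonneg n) (hf n)]
  have h2 : Tendsto (fun N : ℕ => (N : ℝ) * distTail f N) atTop (𝓝 0) := by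
    have h3 := (tendsto_self_mul_const_pow_of_lt_one hξ0 hξ).const_mul K
    rw [mul_zero] at h3
    refine squeeze_zero (fun N => mul_nonneg (Nat.cast_nonneg N) (distTail_nonneg hf hs N))
      (fun N => ?_) h3
    calc (N : ℝ) * distTail f N ≤ N * (K * ξ ^ N) :=
          mul_le_mul_of_nonneg_left (hT N) (Nat.cast_nonneg N)
      _ = K * (N * ξ ^ N) := by ring
  have h4 := h1.hasSum.tendsto_sum_nat.sub h2
  rw [sub_zero] at h4
  rw [← tendsto_add_atTop_iff_nat 1]
  refine h4.congr fun N => ?_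
  rw [sum_range_distTail]
  ring

/-- The tail of a series that converges with the weights `wⁿ` is of order `w⁻ⁿ`. -/
theorem abs_tsum_tail_le {v : ℕ → ℝ} {w : ℝ} (hw : 1 ≤ w) (hv : Summable fun n => |v n| * w ^ n)
    (hv1 : Summable fun n => |v n|) (n : ℕ) :
    |∑' k, v (k + (n + 1))| ≤ (∑' n, |v n| * w ^ n) * (w ^ n)⁻¹ := by
  have hw0 : 0 < w := by linarith
  have hs3 : Summable fun k => |v (k + (n + 1))| :=
    (summable_nat_add_iff (f := fun n => |v n|) (n + 1)).2 hv1
  have hs4 : Summable fun k => |v (k + (n + 1))| * w ^ (k + (n + 1)) :=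
    (summable_nat_add_iff (f := fun n => |v n| * w ^ n) (n + 1)).2 hv
  have h1 : |∑' k, v (k + (n + 1))| ≤ ∑' k, |v (k + (n + 1))| :=
    norm_tsum_le_tsum_norm (f := fun k => v (k + (n + 1))) hs3
  have h2 : (∑' k, |v (k + (n + 1))|) * w ^ n ≤ ∑' k, |v (k + (n + 1))| * w ^ (k + (n + 1)) := by
    rw [← tsum_mul_right]
    refine Summable.tsum_le_tsum (fun k => ?_) (hs3.mul_right _) hs4
    exact mul_le_mul_of_nonneg_left (pow_le_pow_right₀ hw (by omega)) (abs_nonneg _)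
  have h3 : ∑' k, |v (k + (n + 1))| * w ^ (k + (n + 1)) ≤ ∑' n, |v n| * w ^ n := by
    have h4 := hv.sum_add_tsum_nat_add (n + 1)
    have h5 : 0 ≤ ∑ k ∈ range (n + 1), |v k| * w ^ k := Finset.sum_nonneg fun k _ => by positivity
    linarith
  rw [← div_eq_mul_inv, le_div_iff₀ (by positivity)]
  exact (mul_le_mul_of_nonneg_right h1 (by positivity)).trans (h2.trans h3)

theorem tsum_distTail_mul_tsum_increment {f u b : ℕ → ℝ} (hf0 : f 0 = 0)
    (hu : ∀ n, u n = ∑ x ∈ antidiagonal n, f x.1 * u x.2 + b n)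
    (hT : Summable fun k => ‖distTail f k‖) (hv : Summable fun n => ‖increment u n‖) :
    (∑' k, distTail f k) * ∑' n, increment u n = ∑' n, b n := by
  rw [tsum_mul_tsum_eq_tsum_sum_antidiagonal_of_summable_norm hT hv]
  exact tsum_congr fun n => sum_distTail_mul_increment hf0 hu n

/-- The renewal theorem with an exponential rate. -/
theorem abs_sub_renewal_limit_le {f u b : ℕ → ℝ} (hf : ∀ n, 0 ≤ f n) (hf0 : f 0 = 0)
    (hs : HasSum f 1) (hu : ∀ n, u n = ∑ x ∈ antidiagonal n, f x.1 * u x.2 + b n) {w θ : ℝ}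
    (hw : 1 ≤ w) (hθ : θ < 1)
    (hT : ∀ N, ∑ k ∈ range N, distTail f (k + 1) * w ^ (k + 1) ≤ θ)
    (hTs : Summable (distTail f)) (hb : Summable fun n => |b n| * w ^ n) :
    ∃ K, ∀ n, |u n - (∑' n, b n) / ∑' k, distTail f k| ≤ K * (w ^ n)⁻¹ := by
  have hsum := summable_increment hf hf0 hs hu (by linarith) hθ hT hb
  have hsum1 : Summable fun n => |increment u n| :=
    Summable.of_nonneg_of_le (fun n => abs_nonneg _)
      (fun n => le_mul_of_one_le_right (abs_nonneg _) (one_le_pow₀ hw)) hsum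
  have hsum2 : Summable (increment u) := hsum1.of_abs
  have hmul := tsum_distTail_mul_tsum_increment hf0 hu hTs.norm hsum1
  have hμ : 0 < ∑' k, distTail f k :=
    hTs.tsum_pos (distTail_nonneg hf hs) 0 (by simp [distTail, hf0])
  refine ⟨∑' n, |increment u n| * w ^ n, fun n => ?_⟩
  have e2 := hsum2.sum_add_tsum_nat_add (n + 1)
  have e1 : u n - (∑' n, b n) / ∑' k, distTail f k = -∑' k, increment u (k + (n + 1)) := by
    rw [← hmul, mul_div_cancel_left₀ _ hμ.ne', ← e2, sum_increment]
    ring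
  rw [e1, abs_neg]
  exact abs_tsum_tail_le hw hsum hsum1 n

/-- A power series with nonnegative coefficients attains the value one inside `(0, 1)`. -/
theorem exists_hasSum_one {a : ℕ → ℝ} (ha : ∀ n, 0 ≤ a n) (ha0 : a 0 = 0) (hs : Summable a)
    (h1 : 1 < ∑' n, a n) : ∃ r, 0 < r ∧ r < 1 ∧ HasSum (fun n => a n * r ^ n) 1 := by
  have hb : ∀ n, ∀ t ∈ Set.Icc (0 : ℝ) 1, ‖a n * t ^ n‖ ≤ a n := by
    intro n t ht
    rw [Real.norm_of_nonneg (mul_nonneg (ha n) (pow_nonneg ht.1 n))]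
    exact mul_le_of_le_one_right (ha n) (pow_le_one₀ ht.1 ht.2)
  have hc : ContinuousOn (fun t : ℝ => ∑' n, a n * t ^ n) (Set.Icc 0 1) :=
    continuousOn_tsum (fun n => by fun_prop) hs hb
  have e0 : ∑' n, a n * (0 : ℝ) ^ n = 0 := by
    rw [tsum_eq_single 0 fun n hn => by simp [hn]]
    simp [ha0]
  have e1 : ∑' n, a n * (1 : ℝ) ^ n = ∑' n, a n := by simp
  obtain ⟨r, hr, hr1⟩ := intermediate_value_Icc zero_le_one hc
    (show (1 : ℝ) ∈ Set.Icc (∑' n, a n * (0 : ℝ) ^ n) (∑' n, a n * (1 : ℝ) ^ n) by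
      rw [e0, e1]; exact ⟨zero_le_one, h1.le⟩)
  simp only at hr1
  refine ⟨r, lt_of_le_of_ne hr.1 ?_, lt_of_le_of_ne hr.2 ?_, ?_⟩
  · rintro rfl
    rw [e0] at hr1
    exact zero_ne_one hr1
  · rintro rfl
    rw [e1] at hr1
    exact h1.ne' hr1
  · rw [← hr1]
    exact (Summable.of_norm_bounded hs fun n => hb n r hr).hasSum

/-- If the `αₙ` have a geometric bound at the radius `ρ` then so do the tails of `αₙ rⁿ`, even after
multiplication with `(ρ / r)ᵏ`. -/
theorem distTail_mul_pow_le {a : ℕ → ℝ} {r ρ K ξ : ℝ} (ha : ∀ n, 0 ≤ a n)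
    (hr0 : 0 < r) (hr1 : r ≤ 1) (hρ : 1 ≤ ρ) (hK : 0 ≤ K) (hξ0 : 0 ≤ ξ) (hξ : ξ ≤ 1 / 2)
    (hbound : ∀ n, 1 ≤ n → a n * ρ ^ (n - 1) ≤ K * ξ ^ (n - 1))
    (hs : HasSum (fun n => a n * r ^ n) 1) (k : ℕ) :
    distTail (fun n => a n * r ^ n) k * (ρ / r) ^ k ≤ 2 * K * ξ ^ k := by
  have e1 : distTail (fun n => a n * r ^ n) k = ∑' n, a (n + (k + 1)) * r ^ (n + (k + 1)) := by
    rw [distTail, ← hs.tsum_eq, ← hs.summable.sum_add_tsum_nat_add (k + 1)]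
    ring
  have hgeo : Summable fun n : ℕ => K * ξ ^ k * (1 / 2 : ℝ) ^ n :=
    summable_geometric_two.mul_left _
  have hsk : Summable fun n => a (n + (k + 1)) * r ^ (n + (k + 1)) :=
    (summable_nat_add_iff (f := fun n => a n * r ^ n) (k + 1)).2 hs.summable
  rw [e1, ← tsum_mul_right]
  refine (Summable.tsum_le_tsum (fun n => ?_) (hsk.mul_right _) hgeo).trans (le_of_eq ?_)
  · have h1 := hbound (n + (k + 1)) (by omega)
    have h2 : n + (k + 1) - 1 = n + k := by omega
    rw [h2] at h1
    calc a (n + (k + 1)) * r ^ (n + (k + 1)) * (ρ / r) ^ k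
        = a (n + (k + 1)) * (r ^ (n + 1) * ρ ^ k) := by
          rw [div_pow, show n + (k + 1) = (n + 1) + k by ring, pow_add r]
          field_simp
      _ ≤ a (n + (k + 1)) * (1 * ρ ^ (n + k)) := by
          refine mul_le_mul_of_nonneg_left ?_ (ha _)
          exact mul_le_mul (pow_le_one₀ hr0.le hr1) (pow_le_pow_right₀ hρ (by omega))
            (by positivity) zero_le_one
      _ ≤ K * ξ ^ (n + k) := by rw [one_mul]; exact h1
      _ = K * ξ ^ k * ξ ^ n := by rw [pow_add]; ring
      _ ≤ K * ξ ^ k * (1 / 2) ^ n :=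
          mul_le_mul_of_nonneg_left (pow_le_pow_left₀ hξ0 hξ n) (by positivity)
  · rw [tsum_mul_left, tsum_geometric_two]
    ring

/-! ### Smallness of the constants -/

/-- Of the constant `C_q(γ)` only this upper bound is used. -/
theorem decayConst_le {q : ℕ} (hq : 2 ≤ q) (γ : ℝ) : decayConst q γ ≤ γ ^ 2 - (8 * q + 2) := by
  have hq' : (2 : ℝ) ≤ q := by exact_mod_cast hq
  set x := Real.exp (-(4 * (q : ℝ) + 1)) with hx
  have hx1 : x ≤ 1 / 10 := by
    rw [hx, Real.exp_neg, inv_le_comm₀ (Real.exp_pos _) (by norm_num)]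
    have := Real.add_one_le_exp (4 * (q : ℝ) + 1)
    norm_num
    linarith
  have h1 : -(1 / 9) ≤ Real.log (1 - x) := by
    refine le_trans ?_ (Real.one_sub_inv_le_log_of_pos (by linarith))
    have : (1 - x)⁻¹ ≤ (9 / 10)⁻¹ := inv_anti₀ (by norm_num) (by linarith)
    norm_num at this ⊢
    linarith
  have h2 : 2 * (q : ℝ)⁻¹ ≤ 1 := by
    have : (q : ℝ)⁻¹ ≤ 2⁻¹ := inv_anti₀ (by norm_num) hq'
    linarith
  have h3 : 0 ≤ 2 * (q : ℝ)⁻¹ := by positivity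
  have h4 : -(1 / 9) ≤ 2 * (q : ℝ)⁻¹ * Real.log (1 - x) := by
    rcases le_total 0 (Real.log (1 - x)) with h | h
    · exact le_trans (by norm_num) (mul_nonneg h3 h)
    · nlinarith
  have h5 : (1 : ℝ) / 2 ≤ Real.sqrt (2 / 3) := Real.le_sqrt_of_sq_le (by norm_num)
  have h6 : 1 ≤ Real.pi * Real.sqrt (2 / 3) := by nlinarith [Real.pi_gt_three]
  rw [decayConst]
  linarith

theorem eight_mul_add_two_le_sq {q : ℕ} (hq : 2 ≤ q) {γ : ℝ} (hC : 0 < decayConst q γ) :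
    8 * (q : ℝ) + 2 ≤ γ ^ 2 := by
  linarith [decayConst_le hq γ]

theorem one_le_entropy (q : ℕ) : 1 ≤ (2 * Real.exp q) ^ 2 := by
  have : 1 ≤ Real.exp q := Real.one_le_exp (Nat.cast_nonneg q)
  nlinarith

theorem four_mul_exp_le_one {q : ℕ} (hq : 2 ≤ q) {γ : ℝ} (hC : 0 < decayConst q γ) :
    4 * Real.exp (-(γ ^ 2 * q)) ≤ 1 := by
  have h1 := four_exp_le hq (eight_mul_add_two_le_sq hq hC)
  have h2 : 4 * Real.exp (-(γ ^ 2 * q)) ≤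
      (2 * Real.exp q) ^ 2 * (4 * Real.exp (-(γ ^ 2 * q))) :=
    le_mul_of_one_le_left (by positivity) (one_le_entropy q)
  linarith

/-- The ratio of the geometric bound on the irreducible weights, times the radius
`exp (C_q(γ) q)`, is tiny. -/
theorem ratio_small {q : ℕ} (hq : 2 ≤ q) (γ : ℝ) :
    4 * (2 * Real.exp q) ^ 2 * ((2 * Real.exp q) ^ 2 * (4 * Real.exp (-(γ ^ 2 * q))) *
      Real.exp (decayConst q γ * q)) ≤ 1 / 2 := by
  have hq' : (2 : ℝ) ≤ q := by exact_mod_cast hq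
  have h1 : (2 * Real.exp q) ^ 2 = 4 * Real.exp (2 * q) := by
    rw [mul_pow, ← Real.exp_nat_mul]
    norm_num
  have h2 : 4 * (2 * Real.exp q) ^ 2 * ((2 * Real.exp q) ^ 2 * (4 * Real.exp (-(γ ^ 2 * q))) *
      Real.exp (decayConst q γ * q)) =
      256 * Real.exp (2 * q + 2 * q + -(γ ^ 2 * q) + decayConst q γ * q) := by
    rw [h1, Real.exp_add, Real.exp_add, Real.exp_add]
    ring
  have h3 : 2 * q + 2 * q + -(γ ^ 2 * q) + decayConst q γ * q ≤ -24 := by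
    have := mul_le_mul_of_nonneg_right (decayConst_le hq γ) (Nat.cast_nonneg q)
    nlinarith
  have h4 : (512 : ℝ) ≤ Real.exp 24 := by
    have h5 : (2 : ℝ) ≤ Real.exp 1 := by linarith [Real.add_one_le_exp (1 : ℝ)]
    calc (512 : ℝ) ≤ 2 ^ 24 := by norm_num
      _ ≤ Real.exp 1 ^ 24 := pow_le_pow_left₀ (by norm_num) h5 24
      _ = Real.exp 24 := by rw [← Real.exp_nat_mul]; norm_num
  have h6 : Real.exp (-24) ≤ 1 / 512 := by
    rw [Real.exp_neg, one_div]
    exact inv_anti₀ (by norm_num) h4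
  rw [h2]
  linarith [Real.exp_le_exp.2 h3]

theorem ratio_le_half {q : ℕ} (hq : 2 ≤ q) (γ : ℝ) :
    (2 * Real.exp q) ^ 2 * (4 * Real.exp (-(γ ^ 2 * q))) * Real.exp (decayConst q γ * q) ≤
      1 / 2 := by
  refine le_trans ?_ (ratio_small hq γ)
  exact le_mul_of_one_le_left (by positivity) (by linarith [one_le_entropy q])

theorem summable_mul_pow_of_le {a : ℕ → ℝ} {H η ρ : ℝ} (ha : ∀ n, 0 ≤ a n) (hH : 0 ≤ H)
    (hη : 0 ≤ η) (hρ : 0 ≤ ρ) (hr : H * η * ρ < 1) (m : ℕ)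
    (h : ∀ n, a n ≤ H ^ n * η ^ (n - m)) : Summable fun n => a n * ρ ^ n := by
  rw [← summable_nat_add_iff m]
  have hg : Summable fun n : ℕ => (H * ρ) ^ m * (H * η * ρ) ^ n :=
    (summable_geometric_of_lt_one (by positivity) hr).mul_left _
  refine Summable.of_nonneg_of_le (fun n => mul_nonneg (ha _) (by positivity)) (fun n => ?_) hg
  calc a (n + m) * ρ ^ (n + m) ≤ H ^ (n + m) * η ^ (n + m - m) * ρ ^ (n + m) :=
        mul_le_mul_of_nonneg_right (h _) (by positivity)
    _ = _ := by
      rw [Nat.add_sub_cancel, pow_add, pow_add, mul_pow, mul_pow, mul_pow]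
      ring

theorem summable_ofReal_mul_pow {a : ℕ → ℝ} {ρ : ℝ} (ha : ∀ n, 0 ≤ a n)
    (h : Summable fun n => a n * ρ ^ n) {z : ℂ} (hz : ‖z‖ < ρ) :
    Summable fun n => (a n : ℂ) * z ^ n := by
  refine Summable.of_norm_bounded h fun n => ?_
  rw [norm_mul, norm_pow, Complex.norm_real, Real.norm_of_nonneg (ha n)]
  exact mul_le_mul_of_nonneg_left (pow_le_pow_left₀ (norm_nonneg z) hz.le n) (ha n)

/-! ### The wavefunctions with a fixed boundary block -/

theorem alpha_eq {q : ℕ} {γ : ℝ} (hγ : 0 < γ) {n : ℕ} (hn : 1 ≤ n) :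
    alpha q γ n = irredWeight q γ 0 0 n := by
  rw [alpha, if_pos hn, psiHat, normSq_psiPart q hγ fun _ _ _ => le_rfl]
  rfl

theorem alpha_zero (q : ℕ) (γ : ℝ) : alpha q γ 0 = 0 := if_neg (by omega)

theorem alpha_nonneg (q : ℕ) {γ : ℝ} (hγ : 0 < γ) (n : ℕ) : 0 ≤ alpha q γ n := by
  rcases Nat.eq_zero_or_pos n with rfl | hn
  · rw [alpha_zero]
  · rw [alpha_eq hγ hn]
    exact irredWeight_nonneg _ _ _ _ _

theorem alpha_le {q : ℕ} (hq : 2 ≤ q) {γ : ℝ} (hγ : 0 < γ) (hC : 0 < decayConst q γ) (n : ℕ) :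
    alpha q γ n ≤ ((2 * Real.exp q) ^ 2) ^ n * (4 * Real.exp (-(γ ^ 2 * q))) ^ (n - 1) := by
  rcases Nat.eq_zero_or_pos n with rfl | hn
  · rw [alpha_zero]
    positivity
  · rw [alpha_eq hγ hn, pow_right_comm]
    exact irredWeight_le (four_mul_exp_le_one hq hC) (fun _ _ _ => le_rfl) 0 hn

theorem summable_alpha_mul_pow {q : ℕ} (hq : 2 ≤ q) {γ : ℝ} (hγ : 0 < γ)
    (hC : 0 < decayConst q γ) :
    Summable fun n => alpha q γ n * Real.exp (decayConst q γ * q) ^ n :=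
  summable_mul_pow_of_le (alpha_nonneg q hγ) (by positivity) (by positivity)
    (Real.exp_pos _).le ((ratio_le_half hq γ).trans_lt (by norm_num)) 1 (alpha_le hq hγ hC)

theorem one_lt_exp_decayConst {q : ℕ} (hq : 2 ≤ q) {γ : ℝ} (hC : 0 < decayConst q γ) :
    1 < Real.exp (decayConst q γ * q) :=
  Real.one_lt_exp_iff.2 (mul_pos hC (by exact_mod_cast (by omega : 0 < q)))

/-- The number `r`: as `α₁ = 1` and `α₂ > 0`, the sum of the `αₙ` exceeds one. -/
theorem exists_hasSum_alpha_mul_pow {q : ℕ} (hq : 2 ≤ q) {γ : ℝ} (hγ : 0 < γ)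
    (hC : 0 < decayConst q γ) :
    ∃ r : ℝ, 0 < r ∧ r < 1 ∧ HasSum (fun n => alpha q γ n * r ^ n) 1 := by
  have hs : Summable (alpha q γ) :=
    Summable.of_nonneg_of_le (alpha_nonneg q hγ)
      (fun n => le_mul_of_one_le_right (alpha_nonneg q hγ n)
        (one_le_pow₀ (one_lt_exp_decayConst hq hC).le)) (summable_alpha_mul_pow hq hγ hC)
  refine exists_hasSum_one (alpha_nonneg q hγ) (alpha_zero q γ) hs ?_
  refine lt_of_lt_of_le ?_ (hs.sum_le_tsum {1, 2} fun n _ => alpha_nonneg q hγ n)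
  rw [Finset.sum_pair (by norm_num), alpha_eq hγ le_rfl, alpha_eq hγ one_le_two, irredWeight_one]
  linarith [exp_le_irredWeight_two hq γ, Real.exp_pos (-(γ ^ 2 * (2 * ((q : ℝ) - 1))))]

/-- A finite sequence, continued with its last entry. -/
def extend {N : ℕ} (b : Fin N → ℕ) (j : ℕ) : ℕ := if h : j < N then b ⟨j, h⟩ else lastEntry b

theorem monotone_extend {N : ℕ} {b : Fin N → ℕ} (hb : Monotone b) : Monotone (extend b) := by
  intro i j hij
  unfold extend
  split_ifs with h1 h2 h2
  · exact hb hij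
  · exact le_lastEntry hb _
  · omega
  · exact le_rfl

theorem block_extend {N : ℕ} (b : Fin N → ℕ) : block (extend b) 0 N = b := by
  funext j
  simp [block, extend]

theorem monotone_padded {M : ℕ} {b₂ : Fin M → ℕ} (hb : Monotone b₂) (N : ℕ) :
    Monotone (padded b₂ N) := by
  intro i j hij
  have hij' : (i : ℕ) ≤ j := hij
  unfold padded
  split_ifs with h1 h2 h2
  · exact hb (by rw [Fin.mk_le_mk]; omega)
  · omega
  · exact Nat.zero_le _
  · exact le_rfl

theorem block_extend_padded_left {M : ℕ} (b₂ : Fin M → ℕ) {n s : ℕ} (hs : s ≤ n - M) :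
    block (extend (padded b₂ n)) 0 s = block 0 0 s := by
  funext j
  have := j.2
  simp only [block, extend, padded]
  rw [dif_pos (by omega), dif_neg (by omega)]
  rfl

theorem block_extend_padded_right {M : ℕ} (b₂ : Fin M → ℕ) {n s : ℕ} (hM : M ≤ n)
    (hs : s ≤ n - M) : block (extend (padded b₂ n)) (0 + s) (n - s) = padded b₂ (n - s) := by
  funext j
  have := j.2
  simp only [block, extend, padded]
  rw [dif_pos (by omega)]
  by_cases h : n - M ≤ 0 + s + j
  · rw [dif_pos h, dif_pos (by omega)]
    congr 1
    rw [Fin.mk.injEq]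
    omega
  · rw [dif_neg h, dif_neg (by omega)]

theorem normC_eq {q : ℕ} {γ : ℝ} (hγ : 0 < γ) {M : ℕ} {b₂ : Fin M → ℕ} (hb : Monotone b₂)
    (n : ℕ) : normC q γ b₂ n = blockWeight q γ (extend (padded b₂ n)) 0 n := by
  rw [normC, normSq_psi q hγ (monotone_padded hb n), blockWeight, block_extend]

theorem one_le_normC {q : ℕ} (hq : 2 ≤ q) {γ : ℝ} (hγ : 0 < γ) {M : ℕ} {b₂ : Fin M → ℕ}
    (hb : Monotone b₂) (n : ℕ) : 1 ≤ normC q γ b₂ n := by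
  rw [normC_eq hγ hb]
  exact one_le_blockWeight (by omega) γ (monotone_extend (monotone_padded hb n)) n 0

/-- The renewal equation for `C_n`: in front of a renewal point `s ≤ n - M` the boundary sequence
vanishes, and behind it it is again padded. -/
theorem normC_recursion {q : ℕ} (hq : 2 ≤ q) {γ : ℝ} (hγ : 0 < γ) {M : ℕ} {b₂ : Fin M → ℕ}
    (hb : Monotone b₂) {n : ℕ} (hn : 1 ≤ n) (hM : M ≤ n) :
    normC q γ b₂ n = (∑ j ∈ (Ico 1 n).filter (fun j => j ≤ n - M),
      alpha q γ j * normC q γ b₂ (n - j)) + beta q γ b₂ n := by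
  have hm := monotone_padded hb n
  rw [normC_eq hγ hb, blockWeight_eq (by omega) γ (monotone_extend hm) 0 n (n - M), beta,
    if_pos ⟨hn, hM⟩, normSq_psiPart q hγ hm, block_extend]
  congr 1
  refine Finset.sum_congr rfl fun s hs => ?_
  obtain ⟨h1, h2⟩ := mem_filter.1 hs
  rw [alpha_eq hγ (mem_Ico.1 h1).1, normC, normSq_psi q hγ (monotone_padded hb _), irredWeight,
    block_extend_padded_left b₂ h2, blockWeight, block_extend_padded_right b₂ hM h2]
  rfl

/-- For the zero sequence the renewal equation preserves the bound, since `∑ αₙ rⁿ ≤ 1`. -/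
theorem blockWeight_zero_mul_pow_le {q : ℕ} (hq : 2 ≤ q) {γ r : ℝ} (hγ : 0 < γ) (hr : 0 < r)
    (hs : HasSum (fun n => alpha q γ n * r ^ n) 1) (n : ℕ) :
    blockWeight q γ 0 0 n * r ^ n ≤ 1 := by
  induction n using Nat.strong_induction_on with
  | _ n ih =>
    rcases Nat.eq_zero_or_pos n with rfl | hn
    · rw [blockWeight_zero, pow_zero, one_mul]
    rw [blockWeight_eq_sum (by omega) γ (fun _ _ _ => le_rfl) 0 hn, Finset.sum_mul]
    refine le_trans (Finset.sum_le_sum fun t ht => ?_)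
      (sum_le_hasSum (Ioc 0 n) (fun t _ => mul_nonneg (alpha_nonneg q hγ t) (by positivity)) hs)
    obtain ⟨h1, h2⟩ := mem_Ioc.1 ht
    calc irredWeight q γ 0 0 t * blockWeight q γ 0 (0 + t) (n - t) * r ^ n
        = alpha q γ t * r ^ t * (blockWeight q γ 0 0 (n - t) * r ^ (n - t)) := by
          rw [alpha_eq hγ h1, ← Nat.add_sub_cancel' h2, pow_add, Nat.add_sub_cancel_left]
          change irredWeight q γ 0 0 t * blockWeight q γ 0 0 (n - t) * _ = _
          ring
      _ ≤ alpha q γ t * r ^ t * 1 :=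
          mul_le_mul_of_nonneg_left (ih (n - t) (by omega))
            (mul_nonneg (alpha_nonneg q hγ t) (by positivity))
      _ = _ := mul_one _

/-- Among all boundary sequences the constant one has the largest norm, so `C_N ≤ r⁻ᴺ`. -/
theorem normC_mul_pow_le {q : ℕ} (hq : 2 ≤ q) {γ r : ℝ} (hγ : 0 < γ)
    (hC : 0 < decayConst q γ) (hr : 0 < r) (hs : HasSum (fun n => alpha q γ n * r ^ n) 1)
    {M : ℕ} {b₂ : Fin M → ℕ} (hb : Monotone b₂) (n : ℕ) : normC q γ b₂ n * r ^ n ≤ 1 := by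
  have hm := monotone_extend (monotone_padded hb n)
  refine le_trans (mul_le_mul_of_nonneg_right ?_ (by positivity))
    (blockWeight_zero_mul_pow_le hq hγ hr hs n)
  rw [normC_eq hγ hb]
  refine blockWeight_le_zero hq (eight_mul_add_two_le_sq hq hC) n
    (extend (padded b₂ n) (n - 1) - extend (padded b₂ n) 0) _ hm ?_
  have := hm (Nat.zero_le (n - 1))
  omega

theorem beta_nonneg (q : ℕ) {γ : ℝ} (hγ : 0 < γ) {M : ℕ} {b₂ : Fin M → ℕ} (hb : Monotone b₂)
    (n : ℕ) : 0 ≤ beta q γ b₂ n := by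
  unfold beta
  split_ifs
  · rw [normSq_psiPart q hγ (monotone_padded hb n)]
    exact partWeight_nonneg _ _ _ _
  · exact le_rfl

theorem betaHat_nonneg (q : ℕ) {γ : ℝ} (hγ : 0 < γ) {M : ℕ} {b₂ : Fin M → ℕ}
    (hb : Monotone b₂) (n : ℕ) : 0 ≤ betaHat q γ b₂ n := by
  unfold betaHat psiHat
  split_ifs
  · rw [normSq_psiPart q hγ (monotone_padded hb n)]
    exact partWeight_nonneg _ _ _ _
  · exact le_rfl

theorem summable_beta_mul_pow {q : ℕ} (hq : 2 ≤ q) {γ : ℝ} (hγ : 0 < γ)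
    (hC : 0 < decayConst q γ) {M : ℕ} {b₂ : Fin M → ℕ} (hb : Monotone b₂) :
    Summable fun n => beta q γ b₂ n * Real.exp (decayConst q γ * q) ^ n := by
  refine summable_mul_pow_of_le (beta_nonneg q hγ hb) (H := (2 * Real.exp q) ^ 2)
    (η := 4 * Real.exp (-(γ ^ 2 * q))) (by positivity) (by positivity)
    (Real.exp_pos _).le ((ratio_le_half hq γ).trans_lt (by norm_num)) (M + 1) fun n => ?_
  -- `M + 1` rather than `M`, as for `M = 0` the position `n` is not a possible renewal point
  unfold beta
  split_ifs with h
  · rw [normSq_psiPart q hγ (monotone_padded hb n), pow_right_comm]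
    exact partWeight_no_renewal_le (four_mul_exp_le_one hq hC) (monotone_padded hb n)
      (by omega) fun μ hμ s hs => hμ s (by omega)
  · positivity

theorem summable_betaHat_mul_pow {q : ℕ} (hq : 2 ≤ q) {γ : ℝ} (hγ : 0 < γ)
    (hC : 0 < decayConst q γ) {M : ℕ} {b₂ : Fin M → ℕ} (hb : Monotone b₂) :
    Summable fun n => betaHat q γ b₂ n * Real.exp (decayConst q γ * q) ^ n := by
  refine summable_mul_pow_of_le (betaHat_nonneg q hγ hb) (H := (2 * Real.exp q) ^ 2)
    (η := 4 * Real.exp (-(γ ^ 2 * q))) (by positivity) (by positivity)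
    (Real.exp_pos _).le ((ratio_le_half hq γ).trans_lt (by norm_num)) 1 fun n => ?_
  unfold betaHat psiHat
  split_ifs with h
  · rw [normSq_psiPart q hγ (monotone_padded hb n), pow_right_comm]
    exact partWeight_no_renewal_le (four_mul_exp_le_one hq hC) (monotone_padded hb n)
      (by omega) fun μ hμ s _ => hμ s
  · positivity

/-- At the smallest admissible length there is no room for a renewal point. -/
theorem beta_max_pos {q : ℕ} (hq : 2 ≤ q) {γ : ℝ} (hγ : 0 < γ) {M : ℕ} {b₂ : Fin M → ℕ}
    (hb : Monotone b₂) : 0 < beta q γ b₂ (max 1 M) := by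
  have h1 := normC_recursion hq hγ hb (le_max_left 1 M) (le_max_right 1 M)
  rw [Finset.filter_eq_empty_iff.2 fun j hj => ?_, Finset.sum_empty, zero_add] at h1
  · rw [← h1]
    linarith [one_le_normC hq hγ hb (max 1 M)]
  · have := mem_Ico.1 hj
    omega

/-! ### The renewal limit -/

/-- The normalized norms `C_n rⁿ`, set to zero at lengths that are not admissible. -/
noncomputable def scaledNorm (q : ℕ) (γ r : ℝ) {M : ℕ} (b₂ : Fin M → ℕ) (n : ℕ) : ℝ :=
  if 1 ≤ n ∧ M ≤ n then normC q γ b₂ n * r ^ n else 0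

theorem scaledNorm_recursion {q : ℕ} (hq : 2 ≤ q) {γ : ℝ} (hγ : 0 < γ) (r : ℝ) {M : ℕ}
    {b₂ : Fin M → ℕ} (hb : Monotone b₂) (n : ℕ) :
    scaledNorm q γ r b₂ n =
      ∑ x ∈ antidiagonal n, alpha q γ x.1 * r ^ x.1 * scaledNorm q γ r b₂ x.2 +
        beta q γ b₂ n * r ^ n := by
  rw [Finset.Nat.sum_antidiagonal_eq_sum_range_succ
    fun i j => alpha q γ i * r ^ i * scaledNorm q γ r b₂ j]
  by_cases h : 1 ≤ n ∧ M ≤ n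
  · rw [scaledNorm, if_pos h, normC_recursion hq hγ hb h.1 h.2, add_mul, Finset.sum_mul]
    congr 1
    refine Eq.trans (Finset.sum_congr rfl fun j hj => ?_)
      (Finset.sum_subset (s₁ := (Ico 1 n).filter fun j => j ≤ n - M) ?_ fun j hj hj' => ?_)
    · obtain ⟨h1, h2⟩ := mem_filter.1 hj
      have h3 := mem_Ico.1 h1
      rw [scaledNorm, if_pos (by omega)]
      have e : r ^ n = r ^ j * r ^ (n - j) := by rw [← pow_add, Nat.add_sub_cancel' h3.2.le]
      rw [e]
      ring
    · intro j hj
      have := mem_Ico.1 (mem_filter.1 hj).1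
      exact mem_range.2 (by omega)
    · rcases Nat.eq_zero_or_pos j with rfl | hj0
      · rw [alpha_zero, zero_mul, zero_mul]
      · rw [scaledNorm, if_neg, mul_zero]
        intro h1
        exact hj' (mem_filter.2 ⟨mem_Ico.2 ⟨hj0, by omega⟩, by omega⟩)
  · rw [scaledNorm, if_neg h, beta, if_neg h, zero_mul, add_zero, Finset.sum_eq_zero]
    intro j _
    rw [scaledNorm, if_neg (by omega), mul_zero]

/-- The mean `μ = ∑ n αₙ rⁿ` and the limit of `C_n rⁿ` with its exponential rate. -/
theorem exists_mean_and_rate {q : ℕ} (hq : 2 ≤ q) {γ r : ℝ} (hγ : 0 < γ)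
    (hC : 0 < decayConst q γ) (hr : 0 < r) (hr1 : r < 1)
    (hs : HasSum (fun n => alpha q γ n * r ^ n) 1) :
    ∃ μ : ℝ, 0 < μ ∧ HasSum (fun n : ℕ => (n : ℝ) * (alpha q γ n * r ^ n)) μ ∧
      ∀ (M : ℕ) (b₂ : Fin M → ℕ), Monotone b₂ → ∃ K, ∀ n,
        |scaledNorm q γ r b₂ n - (∑' n, beta q γ b₂ n * r ^ n) / μ| ≤
          K * ((Real.exp (decayConst q γ * q) / r) ^ n)⁻¹ := by
  set ρ := Real.exp (decayConst q γ * q) with hρ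
  set H := (2 * Real.exp q) ^ 2 with hH
  set ξ := H * (4 * Real.exp (-(γ ^ 2 * q))) * ρ with hξ
  set f := fun n => alpha q γ n * r ^ n with hf
  have hρ1 : 1 < ρ := one_lt_exp_decayConst hq hC
  have hH0 : 0 ≤ H := by positivity
  have hξ0 : 0 ≤ ξ := by positivity
  have hξ1 : ξ ≤ 1 / 2 := ratio_le_half hq γ
  have hξ2 : 4 * H * ξ ≤ 1 / 2 := ratio_small hq γ
  have hf0 : ∀ n, 0 ≤ f n := fun n => mul_nonneg (alpha_nonneg q hγ n) (by positivity)
  have hfz : f 0 = 0 := by simp [hf, alpha_zero]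
  have hw : 1 ≤ ρ / r := by rw [le_div_iff₀ hr]; linarith
  have hbound : ∀ n, 1 ≤ n → alpha q γ n * ρ ^ (n - 1) ≤ H * ξ ^ (n - 1) := by
    intro n hn
    obtain ⟨m, rfl⟩ := Nat.exists_eq_add_of_le' hn
    refine (mul_le_mul_of_nonneg_right (alpha_le hq hγ hC _) (by positivity)).trans_eq ?_
    rw [Nat.add_sub_cancel, ← hH, hξ]
    clear_value H
    ring
  have hT := distTail_mul_pow_le (alpha_nonneg q hγ) hr hr1.le hρ1.le hH0 hξ0 hξ1 hbound hs
  have hT1 : ∀ k, distTail f k ≤ 2 * H * ξ ^ k := fun k =>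
    (le_mul_of_one_le_right (distTail_nonneg hf0 hs k) (one_le_pow₀ hw)).trans (hT k)
  obtain ⟨hTs, hmean⟩ := hasSum_mul_of_distTail_le hf0 hs hξ0 (by linarith) hT1
  have hθ : ∀ N, ∑ k ∈ range N, distTail f (k + 1) * (ρ / r) ^ (k + 1) ≤ 1 / 2 := by
    intro N
    have hg : ∑ k ∈ range N, (1 / 2 : ℝ) ^ k ≤ 2 :=
      sum_le_hasSum _ (fun k _ => by positivity) hasSum_geometric_two
    calc ∑ k ∈ range N, distTail f (k + 1) * (ρ / r) ^ (k + 1)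
        ≤ ∑ k ∈ range N, 2 * H * ξ * (1 / 2) ^ k := by
          refine Finset.sum_le_sum fun k _ => (hT (k + 1)).trans ?_
          rw [pow_succ', ← mul_assoc]
          exact mul_le_mul_of_nonneg_left (pow_le_pow_left₀ hξ0 hξ1 k) (by positivity)
      _ = 2 * H * ξ * ∑ k ∈ range N, (1 / 2 : ℝ) ^ k := by rw [Finset.mul_sum]
      _ ≤ 2 * H * ξ * 2 := mul_le_mul_of_nonneg_left hg (by positivity)
      _ ≤ 1 / 2 := by linarith
  have hμ : 0 < ∑' k, distTail f k :=
    hTs.tsum_pos (distTail_nonneg hf0 hs) 0 (by simp [distTail, hfz])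
  refine ⟨∑' k, distTail f k, hμ, hmean, fun M b₂ hb => ?_⟩
  refine abs_sub_renewal_limit_le hf0 hfz hs (scaledNorm_recursion hq hγ r hb) hw
    (by norm_num : (1 / 2 : ℝ) < 1) hθ hTs ?_
  refine (summable_beta_mul_pow hq hγ hC hb).congr fun n => ?_
  rw [abs_of_nonneg (mul_nonneg (beta_nonneg q hγ hb n) (by positivity)), mul_assoc, ← mul_pow,
    mul_div_cancel₀ _ hr.ne']

theorem hasSum_beta_mul_pow {q : ℕ} (hq : 2 ≤ q) {γ r : ℝ} (hγ : 0 < γ)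
    (hC : 0 < decayConst q γ) (hr : 0 < r) (hr1 : r < 1) {M : ℕ} {b₂ : Fin M → ℕ}
    (hb : Monotone b₂) :
    HasSum (fun n => beta q γ b₂ n * r ^ n) (∑' n, beta q γ b₂ n * r ^ n) ∧
      0 < ∑' n, beta q γ b₂ n * r ^ n := by
  have hnn : ∀ n, 0 ≤ beta q γ b₂ n * r ^ n := fun n =>
    mul_nonneg (beta_nonneg q hγ hb n) (by positivity)
  have hsum : Summable fun n => beta q γ b₂ n * r ^ n :=
    Summable.of_nonneg_of_le hnn (fun n => mul_le_mul_of_nonneg_left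
      (pow_le_pow_left₀ hr.le (hr1.trans (one_lt_exp_decayConst hq hC)).le n)
      (beta_nonneg q hγ hb n)) (summable_beta_mul_pow hq hγ hC hb)
  exact ⟨hsum.hasSum, hsum.tsum_pos hnn (max 1 M) (mul_pos (beta_max_pos hq hγ hb) (by positivity))⟩

/-- If `Cₙ rⁿ` has a positive limit then `Cₙ` grows at the rate `r⁻¹`. -/
theorem tendsto_log_div {C : ℕ → ℝ} {r c : ℝ} (hr : 0 < r) (hc : 0 < c) (hC : ∀ n, 0 < C n)
    (h : Tendsto (fun n => C n * r ^ n) atTop (𝓝 c)) :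
    Tendsto (fun n : ℕ => Real.log (C n) / n) atTop (𝓝 (Real.log r⁻¹)) := by
  have h1 : Tendsto (fun n : ℕ => Real.log (C n * r ^ n) / (n : ℝ)) atTop (𝓝 0) :=
    (h.log hc.ne').div_atTop tendsto_natCast_atTop_atTop
  have h2 := h1.add_const (Real.log r⁻¹)
  rw [zero_add] at h2
  refine h2.congr' ?_
  filter_upwards [eventually_ge_atTop 1] with n hn
  have hn' : (n : ℝ) ≠ 0 := by exact_mod_cast (by omega : n ≠ 0)
  rw [Real.log_mul (hC n).ne' (by positivity), Real.log_pow, Real.log_inv]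
  field_simp
  ring

theorem rateBound_le {q : ℕ} {γ r : ℝ} (hq : 2 ≤ q) (hC : 0 < decayConst q γ) (hr : 0 < r)
    (l : ℕ) : rateBound q γ r l ≤ Real.exp (decayConst q γ * q) / r := by
  have h1 : Real.exp (-(decayConst q γ * q)) < 1 :=
    Real.exp_lt_one_iff.2 (neg_lt_zero.2 (mul_pos hC (by exact_mod_cast (by omega : 0 < q))))
  have h2 : 0 ≤ Real.exp (-(l : ℝ)) / (1 - Real.exp (-(decayConst q γ * q))) :=
    div_nonneg (Real.exp_pos _).le (by linarith)
  refine mul_le_of_le_one_right (by positivity) ?_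
  rw [div_le_one (by linarith)]
  linarith

end FQH

theorem mainTheorem11 (q : ℕ) (hq : 2 ≤ q) (γ : ℝ) (hγ : 0 < γ)
    (hC : 0 < FQH.decayConst q γ) :
    ∃ r : ℝ, 0 < r ∧ 1 < r⁻¹ ∧
      (∀ z : ℂ, ‖z‖ < Real.exp (FQH.decayConst q γ * q) →
        Summable fun n : ℕ => (FQH.alpha q γ n : ℂ) * z ^ n) ∧
      ∃ μ : ℝ, 0 < μ ∧ HasSum (fun n : ℕ => (n : ℝ) * FQH.alpha q γ n * r ^ n) μ ∧
      ∀ (M : ℕ) (b₂ : Fin M → ℕ), Monotone b₂ →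
        Tendsto (fun N : ℕ => Real.log (FQH.normC q γ b₂ N) / N) atTop (𝓝 (Real.log r⁻¹)) ∧
        IsLUB {x : ℝ | ∃ N : ℕ, 1 ≤ N ∧ M ≤ N ∧ x = Real.log (FQH.normC q γ b₂ N) / N}
          (Real.log r⁻¹) ∧
        (∀ n : ℕ, 1 ≤ n → M ≤ n →
          FQH.normC q γ b₂ n =
            (∑ j ∈ (Finset.Ico 1 n).filter (fun j => j ≤ n - M),
              FQH.alpha q γ j * FQH.normC q γ b₂ (n - j)) + FQH.beta q γ b₂ n) ∧
        (∀ z : ℂ, ‖z‖ < Real.exp (FQH.decayConst q γ * q) →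
          Summable (fun n : ℕ => (FQH.betaHat q γ b₂ n : ℂ) * z ^ n) ∧
          Summable (fun n : ℕ => (FQH.beta q γ b₂ n : ℂ) * z ^ n)) ∧
        ∃ B : ℝ, HasSum (fun n : ℕ => FQH.beta q γ b₂ n * r ^ n) B ∧
          ∀ R : ℝ, 0 < R → R < FQH.rateBound q γ r (FQH.lastEntry b₂) →
            (fun n : ℕ => FQH.normC q γ b₂ n * r ^ n - B / μ) =O[atTop]
              (fun n : ℕ => (R ^ n)⁻¹) := by
  obtain ⟨r, hr, hr1, hs⟩ := FQH.exists_hasSum_alpha_mul_pow hq hγ hC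
  obtain ⟨μ, hμ, hmean, hrate⟩ := FQH.exists_mean_and_rate hq hγ hC hr hr1 hs
  refine ⟨r, hr, (one_lt_inv₀ hr).2 hr1, fun z hz => FQH.summable_ofReal_mul_pow
    (FQH.alpha_nonneg q hγ) (FQH.summable_alpha_mul_pow hq hγ hC) hz, μ, hμ, ?_,
    fun M b₂ hb => ?_⟩
  · simpa only [mul_assoc] using hmean
  obtain ⟨K, hK⟩ := hrate M b₂ hb
  obtain ⟨hB, hB0⟩ := FQH.hasSum_beta_mul_pow hq hγ hC hr hr1 hb
  set B := ∑' n, FQH.beta q γ b₂ n * r ^ n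
  set w := Real.exp (FQH.decayConst q γ * q) / r with hw
  have hw1 : 1 < w := by
    rw [hw, lt_div_iff₀ hr]
    linarith [FQH.one_lt_exp_decayConst hq hC]
  have hK0 : 0 ≤ K := by
    have := (abs_nonneg _).trans (hK 0)
    simpa using this
  have hadm : ∀ᶠ n : ℕ in atTop, |FQH.normC q γ b₂ n * r ^ n - B / μ| ≤ K * (w ^ n)⁻¹ := by
    filter_upwards [eventually_ge_atTop (max 1 M)] with n hn
    have := hK n
    rwa [FQH.scaledNorm, if_pos (by omega)] at this
  have hlim : Tendsto (fun n => FQH.normC q γ b₂ n * r ^ n) atTop (𝓝 (B / μ)) := by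
    rw [tendsto_iff_norm_sub_tendsto_zero]
    have h0 : Tendsto (fun n : ℕ => K * (w ^ n)⁻¹) atTop (𝓝 0) := by
      simpa using (tendsto_inv_atTop_zero.comp (tendsto_pow_atTop_atTop_of_one_lt hw1)).const_mul K
    exact squeeze_zero' (Eventually.of_forall fun n => norm_nonneg _) hadm h0
  have hlog := FQH.tendsto_log_div hr (div_pos hB0 hμ)
    (fun n => zero_lt_one.trans_le (FQH.one_le_normC hq hγ hb n)) hlim
  refine ⟨hlog, ⟨?_, fun x hx => ?_⟩, fun n hn hM => FQH.normC_recursion hq hγ hb hn hM,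
    fun z hz => ⟨FQH.summable_ofReal_mul_pow (FQH.betaHat_nonneg q hγ hb)
      (FQH.summable_betaHat_mul_pow hq hγ hC hb) hz, FQH.summable_ofReal_mul_pow
      (FQH.beta_nonneg q hγ hb) (FQH.summable_beta_mul_pow hq hγ hC hb) hz⟩,
    B, hB, fun R hR0 hR => ?_⟩
  · rintro x ⟨N, hN, -, rfl⟩
    have hN' : (0 : ℝ) < N := by exact_mod_cast hN
    rw [div_le_iff₀ hN', mul_comm, ← Real.log_pow]
    refine Real.log_le_log (zero_lt_one.trans_le (FQH.one_le_normC hq hγ hb N)) ?_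
    rw [inv_pow, ← one_div, le_div_iff₀ (by positivity)]
    exact FQH.normC_mul_pow_le hq hγ hC hr hs hb N
  · refine le_of_tendsto hlog ?_
    filter_upwards [eventually_ge_atTop (max 1 M)] with N hN
    exact hx ⟨N, by omega, by omega, rfl⟩
  · refine Asymptotics.IsBigO.of_bound K ?_
    filter_upwards [hadm] with n hn
    rw [Real.norm_of_nonneg (by positivity : 0 ≤ (R ^ n)⁻¹)]
    refine hn.trans (mul_le_mul_of_nonneg_left ?_ hK0)
    exact inv_anti₀ (by positivity)
      (pow_le_pow_left₀ hR0.le (hR.le.trans (FQH.rateBound_le hq hC hr _)) n)
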